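/- **Setting.** Let $\mathbb A$ be a finite set of actions with at least two elements, $\Theta$ a finite set of post-change parameters, and let $f_a^{\theta_0}$ (pre-change) and $f_a^{\theta}$ (post-change, $\theta\in\Theta$), $a\in\mathbb A$, be probability densities with respect to a common dominating measure $\lambda$ on a measurable space. Put $D(f\|g)=\int f\log(f/g)\,d\lambda$ (with $\log 0=-\infty$ and $\log(c/0)=+\infty$ for $c>0$), $I_a^\theta=D(f_a^\theta\|f_a^{\theta_0})$ and $I^\theta=\max_{a}I_a^\theta$. Assume that 1. for every $\theta\in\Theta$ there is $a\in\mathbb A$ with $I_a^\theta>0$; 2. there is $V<\infty$ with $\int(\log(f_a^\theta/f_a^{\theta_0}))^2f_a^\theta\,d\lambda<V$ for all $\theta\in\Theta$, $a\in\mathbb A$; 3. for all $\theta\ne\tilde\theta$ in $\Theta$ there is $a\in\mathbb A$ with $D(f_a^\theta\|f_a^{\tilde\theta})>0$; 4. $D(f_a^\theta\|f_a^{\tilde\theta})<\infty$ for all $\theta,\tilde\theta\in\Theta$, $a\in\mathbb A$. At each time $n=1,2,\dots$ an action $A_n\in\mathbb A$ is taken, an observation $X_n$ is made, and a randomization variable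 $U_n$ is drawn. $A_1$ is uniform on $\mathbb A$. Let $\mathcal F_0$ be trivial and let $\mathcal F_n$ be generated by $A_1,X_1,\dots,X_n,U_1,\dots,U_n$. A control policy $A=(A_n)$ is such that $A_n$ is $\mathcal F_{n-1}$-measurable for $n\ge2$. Given the past and $A_n$, $X_n$ and $U_n$ are independent, $U_n$ is uniform on $[0,1]$, and $X_n$ has density $f^{\theta_0}_{A_n}$ for $n<\nu$ and $f^\theta_{A_n}$ for $n\ge\nu$ under $\mathsf P^\theta_{\nu,A}$ (change-point $\nu\ge1$), and density $f^{\theta_0}_{A_n}$ for all $n$ under $\mathsf P_{\infty,A}$ (no change). A procedure is a pair $(A,T)$ of a control policy and an $(\mathcal F_n)$-stopping time $T\le\infty$. For $\gamma\in\mathbb R$ let $\mathcal C_\gamma$ be the set of procedures with $\mathsf E_{\infty,A}[T]\ge\gamma$. Lorden's delay of a procedure is $$\mathcal J_\theta(A,T)=\sup_{\nu\ge1}\ \operatorname{ess\,sup}\ \mathsf E^\theta_{\nu,A}\big[(T-\nu+1)^+\,\big|\,\mathcal F_{\nu-1}\big].$$ **The Windowed Chernoff-CuSum procedure.** Let $0<q<w$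 be integers, $b\in\mathbb R$, and let $\mathcal N\subseteq\{w+1,w+2,\dots\}$ be a deterministic set of exploration times such that $|\mathcal N\cap[w+1,w+n]|\le nq/w$ for all $n\ge1$ and $|\mathcal N\cap[m+1,m+w]|\ge q$ for all $m\ge w$. For $n>w$ let $\hat\theta_n$ be an $\mathcal F_{n-1}$-measurable maximizer of $\vartheta\mapsto\sum_{m=n-w}^{n-1}\log f^\vartheta_{A_m}(X_m)$ over $\Theta$. The policy $A^*$ takes $A_1^*$ uniform on $\mathbb A$; for $2\le n\le w$ and for $n\in\mathcal N$ it takes $A_n^*$ to be a function of $U_{n-1}$ that is uniformly distributed on $\mathbb A$; for $n>w$ with $n\notin\mathcal N$ it takes $A_n^*\in\arg\max_aI_a^{\hat\theta_n}$, with $A_n^*$ $\mathcal F_{n-1}$-measurable. Ties in both maximizations may be broken arbitrarily. With $W_w=0$ and $$W_n=\max\{W_{n-1},0\}+\log\frac{f^{\hat\theta_n}_{A_n}(X_n)}{f^{\theta_0}_{A_n}(X_n)}\quad(n>w),$$ the procedure is $(A^*,T_b)$ with $T_b=\inf\{n>w:W_n\ge b\}$. **Claim.** For every $\theta\in\Theta$,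 as $\gamma\to\infty$, $$\inf_{(A,T)\in\mathcal C_\gamma}\mathcal J_\theta(A,T)\sim\frac{\log\gamma}{I^\theta}.$$ Moreover, take the Windowed Chernoff-CuSum procedure with $b=\log\gamma$. It belongs to $\mathcal C_\gamma$ whenever $\gamma>1$, and, as $q,w,\gamma\to\infty$ so that $q=o(w)$ and $w=o(\log\gamma)$, for every $\theta\in\Theta$, $$\mathcal J_\theta(A^*,T_b)\ \sim\ \inf_{(A,T)\in\mathcal C_\gamma}\mathcal J_\theta(A,T)\ \sim\ \frac{\log\gamma}{I^\theta},$$ where $x\sim y$ means $x/y\to1$; that is, the procedure is first-order asymptotically optimal, simultaneously for all $\theta$. -/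

import Mathlib

open MeasureTheory ProbabilityTheory Filter Topology Asymptotics
open scoped ENNReal NNReal

noncomputable section

/-- A probability density with respect to the dominating measure `lam`. -/
structure Density {E : Type*} [MeasurableSpace E] (lam : Measure E) where
  toFun : E → ℝ≥0
  measurable' : Measurable toFun
  lintegral_eq_one : ∫⁻ x, (toFun x : ℝ≥0∞) ∂lam = 1

/-- The probability measure with density `f`. -/
def Density.toMeasure {E : Type*} [MeasurableSpace E] {lam : Measure E} (f : Density lam) :
    Measure E :=
  lam.withDensity (fun x => (f.toFun x : ℝ≥0∞))

instance Density.isProbabilityMeasure {E : Type*} [MeasurableSpace E] {lam : Measure E}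
    (f : Density lam) : IsProbabilityMeasure f.toMeasure :=
  ⟨by simpa [Density.toMeasure] using f.lintegral_eq_one⟩

/-- The logarithm of the ratio `f / g` of two densities at `x`, with `log 0 = -∞` and
`log (c / 0) = +∞` for `c > 0`. -/
def logRatio {E : Type*} [MeasurableSpace E] {lam : Measure E} (f g : Density lam) (x : E) :
    EReal :=
  ENNReal.log ((f.toFun x : ℝ≥0∞) / (g.toFun x : ℝ≥0∞))

/-- The record of one time step: the action `A_n`, the observation `X_n` and the randomization
variable `U_n`. -/
abbrev Step (𝔸 E : Type*) := 𝔸 × E × unitInterval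

/-- The path space. Times are `1, 2, …`; the record of time `n` is the coordinate `n - 1`. -/
abbrev RunPath (𝔸 E : Type*) := ℕ → Step 𝔸 E

/-- The recorded action `A_n`, for `n ≥ 1`. -/
def RunPath.A {𝔸 E : Type*} (n : ℕ) (ω : RunPath 𝔸 E) : 𝔸 := (ω (n - 1)).1

/-- The observation `X_n`, for `n ≥ 1`. -/
def RunPath.X {𝔸 E : Type*} (n : ℕ) (ω : RunPath 𝔸 E) : E := (ω (n - 1)).2.1

/-- The randomization variable `U_n`, for `n ≥ 1`. -/
def RunPath.U {𝔸 E : Type*} (n : ℕ) (ω : RunPath 𝔸 E) : unitInterval := (ω (n - 1)).2.2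

/-- The information `F_n` available at time `n`, generated by the records of the times `1, …, n`;
`F_0` is trivial. Under the law of a control policy every action `A_n` with `n ≥ 2` is almost
surely a function of `A_1` and of the observations and randomization variables before `n`. -/
def history (𝔸 E : Type*) [MeasurableSpace 𝔸] [MeasurableSpace E] :
    Filtration ℕ (inferInstance : MeasurableSpace (RunPath 𝔸 E)) where
  seq n := ⨆ i : Fin n, MeasurableSpace.comap (fun ω : RunPath 𝔸 E => ω i) inferInstance
  mono' _ _ hmn :=
    iSup_le fun i => le_iSup_of_le (Fin.castLE hmn i) le_rfl
  le' _ := iSup_le fun i => (measurable_pi_apply (i : ℕ)).comap_le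

/-- A control policy. The first action is drawn uniformly at random; the action at time `n + 2`
is `act n` applied to the records of the times `1, …, n + 1`. -/
structure Policy (𝔸 E : Type*) [MeasurableSpace 𝔸] [MeasurableSpace E] where
  act : (n : ℕ) → ((Finset.Iic n) → Step 𝔸 E) → 𝔸
  measurable_act : ∀ n, Measurable (act n)

/-- The action at time `n` (for `n ≥ 2`) which the policy prescribes along the path `ω`. -/
def Policy.action {𝔸 E : Type*} [MeasurableSpace 𝔸] [MeasurableSpace E] (π : Policy 𝔸 E)
    (n : ℕ) (ω : RunPath 𝔸 E) : 𝔸 :=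
  π.act (n - 2) (fun i => ω i)

/-- Given the action `a`, the record of a time step is `(a, X, U)`, with `X` of density `g a` and
`U` uniform on `[0,1]`, independent of each other. -/
def stepKernel {𝔸 E : Type*} [MeasurableSpace 𝔸] [Countable 𝔸] [MeasurableSingletonClass 𝔸]
    [MeasurableSpace E] {lam : Measure E} (g : 𝔸 → Density lam) : Kernel 𝔸 (Step 𝔸 E) :=
  Kernel.ofFunOfCountable fun a =>
    (Measure.dirac a).prod ((g a).toMeasure.prod (volume : Measure unitInterval))

instance stepKernel.isMarkovKernel {𝔸 E : Type*} [MeasurableSpace 𝔸] [Countable 𝔸]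
    [MeasurableSingletonClass 𝔸] [MeasurableSpace E] {lam : Measure E} (g : 𝔸 → Density lam) :
    IsMarkovKernel (stepKernel g) :=
  ⟨fun a => inferInstanceAs (IsProbabilityMeasure
    ((Measure.dirac a).prod ((g a).toMeasure.prod (volume : Measure unitInterval))))⟩

/-- The uniform distribution on the finite set of actions. -/
def uniformAction (𝔸 : Type*) [Fintype 𝔸] [Nonempty 𝔸] [MeasurableSpace 𝔸] : Measure 𝔸 :=
  (PMF.uniformOfFintype 𝔸).toMeasure

/-- The law of the path when the policy `π` is used and, for every `n ≥ 1`, the observation `X_n`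
has conditional density `g n a` given that `A_n = a`. -/
def pathLaw {𝔸 E : Type*} [Fintype 𝔸] [Nonempty 𝔸] [MeasurableSpace 𝔸]
    [MeasurableSingletonClass 𝔸] [MeasurableSpace E] {lam : Measure E}
    (g : ℕ → 𝔸 → Density lam) (π : Policy 𝔸 E) : Measure (RunPath 𝔸 E) :=
  Kernel.trajMeasure (X := fun _ => Step 𝔸 E) (stepKernel (g 1) ∘ₘ uniformAction 𝔸)
    (fun n => (stepKernel (g (n + 2))).comap (π.act n) (π.measurable_act n))

/-- The law `P_{∞,A}`, under which the change never occurs. -/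
def lawNoChange {𝔸 E : Type*} [Fintype 𝔸] [Nonempty 𝔸] [MeasurableSpace 𝔸]
    [MeasurableSingletonClass 𝔸] [MeasurableSpace E] {lam : Measure E}
    (pre : 𝔸 → Density lam) (π : Policy 𝔸 E) : Measure (RunPath 𝔸 E) :=
  pathLaw (fun _ => pre) π

/-- The law `P_{ν,A}^θ` with change-point `ν`, where `post` is the family of densities of the
post-change parameter `θ`. -/
def lawChange {𝔸 E : Type*} [Fintype 𝔸] [Nonempty 𝔸] [MeasurableSpace 𝔸]
    [MeasurableSingletonClass 𝔸] [MeasurableSpace E] {lam : Measure E}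
    (pre post : 𝔸 → Density lam) (ν : ℕ) (π : Policy 𝔸 E) : Measure (RunPath 𝔸 E) :=
  pathLaw (fun n => if n < ν then pre else post) π

/-- The class `C_γ` of pairs of a control policy and a stopping time (possibly infinite) whose
mean time to false alarm is at least `γ`. -/
def procedureClass {𝔸 E : Type*} [Fintype 𝔸] [Nonempty 𝔸] [MeasurableSpace 𝔸]
    [MeasurableSingletonClass 𝔸] [MeasurableSpace E] {lam : Measure E}
    (pre : 𝔸 → Density lam) (γ : ℝ) : Set (Policy 𝔸 E × (RunPath 𝔸 E → ℕ∞)) :=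
  {p | (∀ n : ℕ, MeasurableSet[history 𝔸 E n] {ω | p.2 ω = n}) ∧
    ENNReal.ofReal γ ≤ ∫⁻ ω, (p.2 ω : ℝ≥0∞) ∂(lawNoChange pre p.1)}

/-- Lorden's worst-case delay `sup_{ν ≥ 1} ess sup E_ν[(T - ν + 1)^+ | F_{ν-1}]`. Subtraction in
`ℝ≥0∞` is truncated at `0`, so that `T + 1 - ν` is the positive part. -/
def lordenDelay {𝔸 E : Type*} [Fintype 𝔸] [Nonempty 𝔸] [MeasurableSpace 𝔸]
    [MeasurableSingletonClass 𝔸] [MeasurableSpace E] {lam : Measure E}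
    (pre post : 𝔸 → Density lam) (p : Policy 𝔸 E × (RunPath 𝔸 E → ℕ∞)) : ℝ≥0∞ :=
  ⨆ (ν : ℕ) (_ : 1 ≤ ν),
    essSup (condLExp (history 𝔸 E (ν - 1)) (lawChange pre post ν p.1)
      (fun ω => (p.2 ω : ℝ≥0∞) + 1 - (ν : ℝ≥0∞))) (lawChange pre post ν p.1)

/-- The infimum of Lorden's delay over the procedures with mean time to false alarm at least
`γ`. -/
def optimalDelay {𝔸 E : Type*} [Fintype 𝔸] [Nonempty 𝔸] [MeasurableSpace 𝔸]
    [MeasurableSingletonClass 𝔸] [MeasurableSpace E] {lam : Measure E}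
    (pre post : 𝔸 → Density lam) (γ : ℝ) : ℝ≥0∞ :=
  ⨅ p ∈ procedureClass pre γ, lordenDelay pre post p

/-- `I_a = D(f_a ‖ f_a^{θ₀})`. -/
def actionInfo {𝔸 E : Type*} [MeasurableSpace E] {lam : Measure E}
    (pre post : 𝔸 → Density lam) (a : 𝔸) : ℝ≥0∞ :=
  InformationTheory.klDiv (post a).toMeasure (pre a).toMeasure

/-- `I = max_a I_a`. -/
def maxInfo {𝔸 E : Type*} [MeasurableSpace E] {lam : Measure E}
    (pre post : 𝔸 → Density lam) : ℝ≥0∞ :=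
  ⨆ a, actionInfo pre post a

/-- The log-likelihood of the parameter `ϑ` in the window `{n - w, …, n - 1}`. -/
def windowLogLik {𝔸 E Θ : Type*} [MeasurableSpace E] {lam : Measure E}
    (post : Θ → 𝔸 → Density lam) (w n : ℕ) (ϑ : Θ) (ω : RunPath 𝔸 E) : EReal :=
  ∑ m ∈ Finset.Ico (n - w) n,
    ENNReal.log ((post ϑ (RunPath.A m ω)).toFun (RunPath.X m ω) : ℝ≥0∞)

/-- The statistic `W_n` for the sequence of estimators `est`: it is `0` for `n ≤ w` and satisfies
`W_n = max (W_{n-1}, 0) + Λ_n` for `n > w`, where `Λ_n` is the log-likelihood ratio of the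
observation `X_n` at the estimated parameter `est n`. -/
def cusum {𝔸 E Θ : Type*} [MeasurableSpace E] {lam : Measure E}
    (pre : 𝔸 → Density lam) (post : Θ → 𝔸 → Density lam) (w : ℕ) (est : ℕ → RunPath 𝔸 E → Θ)
    (ω : RunPath 𝔸 E) : ℕ → EReal
  | 0 => 0
  | n + 1 =>
    if n + 1 ≤ w then 0
    else max (cusum pre post w est ω n) 0 +
      logRatio (post (est (n + 1) ω) (RunPath.A (n + 1) ω)) (pre (RunPath.A (n + 1) ω))
        (RunPath.X (n + 1) ω)

/-- The first time `n > w` at which `W_n ≥ b`. -/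
def cusumTime {𝔸 E Θ : Type*} [MeasurableSpace E] {lam : Measure E}
    (pre : 𝔸 → Density lam) (post : Θ → 𝔸 → Density lam) (w : ℕ) (est : ℕ → RunPath 𝔸 E → Θ)
    (b : ℝ) (ω : RunPath 𝔸 E) : ℕ∞ :=
  ⨅ (n : ℕ) (_ : w < n ∧ (b : EReal) ≤ cusum pre post w est ω n), (n : ℕ∞)

/-- `N` is an admissible set of exploration times for the window size `w` and `q < w`. -/
structure IsExplorationSet (q w : ℕ) (N : Set ℕ) : Prop where
  q_pos : 0 < q
  q_lt : q < w
  subset : ∀ n ∈ N, w < n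
  sampling_le : ∀ n : ℕ, 1 ≤ n →
    ∑ i ∈ Finset.Icc (w + 1) (w + n), N.indicator (fun _ => (1 : ℝ)) i ≤ (n : ℝ) / w * q
  /-- Every window of `w` consecutive times after `w` contains at least `q` exploration times. -/
  le_window : ∀ m : ℕ, w ≤ m →
    (q : ℝ) ≤ ∑ i ∈ Finset.Icc (m + 1) (m + w), N.indicator (fun _ => (1 : ℝ)) i

/-- The policy `π` and the estimators `est` are those of a Windowed Chernoff-CuSum procedure with
parameters `q`, `w` and exploration times `N`; ties in the two maximizations may be broken in any
non-anticipating way. -/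
structure IsWindowedChernoff {𝔸 E Θ : Type*} [Fintype 𝔸] [Nonempty 𝔸] [MeasurableSpace 𝔸]
    [MeasurableSpace E] {lam : Measure E} (pre : 𝔸 → Density lam) (post : Θ → 𝔸 → Density lam)
    (q w : ℕ) (N : Set ℕ) (π : Policy 𝔸 E) (est : ℕ → RunPath 𝔸 E → Θ) : Prop where
  exploration_set : IsExplorationSet q w N
  /-- `est n` is `F_{n-1}`-measurable. -/
  measurable_est : ∀ n, w < n → ∀ ϑ : Θ, MeasurableSet[history 𝔸 E (n - 1)] {ω | est n ω = ϑ}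
  /-- `est n` is a maximum likelihood estimate over the last `w` observations. -/
  mle : ∀ n, w < n → ∀ ω ϑ, windowLogLik post w n ϑ ω ≤ windowLogLik post w n (est n ω) ω
  /-- At the times `n ≤ w` and `n ∈ N` the action is uniformly distributed and is a function of
  `U_{n-1}` (the action at time `1` is uniform under every policy). -/
  explore : ∀ n, 2 ≤ n → (n ≤ w ∨ n ∈ N) → ∃ φ : unitInterval → 𝔸,
    Measurable φ ∧ Measure.map φ volume = uniformAction 𝔸 ∧
      ∀ ω, π.action n ω = φ (RunPath.U (n - 1) ω)
  /-- At the other times the action maximizes the divergence at the estimated parameter. -/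
  exploit : ∀ n, w < n → n ∉ N → ∀ ω a,
    actionInfo pre (post (est n ω)) a ≤ actionInfo pre (post (est n ω)) (π.action n ω)

end

/-! The optimal delay is squeezed between a universal lower bound and the delay of the procedure
itself. Conditioning on the past is expressed throughout by integrating over an arbitrary event `B`
of the past: Lorden's delay is the least `c` such that the integral over `B` of `T - s`, truncated
at `0`, under change-point `s + 1`, is at most `c` times the probability of `B`, for all `s` and all
`B` in `F_s`. Path integrals are computed by integrating out one record at a time
(`lintegral_pathLaw_step`).

Lower bound (`le_lordenDelay_of_mem_procedureClass`). If the mean time to false alarm is at least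
`γ`, then for every block length `m` there is a time `s` such that, given `T > s`, a false alarm
within `m` steps has probability at most `2 m / γ`. Put the change at `s + 1`. Whatever the actions,
the log-likelihood ratio of the next `m` observations exceeds `(I + η) m` with conditional
probability at most `V / (η² m)`, by Chebyshev. Off that event a change of measure costs a factor at
most `exp((I + η) m)`. With `m` slightly below `log γ / I` an alarm within `m` steps is therefore
unlikely, and the delay is nearly `m`.

False alarms (`le_lintegral_cusumTime`). The exponential of the CuSum statistic is dominated by a
Shiryaev–Roberts statistic `R`, and `R_n - n` is a supermartingale without change because the
estimator is predictable. Optional stopping gives mean time at least `exp b`.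

Upper bound (`lordenDelay_cusumTime_le`). Once a full window lies after the change, an incorrect
maximum likelihood estimate forces a product of root likelihood ratios to be at least `1`. The mean
of that product contracts by a fixed `ρ < 1` at each exploration, so a given wrong value is
estimated with probability at most `ρ ^ (q - 1)` given any past. The CuSum drift is `I` per step, up
to the exploration fraction, of order `q / w`, and the rare estimation errors. Hence within `w + k`
steps, `k` slightly above `log γ / I`, an alarm fails with probability at most a small `δ` from any
past. Iterating over blocks bounds the delay by `(w + k) / (1 - δ)`, where `w = o(log γ)`. -/

set_option linter.unusedSectionVars false

noncomputable section

section PathLaw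

variable {𝔸 E : Type*} [MeasurableSpace 𝔸] [MeasurableSpace E]

/-! ### Events and random variables determined by the first records -/

lemma history_eq_comap (n : ℕ) :
    (history 𝔸 E n : MeasurableSpace (RunPath 𝔸 E)) =
      MeasurableSpace.comap (fun (ω : RunPath 𝔸 E) (i : Fin n) => ω i) MeasurableSpace.pi := by
  simp only [history, MeasurableSpace.pi, MeasurableSpace.comap_iSup, MeasurableSpace.comap_comp]
  rfl

lemma history_le (n : ℕ) :
    (history 𝔸 E n : MeasurableSpace (RunPath 𝔸 E)) ≤ MeasurableSpace.pi :=
  (history 𝔸 E).le n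

lemma measurable_coord_history {i n : ℕ} (h : i < n) :
    Measurable[history 𝔸 E n] (fun ω : RunPath 𝔸 E => ω i) := by
  rw [measurable_iff_comap_le]
  exact le_iSup (fun i : Fin n => MeasurableSpace.comap
    (fun ω : RunPath 𝔸 E => ω i) inferInstance) ⟨i, h⟩

lemma measurable_action_history {m n : ℕ} (h1 : 1 ≤ m) (h : m ≤ n) :
    Measurable[history 𝔸 E n] (RunPath.A m : RunPath 𝔸 E → 𝔸) :=
  measurable_fst.comp (measurable_coord_history (by omega))

lemma measurable_obs_history {m n : ℕ} (h1 : 1 ≤ m) (h : m ≤ n) :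
    Measurable[history 𝔸 E n] (RunPath.X m : RunPath 𝔸 E → E) :=
  (measurable_fst.comp measurable_snd).comp (measurable_coord_history (by omega))

lemma measurable_rand_history {m n : ℕ} (h1 : 1 ≤ m) (h : m ≤ n) :
    Measurable[history 𝔸 E n] (RunPath.U m : RunPath 𝔸 E → unitInterval) :=
  (measurable_snd.comp measurable_snd).comp (measurable_coord_history (by omega))

/-- An event of `F_n` is a preimage under restriction to the first `n` records. This is what allows
the last record to be overwritten freely in events and variables of the past. -/
lemma MeasurableSet.mem_iff_of_agree {n : ℕ} {S : Set (RunPath 𝔸 E)}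
    (hS : MeasurableSet[history 𝔸 E n] S) {ω ω' : RunPath 𝔸 E} (h : ∀ i < n, ω i = ω' i) :
    ω ∈ S ↔ ω' ∈ S := by
  rw [history_eq_comap] at hS
  obtain ⟨t, -, rfl⟩ := hS
  have : (fun i : Fin n => ω i) = fun i : Fin n => ω' i := funext fun i => h i i.2
  simp only [Set.mem_preimage, this]

lemma Measurable.eq_of_agree {β : Type*} [MeasurableSpace β] [MeasurableSingletonClass β] {n : ℕ}
    {F : RunPath 𝔸 E → β} (hF : Measurable[history 𝔸 E n] F) {ω ω' : RunPath 𝔸 E}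
    (h : ∀ i < n, ω i = ω' i) : F ω = F ω' :=
  ((hF (measurableSet_singleton (F ω'))).mem_iff_of_agree h).2 rfl

lemma Measurable.update_of_le {β : Type*} [MeasurableSpace β] [MeasurableSingletonClass β] {n m : ℕ}
    {F : RunPath 𝔸 E → β} (hF : Measurable[history 𝔸 E n] F) (h : n ≤ m) (ω : RunPath 𝔸 E)
    (y : Step 𝔸 E) : F (Function.update ω m y) = F ω :=
  hF.eq_of_agree fun i hi => Function.update_of_ne (by omega) _ _

lemma Policy.action_update (π : Policy 𝔸 E) {n m : ℕ} (hn : 2 ≤ n) (h : n ≤ m + 1)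
    (ω : RunPath 𝔸 E) (y : Step 𝔸 E) : π.action n (Function.update ω m y) = π.action n ω := by
  unfold Policy.action
  congr 1
  funext i
  have := Finset.mem_Iic.1 i.2
  exact Function.update_of_ne (by omega) _ _

lemma Policy.measurable_action (π : Policy 𝔸 E) {n m : ℕ} (hn : 2 ≤ n) (h : n ≤ m + 1) :
    Measurable[history 𝔸 E m] (π.action n) := by
  refine (π.measurable_act (n - 2)).comp ?_
  refine @measurable_pi_lambda _ _ _ (history 𝔸 E m) _ _ fun i => ?_
  have := Finset.mem_Iic.1 i.2
  exact measurable_coord_history (by omega)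

@[simp] lemma RunPath.A_update (n : ℕ) (ω : RunPath 𝔸 E) (y : Step 𝔸 E) :
    RunPath.A (n + 1) (Function.update ω n y) = y.1 := by simp [RunPath.A]

@[simp] lemma RunPath.X_update (n : ℕ) (ω : RunPath 𝔸 E) (y : Step 𝔸 E) :
    RunPath.X (n + 1) (Function.update ω n y) = y.2.1 := by simp [RunPath.X]

@[simp] lemma RunPath.U_update (n : ℕ) (ω : RunPath 𝔸 E) (y : Step 𝔸 E) :
    RunPath.U (n + 1) (Function.update ω n y) = y.2.2 := by simp [RunPath.U]

/-! ### Integrating out the last record -/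

variable [Fintype 𝔸] [Nonempty 𝔸] [MeasurableSingletonClass 𝔸] {lam : Measure E}

instance : IsProbabilityMeasure (uniformAction 𝔸) := by
  unfold uniformAction; infer_instance

instance (g : ℕ → 𝔸 → Density lam) (π : Policy 𝔸 E) : IsProbabilityMeasure (pathLaw g π) := by
  unfold pathLaw; infer_instance

instance (pre : 𝔸 → Density lam) (π : Policy 𝔸 E) : IsProbabilityMeasure (lawNoChange pre π) := by
  unfold lawNoChange; infer_instance

instance (pre post : 𝔸 → Density lam) (ν : ℕ) (π : Policy 𝔸 E) :
    IsProbabilityMeasure (lawChange pre post ν π) := by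
  unfold lawChange; infer_instance

/-- The conditional law of the action at time `n + 1` given the path up to time `n`. -/
def Policy.actionLaw (π : Policy 𝔸 E) (n : ℕ) (ω : RunPath 𝔸 E) : Measure 𝔸 :=
  if n = 0 then uniformAction 𝔸 else Measure.dirac (π.action (n + 1) ω)

lemma lintegral_stepKernel (g : 𝔸 → Density lam) (a : 𝔸) {F : Step 𝔸 E → ℝ≥0∞}
    (hF : Measurable F) :
    ∫⁻ y, F y ∂(stepKernel g a) = ∫⁻ x, ∫⁻ u, F (a, x, u) ∂volume ∂(g a).toMeasure := by
  change ∫⁻ y, F y ∂((Measure.dirac a).prod ((g a).toMeasure.prod _)) = _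
  rw [lintegral_prod _ hF.aemeasurable, lintegral_dirac,
    lintegral_prod _ (by fun_prop)]

lemma pathLaw_map_zero (g : ℕ → 𝔸 → Density lam) (π : Policy 𝔸 E) :
    (pathLaw g π).map (fun ω => ω 0) = stepKernel (g 1) ∘ₘ uniformAction 𝔸 := by
  have h0 : (0 : ℕ) ∈ Finset.Iic 0 := by simp
  have h : (fun ω : RunPath 𝔸 E => ω 0) =
      (fun x : (Finset.Iic 0) → Step 𝔸 E => x ⟨0, h0⟩) ∘ Preorder.frestrictLe 0 := rfl
  rw [h, ← Measure.map_map (by fun_prop) (by fun_prop), pathLaw, Kernel.trajMeasure,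
    Measure.map_comp _ _ (by fun_prop), Kernel.traj_map_frestrictLe, Kernel.partialTraj_self,
    Measure.id_comp, Measure.map_map (by fun_prop) (by fun_prop)]
  exact Measure.map_id

/-- Disintegration along the last Markov kernel of the trajectory measure. All probabilistic
estimates reduce to it: the past is frozen and only the newest action, observation and randomization
are averaged. -/
theorem lintegral_pathLaw_step (g : ℕ → 𝔸 → Density lam) (π : Policy 𝔸 E) (n : ℕ)
    {F : RunPath 𝔸 E → ℝ≥0∞} (hF : Measurable[history 𝔸 E (n + 1)] F) :
    ∫⁻ ω, F ω ∂(pathLaw g π) =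
      ∫⁻ ω, ∫⁻ a, ∫⁻ x, ∫⁻ u, F (Function.update ω n (a, x, u)) ∂volume
        ∂(g (n + 1) a).toMeasure ∂(π.actionLaw n ω) ∂(pathLaw g π) := by
  have hF' : Measurable F := hF.mono (history_le _) le_rfl
  rcases n with _ | n
  -- With a single record, `F` sees only coordinate `0`, so it may be evaluated on constant paths;
  -- the first action has no past and is uniform.
  · set G : Step 𝔸 E → ℝ≥0∞ := fun y => F (fun _ => y)
    have hG : Measurable G := hF'.comp (by fun_prop)
    have h1 : ∀ ω, F ω = G (ω 0) := fun ω => hF.eq_of_agree fun i hi => by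
      obtain rfl : i = 0 := by omega
      rfl
    simp only [h1, Function.update_self, Policy.actionLaw, if_true, lintegral_const, measure_univ,
      mul_one]
    rw [← lintegral_map (f := G) hG (measurable_pi_apply 0), pathLaw_map_zero,
      Measure.lintegral_bind (Kernel.aemeasurable _) hG.aemeasurable]
    simp_rw [lintegral_stepKernel _ _ hG]
  · set G : ((Finset.Iic n) → Step 𝔸 E) × Step 𝔸 E → ℝ≥0∞ :=
      fun p => F (fun i => if h : i ∈ Finset.Iic n then p.1 ⟨i, h⟩ else p.2) with hGdef
    have hG : Measurable G := by
      refine hF'.comp (measurable_pi_lambda _ fun i => ?_)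
      by_cases h : i ∈ Finset.Iic n
      · simp only [h, dif_pos]; fun_prop
      · simp only [h, dif_neg, not_false_iff]; fun_prop
    have h1 : ∀ ω y, F (Function.update ω (n + 1) y) = G (Preorder.frestrictLe n ω, y) :=
      fun ω y => hF.eq_of_agree fun i hi => by
        by_cases h : i ≤ n
        · rw [Function.update_of_ne (by omega)]
          simp [h]
        · obtain rfl : i = n + 1 := by omega
          simp
    have h2 : ∀ ω, F ω = G (Preorder.frestrictLe n ω, ω (n + 1)) := fun ω => by
      rw [← h1, Function.update_eq_self]
    simp only [h1, Policy.actionLaw, Nat.add_eq_zero_iff, one_ne_zero, and_false, if_false,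
      lintegral_dirac]
    simp_rw [h2]
    have key := Kernel.map_frestrictLe_trajMeasure_compProd_eq_map_trajMeasure
      (X := fun _ => Step 𝔸 E) (μ₀ := stepKernel (g 1) ∘ₘ uniformAction 𝔸)
      (κ := fun n => (stepKernel (g (n + 2))).comap (π.act n) (π.measurable_act n)) (a := n)
    change (pathLaw g π).map _ ⊗ₘ _ = (pathLaw g π).map _ at key
    rw [← lintegral_map (f := G)
      (g := fun ω : RunPath 𝔸 E => (Preorder.frestrictLe n ω, ω (n + 1))) hG (by fun_prop), ← key,
      Measure.lintegral_compProd hG, lintegral_map (Measurable.lintegral_kernel_prod_right' hG)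
      (by fun_prop)]
    refine lintegral_congr fun ω => ?_
    rw [Kernel.comap_apply]
    exact lintegral_stepKernel _ _ (hG.comp measurable_prodMk_left)

theorem lintegral_pathLaw_le_of_step (g : ℕ → 𝔸 → Density lam) (π : Policy 𝔸 E) (n : ℕ)
    {F G : RunPath 𝔸 E → ℝ≥0∞} (hF : Measurable[history 𝔸 E (n + 1)] F)
    (hG : Measurable[history 𝔸 E (n + 1)] G)
    (h : ∀ ω a, ∫⁻ x, ∫⁻ u, F (Function.update ω n (a, x, u)) ∂volume ∂(g (n + 1) a).toMeasure ≤
      ∫⁻ x, ∫⁻ u, G (Function.update ω n (a, x, u)) ∂volume ∂(g (n + 1) a).toMeasure) :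
    ∫⁻ ω, F ω ∂(pathLaw g π) ≤ ∫⁻ ω, G ω ∂(pathLaw g π) := by
  rw [lintegral_pathLaw_step g π n hF, lintegral_pathLaw_step g π n hG]
  exact lintegral_mono fun ω => lintegral_mono fun a => h ω a

lemma measurable_comp_action_obs {β : Type*} [MeasurableSpace β] {φ : 𝔸 → E → β}
    (hφ : ∀ a, Measurable (φ a)) {m n : ℕ} (h1 : 1 ≤ m) (h : m ≤ n) :
    Measurable[history 𝔸 E n] fun ω => φ (RunPath.A m ω) (RunPath.X m ω) := by
  have : Measurable fun p : 𝔸 × E => φ p.1 p.2 := measurable_from_prod_countable_right hφ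
  have h' : Measurable[history 𝔸 E n] fun ω : RunPath 𝔸 E => (RunPath.A m ω, RunPath.X m ω) :=
    (measurable_action_history h1 h).prodMk (measurable_obs_history h1 h)
  exact this.comp h'

theorem lintegral_mul_step_le (g : ℕ → 𝔸 → Density lam) (π : Policy 𝔸 E) (n : ℕ)
    {H : RunPath 𝔸 E → ℝ≥0∞} (hH : Measurable[history 𝔸 E n] H) {φ : 𝔸 → E → ℝ≥0∞}
    (hφ : ∀ a, Measurable (φ a)) {c : ℝ≥0∞}
    (hc : ∀ a, ∫⁻ x, φ a x ∂(g (n + 1) a).toMeasure ≤ c) :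
    ∫⁻ ω, H ω * φ (RunPath.A (n + 1) ω) (RunPath.X (n + 1) ω) ∂(pathLaw g π) ≤
      c * ∫⁻ ω, H ω ∂(pathLaw g π) := by
  have hH' := hH.mono ((history 𝔸 E).mono n.le_succ) le_rfl
  rw [← lintegral_const_mul _ (hH.mono (history_le _) le_rfl)]
  refine lintegral_pathLaw_le_of_step g π n
    (hH'.mul (measurable_comp_action_obs hφ (by omega) le_rfl)) (hH'.const_mul c) fun ω a => ?_
  simp only [RunPath.A_update, RunPath.X_update, hH.update_of_le le_rfl, lintegral_const,
    measure_univ, mul_one]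
  rw [lintegral_const_mul _ (hφ a), mul_comm]
  gcongr
  exact hc a

theorem ae_pathLaw_of_forall_ae (g : ℕ → 𝔸 → Density lam) (π : Policy 𝔸 E) (n : ℕ)
    {P : 𝔸 → E → Prop} (h : ∀ a, ∀ᵐ x ∂(g (n + 1) a).toMeasure, P a x) :
    ∀ᵐ ω ∂(pathLaw g π), P (RunPath.A (n + 1) ω) (RunPath.X (n + 1) ω) := by
  -- `P` need not be measurable, so its exceptional set is replaced by a measurable null superset
  -- for each action.
  choose S hS hSm hS0 using fun a => exists_measurable_superset_of_null (h a)
  have := lintegral_mul_step_le g π n (H := fun _ => 1) (@measurable_const _ _ _ (_) _)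
    (φ := fun a => (S a).indicator 1) (fun a => measurable_one.indicator (hSm a)) (c := 0)
    (fun a => by rw [lintegral_indicator_one (hSm a), hS0])
  rw [zero_mul, nonpos_iff_eq_zero, lintegral_eq_zero_iff] at this
  · filter_upwards [this] with ω hω
    by_contra hP
    have : RunPath.X (n + 1) ω ∈ S (RunPath.A (n + 1) ω) := hS _ hP
    simp [this] at hω
  · refine (measurable_const.mul ?_)
    exact (measurable_comp_action_obs (fun a => measurable_one.indicator (hSm a)) (by omega)
      le_rfl).mono (history_le (n + 1)) le_rfl

theorem ae_action_eq (g : ℕ → 𝔸 → Density lam) (π : Policy 𝔸 E) {n : ℕ} (hn : 2 ≤ n) :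
    ∀ᵐ ω ∂(pathLaw g π), RunPath.A n ω = π.action n ω := by
  obtain ⟨n, rfl⟩ : ∃ k, n = k + 1 := ⟨n - 1, by omega⟩
  have hm : MeasurableSet[history 𝔸 E (n + 1)]
      {ω : RunPath 𝔸 E | RunPath.A (n + 1) ω ≠ π.action (n + 1) ω} :=
    (measurableSet_eq_fun (measurable_action_history (by omega) le_rfl)
      (π.measurable_action hn (by omega))).compl
  have hm' := history_le _ _ hm
  have hi : Measurable[history 𝔸 E (n + 1)]
      ({ω : RunPath 𝔸 E | RunPath.A (n + 1) ω ≠ π.action (n + 1) ω}.indicator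
        (fun _ => (1 : ℝ≥0∞))) :=
    (@measurable_const _ _ _ (history 𝔸 E (n + 1)) _).indicator hm
  rw [ae_iff]
  change pathLaw g π {ω | RunPath.A (n + 1) ω ≠ π.action (n + 1) ω} = 0
  rw [← lintegral_indicator_one hm']
  change ∫⁻ ω, Set.indicator _ (fun _ => 1) ω ∂_ = 0
  rw [lintegral_pathLaw_step g π n hi]
  have h0 : n ≠ 0 := by omega
  simp only [Policy.actionLaw, h0, if_false, lintegral_dirac]
  simp [Set.indicator, π.action_update hn le_rfl]

/-- Chebyshev-type bound: centred increments with variance at most `V` add at most `V` each to the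
second moment, on every event of the past. -/
theorem setLIntegral_sq_sum_le (g : ℕ → 𝔸 → Density lam) (π : Policy 𝔸 E) (s k : ℕ)
    {B : Set (RunPath 𝔸 E)} (hB : MeasurableSet[history 𝔸 E s] B) {ξ : 𝔸 → E → ℝ}
    (hξ : ∀ a, Measurable (ξ a)) {V : ℝ≥0∞}
    (h : ∀ i < k, ∀ a (x : ℝ), ∫⁻ y, ENNReal.ofReal ((x + ξ a y) ^ 2) ∂(g (s + i + 1) a).toMeasure ≤
      ENNReal.ofReal (x ^ 2) + V) :
    ∫⁻ ω in B, ENNReal.ofReal ((∑ i ∈ Finset.range k,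
      ξ (RunPath.A (s + i + 1) ω) (RunPath.X (s + i + 1) ω)) ^ 2) ∂(pathLaw g π) ≤
      k * V * pathLaw g π B := by
  have hB0 := history_le _ _ hB
  have hS : ∀ j n, s + j ≤ n → Measurable[history 𝔸 E n] fun ω : RunPath 𝔸 E =>
      ∑ i ∈ Finset.range j, ξ (RunPath.A (s + i + 1) ω) (RunPath.X (s + i + 1) ω) :=
    fun j n hj => Finset.measurable_fun_sum _ fun i hi => measurable_comp_action_obs hξ (by omega)
      (by have := Finset.mem_range.1 hi; omega)
  induction k with
  | zero => simp
  | succ k ih =>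
    have ih := ih fun i hi => h i (by omega)
    rw [← lintegral_indicator hB0] at ih ⊢
    have hm : ∀ j n, s + j ≤ n → Measurable[history 𝔸 E n] (B.indicator fun ω =>
        ENNReal.ofReal ((∑ i ∈ Finset.range j,
          ξ (RunPath.A (s + i + 1) ω) (RunPath.X (s + i + 1) ω)) ^ 2)) := fun j n hj =>
      @Measurable.indicator _ _ (_) _ _ _ _ (((hS j n hj).pow_const 2).ennreal_ofReal)
        ((history 𝔸 E).mono (by omega) _ hB)
    have hV : Measurable[history 𝔸 E (s + k + 1)] (B.indicator fun _ => V) :=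
      @Measurable.indicator _ _ (_) _ _ _ _ (@measurable_const _ _ _ (_) _)
        ((history 𝔸 E).mono (by omega) _ hB)
    -- The newest record changes neither `B` nor the partial sum up to `k`, so `h` applies with `x`
    -- equal to that partial sum.
    calc _ ≤ ∫⁻ ω, (B.indicator (fun ω => ENNReal.ofReal ((∑ i ∈ Finset.range k,
          ξ (RunPath.A (s + i + 1) ω) (RunPath.X (s + i + 1) ω)) ^ 2)) ω +
          B.indicator (fun _ => V) ω) ∂(pathLaw g π) := by
          refine lintegral_pathLaw_le_of_step g π (s + k) (hm (k + 1) _ (by omega))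
            ((hm k _ (by omega)).add hV) fun ω a => ?_
          have hBu : ∀ y, Function.update ω (s + k) y ∈ B ↔ ω ∈ B := fun y =>
            hB.mem_iff_of_agree fun i hi => Function.update_of_ne (by omega) _ _
          have hSu : ∀ y, (∑ i ∈ Finset.range k, ξ (RunPath.A (s + i + 1)
              (Function.update ω (s + k) y)) (RunPath.X (s + i + 1) (Function.update ω (s + k) y)))
              = ∑ i ∈ Finset.range k, ξ (RunPath.A (s + i + 1) ω) (RunPath.X (s + i + 1) ω) :=
            fun y => (hS k _ le_rfl).update_of_le le_rfl ω y
          by_cases hω : ω ∈ B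
          · simp only [Set.indicator, hBu, hω, if_true, Finset.sum_range_succ, hSu,
              RunPath.A_update, RunPath.X_update, lintegral_const, measure_univ, mul_one]
            exact h k (by omega) a _
          · simp [Set.indicator, hBu, hω]
      _ ≤ k * V * pathLaw g π B + V * pathLaw g π B := by
          rw [lintegral_add_right _ (hV.mono (history_le _) le_rfl), lintegral_indicator_const hB0]
          gcongr
      _ = _ := by push_cast; ring

end PathLaw

end

noncomputable section

section OneStep

variable {E : Type*} [MeasurableSpace E] {lam : Measure E}

/-! ### Likelihood ratios of two densities -/

/-- The real-valued log-likelihood ratio, with value `0` where one of the densities vanishes. -/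
def logLR (f g : Density lam) (x : E) : ℝ := Real.log ((f.toFun x / g.toFun x : ℝ≥0) : ℝ)

lemma measurable_logLR (f g : Density lam) : Measurable (logLR f g) := by
  have := f.measurable'
  have := g.measurable'
  unfold logLR
  fun_prop

lemma measurable_logRatio (f g : Density lam) : Measurable (logRatio f g) := by
  have := f.measurable'
  have := g.measurable'
  unfold logRatio
  fun_prop

lemma Density.absolutelyContinuous_dominating (f : Density lam) : f.toMeasure ≪ lam :=
  withDensity_absolutelyContinuous _ _

lemma Density.ae_ne_zero (f : Density lam) : ∀ᵐ x ∂f.toMeasure, f.toFun x ≠ 0 := by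
  have := f.measurable'
  rw [Density.toMeasure, ae_withDensity_iff (by fun_prop)]
  exact ae_of_all _ fun x hx => by simpa using hx

lemma Density.ae_ne_zero_of_ac {f g : Density lam} (h : f.toMeasure ≪ g.toMeasure) :
    ∀ᵐ x ∂f.toMeasure, g.toFun x ≠ 0 :=
  h.ae_le g.ae_ne_zero

lemma Density.ac_of_ae_ne_zero {f g : Density lam} (h : ∀ᵐ x ∂f.toMeasure, g.toFun x ≠ 0) :
    f.toMeasure ≪ g.toMeasure := by
  intro S hS
  have hg := g.measurable'
  rw [Density.toMeasure, withDensity_apply_eq_zero (by fun_prop)] at hS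
  have h1 := f.absolutelyContinuous_dominating hS
  refine measure_mono_null (t := ({x | ((g.toFun x : ℝ≥0) : ℝ≥0∞) ≠ 0} ∩ S) ∪ {x | ¬ g.toFun x ≠ 0})
    (fun x hx => ?_) (measure_union_null h1 h)
  by_cases hgx : g.toFun x = 0
  · right; simpa using hgx
  · left; exact ⟨by simpa using hgx, hx⟩

lemma Density.eq_withDensity_ratio {f g : Density lam} (h : f.toMeasure ≪ g.toMeasure) :
    f.toMeasure = g.toMeasure.withDensity fun x => ((f.toFun x / g.toFun x : ℝ≥0) : ℝ≥0∞) := by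
  have hf := f.measurable'
  have hg := g.measurable'
  have h0 := Density.ae_ne_zero_of_ac h
  rw [Density.toMeasure, ae_withDensity_iff (by fun_prop)] at h0
  rw [Density.toMeasure, Density.toMeasure, ← withDensity_mul _ (by fun_prop) (by fun_prop)]
  refine withDensity_congr_ae ?_
  filter_upwards [h0] with x hx
  simp only [Pi.mul_apply]
  norm_cast
  by_cases hfx : f.toFun x = 0
  · simp [hfx]
  · have := hx (by simpa using hfx)
    field_simp

lemma llr_ae_eq_logLR {f g : Density lam} (h : f.toMeasure ≪ g.toMeasure) :
    llr f.toMeasure g.toMeasure =ᵐ[f.toMeasure] logLR f g := by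
  have hf := f.measurable'
  have hg := g.measurable'
  have h1 : f.toMeasure.rnDeriv g.toMeasure =ᵐ[g.toMeasure]
      fun x => ((f.toFun x / g.toFun x : ℝ≥0) : ℝ≥0∞) := by
    nth_rewrite 1 [Density.eq_withDensity_ratio h]
    exact Measure.rnDeriv_withDensity _ (by fun_prop)
  filter_upwards [h.ae_le h1] with x hx
  simp [llr, logLR, hx]

lemma integrable_logLR {f g : Density lam}
    (h : InformationTheory.klDiv f.toMeasure g.toMeasure ≠ ∞) :
    Integrable (logLR f g) f.toMeasure := by
  obtain ⟨h1, h2⟩ := InformationTheory.klDiv_ne_top_iff.1 h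
  exact h2.congr (llr_ae_eq_logLR h1)

lemma integral_logLR {f g : Density lam}
    (h : InformationTheory.klDiv f.toMeasure g.toMeasure ≠ ∞) :
    ∫ x, logLR f g x ∂f.toMeasure = (InformationTheory.klDiv f.toMeasure g.toMeasure).toReal := by
  obtain ⟨h1, h2⟩ := InformationTheory.klDiv_ne_top_iff.1 h
  rw [InformationTheory.toReal_klDiv_of_measure_eq h1 (by simp),
    integral_congr_ae (llr_ae_eq_logLR h1)]

lemma lintegral_logLR_lt_top {f g : Density lam}
    (h : InformationTheory.klDiv f.toMeasure g.toMeasure ≠ ∞) :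
    ∫⁻ x, ENNReal.ofReal (logLR f g x) ∂f.toMeasure < ∞ :=
  (integrable_logLR h).lintegral_lt_top

/-- Only an inequality: where `f` vanishes the ratio is `0`, but `logLR` is `0` by convention and
its exponential is `1`. -/
lemma lintegral_le_lintegral_mul_exp_logLR {f g : Density lam}
    (h : f.toMeasure ≪ g.toMeasure) {F : E → ℝ≥0∞} (hF : Measurable F) :
    ∫⁻ x, F x ∂f.toMeasure ≤ ∫⁻ x, F x * ENNReal.ofReal (Real.exp (logLR f g x)) ∂g.toMeasure := by
  have hf := f.measurable'
  have hg := g.measurable'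
  rw [Density.eq_withDensity_ratio h, lintegral_withDensity_eq_lintegral_mul _ (by fun_prop) hF]
  refine lintegral_mono fun x => ?_
  simp only [Pi.mul_apply]
  rw [mul_comm]
  gcongr
  rw [← ENNReal.ofReal_coe_nnreal]
  refine ENNReal.ofReal_le_ofReal ?_
  unfold logLR
  rcases eq_or_ne (f.toFun x / g.toFun x) 0 with h0 | h0
  · simp [h0]
  · rw [Real.exp_log (by positivity)]

lemma logRatio_eq_coe {f g : Density lam} {x : E} (hf : f.toFun x ≠ 0) (hg : g.toFun x ≠ 0) :
    logRatio f g x = (logLR f g x : EReal) := by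
  unfold logRatio logLR
  rw [← ENNReal.coe_div hg, ENNReal.log_pos_real (by simp [hf, hg]) (by simp)]
  simp

lemma logRatio_eq_top {f g : Density lam} {x : E} (hf : f.toFun x ≠ 0) (hg : g.toFun x = 0) :
    logRatio f g x = ⊤ := by
  unfold logRatio
  rw [hg, ENNReal.coe_zero, ENNReal.div_zero (by simpa using hf), ENNReal.log_top]

/-- The chain rule log(f/g) = log(f/h) + log(h/g). It compares the increment at an estimate `h` with
that at the truth `f`; keeping the positive part of the loss makes it suitable for Markov's
inequality. If `g` vanishes at `x`, the right side is `+∞`. -/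
lemma logLR_sub_le_logRatio {f h g : Density lam} {x : E} (hf : f.toFun x ≠ 0)
    (hh : h.toFun x ≠ 0) :
    ((logLR f g x - max (logLR f h x) 0 : ℝ) : EReal) ≤ logRatio h g x := by
  rcases eq_or_ne (g.toFun x) 0 with hg | hg
  · rw [logRatio_eq_top hh hg]; exact le_top
  · rw [logRatio_eq_coe hh hg, EReal.coe_le_coe_iff]
    have : logLR f g x = logLR f h x + logLR h g x := by
      unfold logLR
      rw [← Real.log_mul (by positivity) (by positivity)]
      congr 1
      push_cast
      field_simp
    have := le_max_left (logLR f h x) 0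
    linarith

/-! ### Second moments -/

/-- Where `g = 0 < f` the log-ratio is `+∞`, so a finite second moment leaves this set no `f`-mass.
-/
lemma ac_of_lintegral_logRatio_sq_lt_top {f g : Density lam}
    (h : ∫⁻ x, (logRatio f g x).abs ^ 2 ∂f.toMeasure < ∞) : f.toMeasure ≪ g.toMeasure := by
  have measurable_abs : Measurable EReal.abs := EReal.measurable_of_measurable_real (by
    simp only [EReal.abs_def]; fun_prop)
  have hm : Measurable fun x => (logRatio f g x).abs ^ 2 :=
    (measurable_abs.comp (measurable_logRatio f g)).pow_const 2
  refine Density.ac_of_ae_ne_zero ?_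
  filter_upwards [ae_lt_top hm h.ne, f.ae_ne_zero] with x hx hfx hgx
  simp [logRatio_eq_top hfx hgx] at hx

lemma lintegral_logLR_sq_eq {f g : Density lam} (h : f.toMeasure ≪ g.toMeasure) :
    ∫⁻ x, ENNReal.ofReal (logLR f g x ^ 2) ∂f.toMeasure =
      ∫⁻ x, (logRatio f g x).abs ^ 2 ∂f.toMeasure := by
  refine lintegral_congr_ae ?_
  filter_upwards [f.ae_ne_zero, Density.ae_ne_zero_of_ac h] with x hf hg
  rw [logRatio_eq_coe hf hg, EReal.abs_def, ← ENNReal.ofReal_pow (abs_nonneg _), sq_abs]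

lemma memLp_logLR {f g : Density lam} (h : ∫⁻ x, (logRatio f g x).abs ^ 2 ∂f.toMeasure < ∞) :
    MemLp (logLR f g) 2 f.toMeasure := by
  rw [memLp_two_iff_integrable_sq (measurable_logLR f g).aestronglyMeasurable]
  refine ⟨((measurable_logLR f g).pow_const 2).aestronglyMeasurable, ?_⟩
  rw [hasFiniteIntegral_iff_ofReal (ae_of_all _ fun x => sq_nonneg _),
    lintegral_logLR_sq_eq (ac_of_lintegral_logRatio_sq_lt_top h)]
  exact h

lemma klDiv_lt_top_of_sq {f g : Density lam}
    (h : ∫⁻ x, (logRatio f g x).abs ^ 2 ∂f.toMeasure < ∞) :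
    InformationTheory.klDiv f.toMeasure g.toMeasure < ∞ := by
  have hac := ac_of_lintegral_logRatio_sq_lt_top h
  refine (InformationTheory.klDiv_ne_top hac ?_).lt_top
  exact ((memLp_logLR h).integrable (by norm_num)).congr (llr_ae_eq_logLR hac).symm

/-- Centring kills the cross term, and the variance is at most the second moment. The shift `z`
plays the role of the partial sum accumulated so far. -/
lemma lintegral_sq_add_centred_le {f g : Density lam} {V : ℝ≥0∞} (hV : V < ∞)
    (h : ∫⁻ x, (logRatio f g x).abs ^ 2 ∂f.toMeasure ≤ V) (z : ℝ) :
    ∫⁻ x, ENNReal.ofReal ((z + (logLR f g x -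
      (InformationTheory.klDiv f.toMeasure g.toMeasure).toReal)) ^ 2) ∂f.toMeasure ≤
      ENNReal.ofReal (z ^ 2) + V := by
  have h' := h.trans_lt hV
  have hL := memLp_logLR h'
  have hI := hL.integrable (by norm_num : (1 : ℝ≥0∞) ≤ 2)
  have hS := hL.integrable_sq
  rw [← integral_logLR (klDiv_lt_top_of_sq h').ne]
  set I := ∫ x, logLR f g x ∂f.toMeasure
  have hexp : ∀ x, (z + (logLR f g x - I)) ^ 2 =
      (logLR f g x ^ 2 + 2 * (z - I) * logLR f g x) + (z - I) ^ 2 := fun x => by ring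
  have hint : Integrable (fun x => (z + (logLR f g x - I)) ^ 2) f.toMeasure := by
    simp_rw [hexp]
    exact (hS.add (hI.const_mul _)).add (integrable_const _)
  rw [← ofReal_integral_eq_lintegral_ofReal hint (ae_of_all _ fun x => sq_nonneg _)]
  have h1 : ∫ x, (z + (logLR f g x - I)) ^ 2 ∂f.toMeasure =
      ∫ x, logLR f g x ^ 2 ∂f.toMeasure + 2 * (z - I) * I + (z - I) ^ 2 := by
    simp_rw [hexp]
    rw [integral_add (f := fun x => logLR f g x ^ 2 + 2 * (z - I) * logLR f g x)
      (hS.add (hI.const_mul _)) (integrable_const _),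
      integral_add hS (hI.const_mul _), integral_const_mul]
    simp [I]
  have h2 : ENNReal.ofReal (∫ x, logLR f g x ^ 2 ∂f.toMeasure) ≤ V := by
    rw [ofReal_integral_eq_lintegral_ofReal hS (ae_of_all _ fun x => sq_nonneg _),
      lintegral_logLR_sq_eq (ac_of_lintegral_logRatio_sq_lt_top h')]
    exact h
  rw [h1]
  calc _ ≤ ENNReal.ofReal (z ^ 2 + ∫ x, logLR f g x ^ 2 ∂f.toMeasure) :=
        ENNReal.ofReal_le_ofReal (by nlinarith [sq_nonneg I])
    _ ≤ _ := by
        refine ENNReal.ofReal_add_le.trans ?_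
        gcongr

/-! ### The Bhattacharyya coefficient -/

/-- The square root of the likelihood ratio `h / f`. -/
def sqrtLR (f h : Density lam) (x : E) : ℝ≥0 := NNReal.sqrt (h.toFun x / f.toFun x)

lemma measurable_sqrtLR (f h : Density lam) : Measurable (sqrtLR f h) := by
  have := f.measurable'
  have := h.measurable'
  unfold sqrtLR
  fun_prop

/-- The Bhattacharyya coefficient of `f` and `h`. -/
def bhattacharyya (f h : Density lam) : ℝ≥0∞ := ∫⁻ x, sqrtLR f h x ∂f.toMeasure

/-- Pointwise, √(fh) + (√f - √h)²/2 = (f + h)/2, which integrates to `1`. Subtraction in `ℝ≥0` is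
truncated, so both differences appear; at each point at least one of them is zero. -/
lemma bhattacharyya_add_le (f h : Density lam) :
    bhattacharyya f h + ∫⁻ x, (((NNReal.sqrt (f.toFun x) - NNReal.sqrt (h.toFun x)) ^ 2 +
      (NNReal.sqrt (h.toFun x) - NNReal.sqrt (f.toFun x)) ^ 2) / 2 : ℝ≥0) ∂lam ≤ 1 := by
  have hf := f.measurable'
  have hh := h.measurable'
  have hr := measurable_sqrtLR f h
  rw [bhattacharyya, Density.toMeasure,
    lintegral_withDensity_eq_lintegral_mul _ (by fun_prop) (by fun_prop),
    ← lintegral_add_left (by fun_prop)]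
  have h1 : ∫⁻ x, ((f.toFun x : ℝ≥0∞) / 2 + (h.toFun x : ℝ≥0∞) / 2) ∂lam = 1 := by
    rw [lintegral_add_left (by fun_prop)]
    simp_rw [ENNReal.div_eq_inv_mul]
    rw [lintegral_const_mul _ (by fun_prop), lintegral_const_mul _ (by fun_prop),
      f.lintegral_eq_one, h.lintegral_eq_one, mul_one, ENNReal.inv_two_add_inv_two]
  rw [← h1]
  refine lintegral_mono fun x => ?_
  simp only [Pi.mul_apply, sqrtLR]
  have h2 : ((f.toFun x : ℝ≥0∞) / 2 + (h.toFun x : ℝ≥0∞) / 2) =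
      ((f.toFun x / 2 + h.toFun x / 2 : ℝ≥0) : ℝ≥0∞) := by
    push_cast [ENNReal.coe_div]; rfl
  rw [h2]
  norm_cast
  generalize f.toFun x = u
  generalize h.toFun x = v
  have h3 : u * NNReal.sqrt (v / u) ≤ NNReal.sqrt u * NNReal.sqrt v := by
    rcases eq_or_ne u 0 with rfl | hu
    · simp
    · have : NNReal.sqrt u ≠ 0 := by simpa using hu
      rw [NNReal.sqrt_div]
      nth_rewrite 1 [← NNReal.mul_self_sqrt u]
      apply le_of_eq
      field_simp
  refine (add_le_add_left h3 _).trans (le_of_eq ?_)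
  obtain ⟨p, rfl⟩ : ∃ p, u = p ^ 2 := ⟨NNReal.sqrt u, by simp⟩
  obtain ⟨q, rfl⟩ : ∃ q, v = q ^ 2 := ⟨NNReal.sqrt v, by simp⟩
  simp only [NNReal.sqrt_sq]
  rcases le_total p q with hpq | hpq
  · rw [tsub_eq_zero_of_le hpq]
    apply NNReal.eq
    push_cast [NNReal.coe_sub hpq]
    ring
  · rw [tsub_eq_zero_of_le hpq]
    apply NNReal.eq
    push_cast [NNReal.coe_sub hpq]
    ring

lemma bhattacharyya_le_one (f h : Density lam) : bhattacharyya f h ≤ 1 :=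
  le_self_add.trans (bhattacharyya_add_le f h)

/-- A coefficient equal to `1` would leave no room for the squared difference of the roots, so the
densities would agree almost everywhere and the divergence would vanish. -/
lemma bhattacharyya_lt_one {f h : Density lam}
    (hne : 0 < InformationTheory.klDiv f.toMeasure h.toMeasure) : bhattacharyya f h < 1 := by
  have hf := f.measurable'
  have hh := h.measurable'
  refine lt_of_le_of_ne (bhattacharyya_le_one f h) fun h1 => hne.ne' ?_
  have h2 := bhattacharyya_add_le f h
  rw [h1] at h2
  have h3 := nonpos_iff_eq_zero.1 ((ENNReal.add_le_add_iff_left (a := 1) (by simp)).1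
    (h2.trans (le_of_eq (add_zero 1).symm)))
  rw [lintegral_eq_zero_iff (by fun_prop)] at h3
  rw [InformationTheory.klDiv_eq_zero_iff]
  refine withDensity_congr_ae ?_
  filter_upwards [h3] with x hx
  simp only [Pi.zero_apply, ENNReal.coe_eq_zero, div_eq_zero_iff, add_eq_zero, pow_eq_zero_iff,
    tsub_eq_zero_iff_le, NNReal.sqrt_le_sqrt, ne_eq, OfNat.ofNat_ne_zero, not_false_iff,
    or_false] at hx
  rw [le_antisymm hx.1 hx.2]

end OneStep

end

noncomputable section

/-! ### Counting representations of a random time -/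

lemma sum_range_lt_le_enat (t : ℕ∞) (n : ℕ) :
    ∑ k ∈ Finset.range n, (if (k : ℕ∞) < t then (1 : ℝ≥0∞) else 0) ≤ t := by
  induction t using ENat.recTopCoe with
  | top => simp
  | coe m =>
    rw [Finset.sum_boole]
    simp only [Nat.cast_lt, ENat.toENNReal_coe, Nat.cast_le]
    calc _ ≤ (Finset.range m).card := Finset.card_le_card fun k hk => by
          simpa using (Finset.mem_filter.1 hk).2
      _ = m := Finset.card_range m

/-- Covers the interval from `s` to `T` by blocks of length `t`, each counted in full if it starts
before `T`. -/
lemma enat_sub_le_tsum_blocks (T : ℕ∞) (s : ℕ) {t : ℕ} (ht : 1 ≤ t) :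
    (T : ℝ≥0∞) - s ≤ ∑' k : ℕ, if ((s + k * t : ℕ) : ℕ∞) < T then (t : ℝ≥0∞) else 0 := by
  induction T using ENat.recTopCoe with
  | top =>
    have : (t : ℝ≥0∞) ≠ 0 := by norm_cast; omega
    simp [ENNReal.tsum_const_eq_top_of_ne_zero this, -Nat.cast_add, -Nat.cast_mul]
  | coe m =>
    -- The quotient is the ceiling of `(m - s) / t`, the number of blocks that start before `m`.
    refine le_trans ?_ (ENNReal.sum_le_tsum (Finset.range ((m - s + (t - 1)) / t)))
    have h1 : ∀ k ∈ Finset.range ((m - s + (t - 1)) / t),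
        (if ((s + k * t : ℕ) : ℕ∞) < (m : ℕ∞) then (t : ℝ≥0∞) else 0) = t := fun k hk => by
      rw [if_pos]
      have hk := Finset.mem_range.1 hk
      rw [Nat.lt_iff_add_one_le, Nat.le_div_iff_mul_le (by omega), add_mul] at hk
      norm_cast
      omega
    rw [Finset.sum_congr rfl h1]
    simp only [Finset.sum_const, Finset.card_range, nsmul_eq_mul, ENat.toENNReal_coe]
    rw [tsub_le_iff_right]
    norm_cast
    have := Nat.lt_div_mul_add (a := m - s + (t - 1)) (b := t) (by omega)
    omega

/-! ### Stopping times: measurability and means as sums of tail probabilities. -/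

section Stopping

variable {𝔸 E : Type*} [MeasurableSpace 𝔸] [MeasurableSpace E]

lemma measurableSet_lt_time {T : RunPath 𝔸 E → ℕ∞}
    (hT : ∀ n : ℕ, MeasurableSet[history 𝔸 E n] {ω | T ω = n}) (n : ℕ) :
    MeasurableSet[history 𝔸 E n] {ω | (n : ℕ∞) < T ω} := by
  have h : {ω | (n : ℕ∞) < T ω} = (⋃ k ∈ Finset.range (n + 1), {ω | T ω = (k : ℕ)})ᶜ := by
    ext ω
    simp only [Set.mem_ofPred_eq, Set.mem_compl_iff, Set.mem_iUnion, Finset.mem_range, exists_prop,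
      not_exists, not_and]
    constructor
    · rintro h k hk hTk
      rw [hTk, Nat.cast_lt] at h
      omega
    · intro h
      by_contra h'
      obtain ⟨k, hk⟩ := ENat.ne_top_iff_exists.1 (ne_top_of_le_ne_top (ENat.natCast_ne_top n)
        (not_lt.1 h'))
      rw [← hk] at h'
      exact h k (by have := Nat.cast_le.1 (not_lt.1 h'); omega) hk.symm
  rw [h]
  exact (Finset.measurableSet_biUnion _ fun k hk =>
    (history 𝔸 E).mono (by have := Finset.mem_range.1 hk; omega) _ (hT k)).compl

lemma measurable_time {T : RunPath 𝔸 E → ℕ∞}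
    (hT : ∀ n : ℕ, MeasurableSet[history 𝔸 E n] {ω | T ω = n}) : Measurable T :=
  ENat.measurable_iff.2 fun n => history_le n _ (hT n)

lemma measurableSet_lt_time' {T : RunPath 𝔸 E → ℕ∞}
    (hT : ∀ n : ℕ, MeasurableSet[history 𝔸 E n] {ω | T ω = n}) (n : ℕ) :
    MeasurableSet {ω | (n : ℕ∞) < T ω} := history_le _ _ (measurableSet_lt_time hT n)

lemma lintegral_time_sub_le {T : RunPath 𝔸 E → ℕ∞}
    (hT : ∀ n : ℕ, MeasurableSet[history 𝔸 E n] {ω | T ω = n}) (μ : Measure (RunPath 𝔸 E))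
    (s : ℕ) {t : ℕ} (ht : 1 ≤ t) :
    ∫⁻ ω, ((T ω : ℝ≥0∞) - s) ∂μ ≤ ∑' k : ℕ, t * μ {ω | ((s + k * t : ℕ) : ℕ∞) < T ω} := by
  refine (lintegral_mono fun ω => enat_sub_le_tsum_blocks (T ω) s ht).trans (le_of_eq ?_)
  rw [lintegral_tsum fun k => (Measurable.ite (measurableSet_lt_time' hT _) measurable_const
    measurable_const).aemeasurable]
  congr 1
  ext k
  rw [← lintegral_indicator_const (measurableSet_lt_time' hT _)]
  simp only [Set.indicator, Set.mem_ofPred_eq]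

lemma sum_measure_lt_time_le {T : RunPath 𝔸 E → ℕ∞}
    (hT : ∀ n : ℕ, MeasurableSet[history 𝔸 E n] {ω | T ω = n}) (μ : Measure (RunPath 𝔸 E))
    (n : ℕ) : ∑ k ∈ Finset.range n, μ {ω | (k : ℕ∞) < T ω} ≤ ∫⁻ ω, (T ω : ℝ≥0∞) ∂μ := by
  refine le_trans (le_of_eq ?_) (lintegral_mono fun ω => sum_range_lt_le_enat (T ω) n)
  rw [lintegral_finsetSum _ fun k _ => Measurable.ite (measurableSet_lt_time' hT _)
    measurable_const measurable_const]
  congr 1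
  ext k
  rw [← lintegral_indicator_one (measurableSet_lt_time' hT _)]
  simp only [Set.indicator, Set.mem_ofPred_eq, Pi.one_apply]

end Stopping

/-! ### Estimators determined by the past. -/

section Estimator

variable {𝔸 E Θ : Type*} [MeasurableSpace 𝔸] [MeasurableSpace E] [Finite Θ]

lemma measurable_comp_estimator {β : Type*} [MeasurableSpace β] {n : ℕ} {e : RunPath 𝔸 E → Θ}
    (he : ∀ ϑ, MeasurableSet[history 𝔸 E n] {ω | e ω = ϑ}) {F : Θ → RunPath 𝔸 E → β}
    (hF : ∀ ϑ, Measurable[history 𝔸 E n] (F ϑ)) :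
    Measurable[history 𝔸 E n] fun ω => F (e ω) ω := by
  intro S hS
  have : (fun ω => F (e ω) ω) ⁻¹' S = ⋃ ϑ, {ω | e ω = ϑ} ∩ F ϑ ⁻¹' S := by
    ext ω; simp
  rw [this]
  exact @MeasurableSet.iUnion _ _ (history 𝔸 E n) _ _ fun ϑ => (he ϑ).inter (hF ϑ hS)

lemma estimator_update {n m : ℕ} {e : RunPath 𝔸 E → Θ}
    (he : ∀ ϑ, MeasurableSet[history 𝔸 E n] {ω | e ω = ϑ}) (h : n ≤ m) (ω : RunPath 𝔸 E)
    (y : Step 𝔸 E) : e (Function.update ω m y) = e ω :=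
  ((he (e ω)).mem_iff_of_agree (ω := Function.update ω m y) (ω' := ω)
    fun i hi => Function.update_of_ne (by omega) _ _).2 rfl

variable [Fintype 𝔸] [Nonempty 𝔸] [MeasurableSingletonClass 𝔸] {lam : Measure E}

/-- The estimator is known before the new record is drawn, so it acts as a constant in the one-step
integral and the bound `c` may depend on its value. -/
theorem lintegral_mul_estimator_step_le (g : ℕ → 𝔸 → Density lam) (π : Policy 𝔸 E) (n : ℕ)
    {H : RunPath 𝔸 E → ℝ≥0∞} (hH : Measurable[history 𝔸 E n] H) {e : RunPath 𝔸 E → Θ}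
    (he : ∀ ϑ, MeasurableSet[history 𝔸 E n] {ω | e ω = ϑ}) {φ : Θ → 𝔸 → E → ℝ≥0∞}
    (hφ : ∀ ϑ a, Measurable (φ ϑ a)) {c : Θ → ℝ≥0∞}
    (hc : ∀ ϑ a, ∫⁻ x, φ ϑ a x ∂(g (n + 1) a).toMeasure ≤ c ϑ) :
    ∫⁻ ω, H ω * φ (e ω) (RunPath.A (n + 1) ω) (RunPath.X (n + 1) ω) ∂(pathLaw g π) ≤
      ∫⁻ ω, H ω * c (e ω) ∂(pathLaw g π) := by
  have hmono := (history 𝔸 E).mono n.le_succ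
  have hH' := hH.mono hmono le_rfl
  have he' : ∀ ϑ, MeasurableSet[history 𝔸 E (n + 1)] {ω | e ω = ϑ} := fun ϑ => hmono _ (he ϑ)
  refine lintegral_pathLaw_le_of_step g π n
    (hH'.mul (measurable_comp_estimator he' (F := fun ϑ ω =>
      φ ϑ (RunPath.A (n + 1) ω) (RunPath.X (n + 1) ω))
      fun ϑ => measurable_comp_action_obs (hφ ϑ) (by omega) le_rfl))
    (hH'.mul (measurable_comp_estimator he' (F := fun ϑ _ => c ϑ)
      fun ϑ => @measurable_const _ _ _ (history 𝔸 E (n + 1)) _)) fun ω a => ?_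
  simp only [RunPath.A_update, RunPath.X_update, hH.update_of_le le_rfl, lintegral_const,
    measure_univ, mul_one, estimator_update he le_rfl]
  rw [lintegral_const_mul _ (hφ _ a)]
  gcongr
  exact hc _ a

end Estimator

/-! ### The mean time to false alarm of the CuSum procedure. -/

section FalseAlarm

variable {𝔸 E Θ : Type*} [MeasurableSpace 𝔸] [MeasurableSpace E] [Finite Θ]
  [Fintype 𝔸] [Nonempty 𝔸] [MeasurableSingletonClass 𝔸] {lam : Measure E}
  {pre : 𝔸 → Density lam} {post : Θ → 𝔸 → Density lam} {w : ℕ} {est : ℕ → RunPath 𝔸 E → Θ}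

lemma measurable_cusum
    (hest : ∀ n, w < n → ∀ ϑ : Θ, MeasurableSet[history 𝔸 E (n - 1)] {ω | est n ω = ϑ}) (n : ℕ) :
    Measurable[history 𝔸 E n] fun ω => cusum pre post w est ω n := by
  induction n with
  | zero => exact @measurable_const _ _ _ (history 𝔸 E 0) _
  | succ n ih =>
    simp only [cusum]
    split_ifs with h
    · exact @measurable_const _ _ _ (history 𝔸 E (n + 1)) _
    · have hmono := (history 𝔸 E).mono n.le_succ
      refine ((ih.mono hmono le_rfl).max (@measurable_const _ _ _ (history 𝔸 E (n + 1)) _)).add ?_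
      exact measurable_comp_estimator (fun ϑ => hmono _ (hest (n + 1) (by omega) ϑ))
        (F := fun ϑ ω => logRatio (post ϑ (RunPath.A (n + 1) ω)) (pre (RunPath.A (n + 1) ω))
          (RunPath.X (n + 1) ω))
        fun ϑ => measurable_comp_action_obs
          (φ := fun a x => logRatio (post ϑ a) (pre a) x)
          (fun a => measurable_logRatio _ _) (by omega) le_rfl

lemma cusumTime_le_iff {b : ℝ} {ω : RunPath 𝔸 E} {n : ℕ} :
    cusumTime pre post w est b ω ≤ n ↔
      ∃ k ≤ n, w < k ∧ (b : EReal) ≤ cusum pre post w est ω k := by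
  constructor
  · intro h
    by_contra! h'
    have : ((n + 1 : ℕ) : ℕ∞) ≤ cusumTime pre post w est b ω := by
      refine le_iInf₂ fun k hk => ?_
      rw [Nat.cast_le]
      by_contra hkn
      exact absurd hk.2 (not_le.2 (h' k (by omega) hk.1))
    have := Nat.cast_le.1 (this.trans h)
    omega
  · rintro ⟨k, hk, h⟩
    exact (iInf₂_le k h).trans (Nat.cast_le.2 hk)

lemma measurableSet_cusumTime_eq
    (hest : ∀ n, w < n → ∀ ϑ : Θ, MeasurableSet[history 𝔸 E (n - 1)] {ω | est n ω = ϑ})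
    (b : ℝ) (n : ℕ) :
    MeasurableSet[history 𝔸 E n] {ω | cusumTime pre post w est b ω = n} := by
  have hle : ∀ j, MeasurableSet[history 𝔸 E j] {ω | cusumTime pre post w est b ω ≤ j} := by
    intro j
    have : {ω | cusumTime pre post w est b ω ≤ j} = ⋃ k ∈ {k | k ≤ j ∧ w < k},
        {ω | (b : EReal) ≤ cusum pre post w est ω k} := by
      ext ω
      simp [cusumTime_le_iff, and_assoc]
    rw [this]
    refine @MeasurableSet.biUnion _ _ (history 𝔸 E j) _ _ (Set.to_countable _) fun k hk => ?_
    exact (history 𝔸 E).mono hk.1 _ (measurable_cusum hest k measurableSet_Ici)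
  rcases n with _ | n
  · convert! hle 0 using 3 with ω
    simp
  · have : {ω | cusumTime pre post w est b ω = (n + 1 : ℕ)} =
        {ω | cusumTime pre post w est b ω ≤ (n + 1 : ℕ)} \
          {ω | cusumTime pre post w est b ω ≤ n} := by
      ext ω
      simp only [Set.mem_ofPred_eq, Set.mem_sdiff, not_le]
      constructor
      · intro h; rw [h]; exact ⟨le_rfl, by exact_mod_cast n.lt_succ_self⟩
      · rintro ⟨h1, h2⟩
        refine le_antisymm h1 ?_
        push_cast
        exact Order.add_one_le_of_lt h2
    rw [this]
    exact (hle (n + 1)).diff ((history 𝔸 E).mono n.le_succ _ (hle n))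

/-- Equality fails if `f` charges the set where `g` vanishes; a supermartingale bound is all that is
needed. -/
lemma lintegral_ratio_le_one (f g : Density lam) :
    ∫⁻ x, (f.toFun x : ℝ≥0∞) / (g.toFun x : ℝ≥0∞) ∂g.toMeasure ≤ 1 := by
  have hf := f.measurable'
  have hg := g.measurable'
  rw [Density.toMeasure, lintegral_withDensity_eq_lintegral_mul _ (by fun_prop) (by fun_prop),
    ← f.lintegral_eq_one]
  exact lintegral_mono fun x => ENNReal.mul_div_le

/-- The Shiryaev–Roberts statistic for the estimated likelihood ratios. -/
def shiryaevRoberts (pre : 𝔸 → Density lam) (post : Θ → 𝔸 → Density lam) (w : ℕ)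
    (est : ℕ → RunPath 𝔸 E → Θ) (ω : RunPath 𝔸 E) : ℕ → ℝ≥0∞
  | 0 => 0
  | n + 1 =>
    if n + 1 ≤ w then 0
    else (1 + shiryaevRoberts pre post w est ω n) *
      (((post (est (n + 1) ω) (RunPath.A (n + 1) ω)).toFun (RunPath.X (n + 1) ω) : ℝ≥0∞) /
        ((pre (RunPath.A (n + 1) ω)).toFun (RunPath.X (n + 1) ω) : ℝ≥0∞))

/-- The two recursions differ only in that the factor max(exp W, 1) is replaced by the larger 1 + R.
At times `n ≤ w` both statistics are `0`, hence the restriction in the second claim. -/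
lemma exp_cusum_le_shiryaevRoberts (ω : RunPath 𝔸 E) (n : ℕ) :
    EReal.exp (max (cusum pre post w est ω n) 0) ≤ 1 + shiryaevRoberts pre post w est ω n ∧
      (w < n → EReal.exp (cusum pre post w est ω n) ≤ shiryaevRoberts pre post w est ω n) := by
  induction n with
  | zero => simp [cusum]
  | succ n ih =>
    by_cases h : n + 1 ≤ w
    · simp [cusum, h, not_lt.2 h]
    · have h2 : EReal.exp (cusum pre post w est ω (n + 1)) ≤
          shiryaevRoberts pre post w est ω (n + 1) := by
        simp only [cusum, shiryaevRoberts, if_neg h, EReal.exp_add, logRatio, ENNReal.exp_log]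
        gcongr
        exact ih.1
      refine ⟨?_, fun _ => h2⟩
      rw [EReal.exp_monotone.map_max, EReal.exp_zero]
      exact max_le (h2.trans le_add_self) le_self_add

lemma measurable_ratio (f g : Density lam) :
    Measurable fun x => (f.toFun x : ℝ≥0∞) / (g.toFun x : ℝ≥0∞) := by
  have hf := f.measurable'
  have hg := g.measurable'
  fun_prop

lemma measurable_shiryaevRoberts
    (hest : ∀ n, w < n → ∀ ϑ : Θ, MeasurableSet[history 𝔸 E (n - 1)] {ω | est n ω = ϑ}) (n : ℕ) :
    Measurable[history 𝔸 E n] fun ω => shiryaevRoberts pre post w est ω n := by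
  induction n with
  | zero => exact @measurable_const _ _ _ (history 𝔸 E 0) _
  | succ n ih =>
    simp only [shiryaevRoberts]
    split_ifs with h
    · exact @measurable_const _ _ _ (history 𝔸 E (n + 1)) _
    · have hmono := (history 𝔸 E).mono n.le_succ
      refine ((ih.mono hmono le_rfl).const_add 1).mul ?_
      exact measurable_comp_estimator (fun ϑ => hmono _ (hest (n + 1) (by omega) ϑ))
        (F := fun ϑ ω => ((post ϑ (RunPath.A (n + 1) ω)).toFun (RunPath.X (n + 1) ω) : ℝ≥0∞) /
          ((pre (RunPath.A (n + 1) ω)).toFun (RunPath.X (n + 1) ω) : ℝ≥0∞))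
        fun ϑ => measurable_comp_action_obs
          (φ := fun a x => ((post ϑ a).toFun x : ℝ≥0∞) / ((pre a).toFun x : ℝ≥0∞))
          (fun a => measurable_ratio _ _) (by omega) le_rfl

/-- Under the no-change law, the Shiryaev–Roberts statistic grows by at most one per step on
average, on every event of the past. -/
lemma setLIntegral_shiryaevRoberts_succ_le
    (hest : ∀ n, w < n → ∀ ϑ : Θ, MeasurableSet[history 𝔸 E (n - 1)] {ω | est n ω = ϑ})
    (π : Policy 𝔸 E) (n : ℕ) {B : Set (RunPath 𝔸 E)} (hB : MeasurableSet[history 𝔸 E n] B) :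
    ∫⁻ ω in B, shiryaevRoberts pre post w est ω (n + 1) ∂(lawNoChange pre π) ≤
      lawNoChange pre π B + ∫⁻ ω in B, shiryaevRoberts pre post w est ω n ∂(lawNoChange pre π) := by
  have hB0 := history_le _ _ hB
  by_cases h : n + 1 ≤ w
  · simp [shiryaevRoberts, h]
  have hR := measurable_shiryaevRoberts (pre := pre) (post := post) hest n
  have hR' : Measurable fun ω => 1 + shiryaevRoberts pre post w est ω n :=
    (hR.mono (history_le _) le_rfl).const_add 1
  have hH : Measurable[history 𝔸 E n]
      (B.indicator fun ω => 1 + shiryaevRoberts pre post w est ω n) := (hR.const_add 1).indicator hB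
  have key := lintegral_mul_estimator_step_le (fun _ => pre) π n hH (hest (n + 1) (by omega))
    (φ := fun ϑ a x => ((post ϑ a).toFun x : ℝ≥0∞) / ((pre a).toFun x : ℝ≥0∞))
    (fun ϑ a => measurable_ratio _ _) (c := fun _ => 1) (fun ϑ a => lintegral_ratio_le_one _ _)
  simp only [mul_one] at key
  rw [lintegral_indicator hB0] at key
  calc _ = _ := by
        rw [← lintegral_indicator hB0]
        refine lintegral_congr fun ω => ?_
        simp only [shiryaevRoberts, if_neg h]
        exact (Set.indicator_mul_left B (fun ω => 1 + shiryaevRoberts pre post w est ω n) _)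
    _ ≤ _ := key
    _ = _ := by
        rw [lintegral_add_left measurable_const]
        simp [lawNoChange]

/-- Optional stopping for the supermartingale R_n - n: at an alarm R is at least `exp b`, while its
mean growth is paid for by the tail sum of `T`. -/
theorem le_lintegral_cusumTime
    (hest : ∀ n, w < n → ∀ ϑ : Θ, MeasurableSet[history 𝔸 E (n - 1)] {ω | est n ω = ϑ})
    (π : Policy 𝔸 E) (b : ℝ) :
    ENNReal.ofReal (Real.exp b) ≤
      ∫⁻ ω, (cusumTime pre post w est b ω : ℝ≥0∞) ∂(lawNoChange pre π) := by
  set T := cusumTime pre post w est b with hTdef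
  set μ := lawNoChange pre π
  have hT : ∀ n : ℕ, MeasurableSet[history 𝔸 E n] {ω | T ω = n} :=
    measurableSet_cusumTime_eq hest b
  have hTm := measurable_time hT
  -- Optional stopping by hand at time `min T n`: the mass of R already stopped, plus the mass still
  -- running, is at most the mean number of steps taken.
  have htel : ∀ n : ℕ, ∑ k ∈ Finset.range n,
      (∫⁻ ω in {ω | T ω = (k + 1 : ℕ)}, shiryaevRoberts pre post w est ω (k + 1) ∂μ) +
      ∫⁻ ω in {ω | (n : ℕ∞) < T ω}, shiryaevRoberts pre post w est ω n ∂μ ≤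
      ∑ k ∈ Finset.range n, μ {ω | (k : ℕ∞) < T ω} := by
    intro n
    induction n with
    | zero => simp [shiryaevRoberts]
    | succ n ih =>
      have hsplit : {ω | (n : ℕ∞) < T ω} =
          {ω | T ω = (n + 1 : ℕ)} ∪ {ω | ((n + 1 : ℕ) : ℕ∞) < T ω} := by
        ext ω
        simp only [Set.mem_ofPred_eq, Set.mem_union]
        rw [eq_comm, ← le_iff_eq_or_lt]
        push_cast
        exact (ENat.add_one_le_iff (ENat.natCast_ne_top n)).symm
      have hdisj : Disjoint {ω | T ω = (n + 1 : ℕ)} {ω | ((n + 1 : ℕ) : ℕ∞) < T ω} :=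
        Set.disjoint_left.2 fun ω h1 h2 => by
          rw [Set.mem_ofPred_eq] at h1 h2
          exact h2.ne' h1
      have hstep := setLIntegral_shiryaevRoberts_succ_le (pre := pre) (post := post) hest π n
        (measurableSet_lt_time hT n)
      have heq : ∫⁻ ω in {ω | (n : ℕ∞) < T ω}, shiryaevRoberts pre post w est ω (n + 1) ∂μ =
          ∫⁻ ω in {ω | T ω = (n + 1 : ℕ)}, shiryaevRoberts pre post w est ω (n + 1) ∂μ +
          ∫⁻ ω in {ω | ((n + 1 : ℕ) : ℕ∞) < T ω},
            shiryaevRoberts pre post w est ω (n + 1) ∂μ := by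
        conv_lhs => rw [hsplit]
        exact lintegral_union (measurableSet_lt_time' hT (n + 1)) hdisj
      rw [Finset.sum_range_succ, Finset.sum_range_succ, add_assoc, ← heq]
      calc _ ≤ _ + (_ + _) := add_le_add_right hstep _
        _ = (_ + _) + _ := by rw [add_comm (μ _), ← add_assoc]
        _ ≤ _ := add_le_add_left ih _
  have hR : ∀ k : ℕ, ENNReal.ofReal (Real.exp b) * μ {ω | T ω = (k + 1 : ℕ)} ≤
      ∫⁻ ω in {ω | T ω = (k + 1 : ℕ)}, shiryaevRoberts pre post w est ω (k + 1) ∂μ := by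
    intro k
    rw [← setLIntegral_const]
    refine setLIntegral_mono' (history_le _ _ (hT (k + 1))) fun ω hω => ?_
    obtain ⟨j, hj, hwj, hbj⟩ := cusumTime_le_iff.1 (le_of_eq hω)
    have hj' : k + 1 ≤ j := by
      have h1 : T ω ≤ (j : ℕ) := cusumTime_le_iff.2 ⟨j, le_rfl, hwj, hbj⟩
      rw [show T ω = _ from hω] at h1
      exact Nat.cast_le.1 h1
    obtain rfl : j = k + 1 := le_antisymm hj hj'
    refine le_trans ?_ ((exp_cusum_le_shiryaevRoberts ω (k + 1)).2 hwj)
    rw [← EReal.exp_coe]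
    exact EReal.exp_monotone hbj
  -- If `T` is infinite with positive probability, its mean is infinite and nothing is to be shown.
  -- Otherwise the events that `T` equals `k + 1` exhaust the probability, since an alarm at time
  -- `0` is impossible.
  by_cases htop : μ {ω | T ω = ⊤} = 0
  · have h0 : {ω | T ω = (0 : ℕ)} = ∅ := by
      ext ω
      simp only [Set.mem_ofPred_eq, Set.mem_empty_iff_false, iff_false]
      intro h
      obtain ⟨j, hj, hwj, -⟩ := cusumTime_le_iff.1 (le_of_eq h)
      omega
    have huniv : (1 : ℝ≥0∞) ≤ ∑' k : ℕ, μ {ω | T ω = (k + 1 : ℕ)} := by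
      calc (1 : ℝ≥0∞) = μ Set.univ := measure_univ.symm
        _ ≤ μ ({ω | T ω = ⊤} ∪ ⋃ k : ℕ, {ω | T ω = (k + 1 : ℕ)}) := by
          refine measure_mono fun ω _ => ?_
          rcases eq_or_ne (T ω) ⊤ with h | h
          · exact Or.inl h
          · obtain ⟨m, hm⟩ := ENat.ne_top_iff_exists.1 h
            rcases m with _ | m
            · have : ω ∈ {ω | T ω = (0 : ℕ)} := hm.symm
              exact absurd this (by rw [h0]; simp)
            · exact Or.inr (Set.mem_iUnion.2 ⟨m, hm.symm⟩)
        _ ≤ _ := (measure_union_le _ _).trans (by rw [htop, zero_add]; exact measure_iUnion_le _)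
    calc _ ≤ ENNReal.ofReal (Real.exp b) * ∑' k : ℕ, μ {ω | T ω = (k + 1 : ℕ)} :=
          le_mul_of_one_le_right' huniv
      _ ≤ _ := by
        rw [← ENNReal.tsum_mul_left, ENNReal.tsum_eq_iSup_nat]
        refine iSup_le fun n => ?_
        refine (Finset.sum_le_sum fun k _ => hR k).trans ?_
        exact le_self_add.trans ((htel n).trans (sum_measure_lt_time_le hT μ n))
  · refine le_top.trans (le_of_eq ?_)
    by_contra hne
    refine htop ?_
    have hTm' : Measurable fun ω => (T ω : ℝ≥0∞) := (measurable_of_countable _).comp hTm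
    have := ae_lt_top (μ := μ) hTm' (Ne.symm hne)
    exact measure_mono_null (fun ω hω => by simp [show T ω = _ from hω]) this

end FalseAlarm

end

noncomputable section

section LordenDelay

variable {𝔸 E : Type*} [MeasurableSpace 𝔸] [MeasurableSpace E]
  [Fintype 𝔸] [Nonempty 𝔸] [MeasurableSingletonClass 𝔸] {lam : Measure E}
  {pre post : 𝔸 → Density lam}

/-! ### Lorden's delay through integrals over events of the past -/

lemma ennreal_add_one_sub_succ (t : ℝ≥0∞) (s : ℕ) :
    t + 1 - ((s + 1 : ℕ) : ℝ≥0∞) = t - s := by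
  push_cast
  rw [add_comm (s : ℝ≥0∞) 1, tsub_add_eq_tsub_tsub, ENNReal.add_sub_cancel_right ENNReal.one_ne_top]

/-- With its converse `lordenDelay_le_of_forall_setLIntegral`, this eliminates conditional
expectations and essential suprema. The change-point is `s + 1`, so that the delay is `T - s` and
the conditioning is on `F_s`. -/
lemma setLIntegral_le_lordenDelay_mul (p : Policy 𝔸 E × (RunPath 𝔸 E → ℕ∞)) (s : ℕ)
    {B : Set (RunPath 𝔸 E)} (hB : MeasurableSet[history 𝔸 E s] B) :
    ∫⁻ ω in B, ((p.2 ω : ℝ≥0∞) - s) ∂(lawChange pre post (s + 1) p.1) ≤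
      lordenDelay pre post p * lawChange pre post (s + 1) p.1 B := by
  have h1 : essSup (condLExp (history 𝔸 E (s + 1 - 1)) (lawChange pre post (s + 1) p.1)
      (fun ω => (p.2 ω : ℝ≥0∞) + 1 - ((s + 1 : ℕ) : ℝ≥0∞))) (lawChange pre post (s + 1) p.1) ≤
      lordenDelay pre post p :=
    le_iSup₂_of_le (f := fun (ν : ℕ) (_ : 1 ≤ ν) => essSup (condLExp (history 𝔸 E (ν - 1))
      (lawChange pre post ν p.1) (fun ω => (p.2 ω : ℝ≥0∞) + 1 - (ν : ℝ≥0∞)))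
      (lawChange pre post ν p.1)) (s + 1) (by omega) le_rfl
  simp only [ennreal_add_one_sub_succ, Nat.add_sub_cancel] at h1
  rw [← setLIntegral_condLExp (hm := history_le s) _ _ hB]
  calc _ ≤ ∫⁻ _ in B, lordenDelay pre post p ∂(lawChange pre post (s + 1) p.1) := by
        refine lintegral_mono_ae (ae_restrict_of_ae ?_)
        filter_upwards [ENNReal.ae_le_essSup (μ := lawChange pre post (s + 1) p.1)
          (condLExp (history 𝔸 E s) (lawChange pre post (s + 1) p.1)
            (fun ω => (p.2 ω : ℝ≥0∞) - s))] with ω hω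
        exact hω.trans h1
    _ = _ := setLIntegral_const _ _

lemma lordenDelay_le_of_forall_setLIntegral (p : Policy 𝔸 E × (RunPath 𝔸 E → ℕ∞)) (c : ℝ≥0∞)
    (h : ∀ (s : ℕ) (B : Set (RunPath 𝔸 E)), MeasurableSet[history 𝔸 E s] B →
      ∫⁻ ω in B, ((p.2 ω : ℝ≥0∞) - s) ∂(lawChange pre post (s + 1) p.1) ≤
        c * lawChange pre post (s + 1) p.1 B) :
    lordenDelay pre post p ≤ c := by
  refine iSup₂_le fun ν hν => ?_
  obtain ⟨s, rfl⟩ : ∃ s, ν = s + 1 := ⟨ν - 1, by omega⟩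
  simp only [ennreal_add_one_sub_succ, Nat.add_sub_cancel]
  refine essSup_le_of_ae_le _ ?_
  set μ := lawChange pre post (s + 1) p.1
  refine ae_of_ae_trim (history_le s) ?_
  refine ae_le_of_forall_setLIntegral_le_of_sigmaFinite (m0 := history 𝔸 E s)
    (measurable_condLExp _ _ _) fun B hB _ => ?_
  refine le_trans (le_of_eq (setLIntegral_condLExp_trim _ μ _ hB)) ?_
  refine (h s B hB).trans (le_of_eq ?_)
  rw [setLIntegral_const, trim_measurableSet_eq _ hB]

/-! ### Change of measure -/

/-- Makes the one-step formula iterable: after integrating out the last record, the result is again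
determined by the records before it. -/
lemma measurable_step_mean (g : 𝔸 → Density lam) (π : Policy 𝔸 E) (n : ℕ)
    {F : RunPath 𝔸 E → ℝ≥0∞} (hF : Measurable[history 𝔸 E (n + 1)] F) :
    Measurable[history 𝔸 E n] fun ω => ∫⁻ a, ∫⁻ x, ∫⁻ u, F (Function.update ω n (a, x, u)) ∂volume
        ∂(g a).toMeasure ∂(π.actionLaw n ω) := by
  have hF' : Measurable F := hF.mono (history_le _) le_rfl
  have h1 : ∀ a, Measurable[history 𝔸 E n] fun ω : RunPath 𝔸 E =>
      ∫⁻ x, ∫⁻ u, F (Function.update ω n (a, x, u)) ∂volume ∂(g a).toMeasure := by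
    intro a
    have h2 : Measurable[(history 𝔸 E n).prod inferInstance, history 𝔸 E (n + 1)]
        (fun q : RunPath 𝔸 E × (E × unitInterval) => Function.update q.1 n (a, q.2)) := by
      rw [history_eq_comap (n + 1), measurable_comap_iff]
      refine @measurable_pi_lambda _ _ _ ((history 𝔸 E n).prod inferInstance) _ _ fun i => ?_
      by_cases hi : (i : ℕ) = n
      · have : (fun q : RunPath 𝔸 E × (E × unitInterval) => Function.update q.1 n (a, q.2) (i : ℕ)) =
            fun q => (a, q.2) := by
          funext q; rw [hi, Function.update_self]
        change Measurable[(history 𝔸 E n).prod inferInstance] (fun q : RunPath 𝔸 E ×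
          (E × unitInterval) => Function.update q.1 n (a, q.2) (i : ℕ))
        rw [this]
        exact measurable_prodMk_left.comp
          (@measurable_snd _ _ (history 𝔸 E n) _)
      · have : (fun q : RunPath 𝔸 E × (E × unitInterval) => Function.update q.1 n (a, q.2) (i : ℕ)) =
            fun q => q.1 i := by
          funext q; rw [Function.update_of_ne hi]
        change Measurable[(history 𝔸 E n).prod inferInstance] (fun q : RunPath 𝔸 E ×
          (E × unitInterval) => Function.update q.1 n (a, q.2) (i : ℕ))
        rw [this]
        exact (measurable_coord_history (by omega)).comp
          (@measurable_fst _ _ (history 𝔸 E n) _)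
    have h3 := @Measurable.lintegral_prod_right' _ _ (history 𝔸 E n) _
      ((g a).toMeasure.prod (volume : Measure unitInterval)) _ _ (hF.comp h2)
    convert! h3 using 2 with ω
    rw [lintegral_prod _ (by
      refine Measurable.aemeasurable ?_
      refine hF'.comp (measurable_pi_lambda _ fun i => ?_)
      by_cases hi : i = n
      · subst hi; simp only [Function.update_self]; fun_prop
      · simp only [Function.update_of_ne hi]; fun_prop)]
    rfl
  by_cases hn : n = 0
  · simp only [Policy.actionLaw, hn, if_true, lintegral_fintype]
    subst hn
    exact Finset.measurable_fun_sum _ fun a _ => (h1 a).mul_const _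
  · simp only [Policy.actionLaw, hn, if_false, lintegral_dirac]
    exact measurable_comp_estimator (fun a =>
      π.measurable_action (by omega) le_rfl (measurableSet_singleton a)) h1

/-- Peeling off records one at a time, only the densities at times up to `n` ever enter. In
particular the pre-change past has the no-change law. -/
lemma lintegral_pathLaw_congr {g g' : ℕ → 𝔸 → Density lam} (π : Policy 𝔸 E) {n : ℕ}
    (h : ∀ m, 1 ≤ m → m ≤ n → g m = g' m) {F : RunPath 𝔸 E → ℝ≥0∞}
    (hF : Measurable[history 𝔸 E n] F) :
    ∫⁻ ω, F ω ∂(pathLaw g π) = ∫⁻ ω, F ω ∂(pathLaw g' π) := by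
  induction n generalizing F with
  | zero =>
    have ω₀ : RunPath 𝔸 E := (nonempty_of_isProbabilityMeasure (pathLaw g π)).some
    have : F = fun _ => F ω₀ := funext fun ω => hF.eq_of_agree fun i hi => by omega
    rw [this]
    simp
  | succ n ih =>
    rw [lintegral_pathLaw_step g π n hF, lintegral_pathLaw_step g' π n hF,
      h (n + 1) (by omega) le_rfl]
    exact ih (fun m h1 h2 => h m h1 (by omega)) (measurable_step_mean _ π n hF)

lemma lintegral_lawChange_eq (π : Policy 𝔸 E) (s : ℕ) {F : RunPath 𝔸 E → ℝ≥0∞}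
    (hF : Measurable[history 𝔸 E s] F) :
    ∫⁻ ω, F ω ∂(lawChange pre post (s + 1) π) = ∫⁻ ω, F ω ∂(lawNoChange pre π) :=
  lintegral_pathLaw_congr π (fun m _ hm => if_pos (by omega)) hF

lemma lawChange_apply_eq (π : Policy 𝔸 E) (s : ℕ) {B : Set (RunPath 𝔸 E)}
    (hB : MeasurableSet[history 𝔸 E s] B) :
    lawChange pre post (s + 1) π B = lawNoChange pre π B := by
  have h := lintegral_lawChange_eq (pre := pre) (post := post) π s (F := B.indicator fun _ => 1)
    ((@measurable_const _ _ _ (history 𝔸 E s) _).indicator hB)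
  simpa [lintegral_indicator_const (history_le _ _ hB)] using h

/-- Wald's likelihood ratio identity as an inequality. The policy contributes the same action law
under both measures, so only the observations produce density factors; one factor is split off per
step. -/
theorem lintegral_lawChange_le (hac : ∀ a, (post a).toMeasure ≪ (pre a).toMeasure)
    (π : Policy 𝔸 E) (s k : ℕ) {F : RunPath 𝔸 E → ℝ≥0∞}
    (hF : Measurable[history 𝔸 E (s + k)] F) :
    ∫⁻ ω, F ω ∂(lawChange pre post (s + 1) π) ≤
      ∫⁻ ω, F ω * ∏ i ∈ Finset.range k, ENNReal.ofReal (Real.exp (logLR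
        (post (RunPath.A (s + i + 1) ω)) (pre (RunPath.A (s + i + 1) ω))
        (RunPath.X (s + i + 1) ω))) ∂(lawNoChange pre π) := by
  have hm : ∀ a, Measurable fun x => ENNReal.ofReal (Real.exp (logLR (post a) (pre a) x)) :=
    fun a => (measurable_logLR _ _).exp.ennreal_ofReal
  have hL : ∀ j n, s + j ≤ n → Measurable[history 𝔸 E n] fun ω : RunPath 𝔸 E =>
      ∏ i ∈ Finset.range j, ENNReal.ofReal (Real.exp (logLR
        (post (RunPath.A (s + i + 1) ω)) (pre (RunPath.A (s + i + 1) ω))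
        (RunPath.X (s + i + 1) ω))) := fun j n hj =>
    Finset.measurable_fun_prod _ fun i hi => measurable_comp_action_obs
      (φ := fun a x => ENNReal.ofReal (Real.exp (logLR (post a) (pre a) x))) hm (by omega)
      (by have := Finset.mem_range.1 hi; omega)
  induction k generalizing F with
  | zero => simpa using (lintegral_lawChange_eq π s hF).le
  | succ k ih =>
    have hF' : Measurable F := hF.mono (history_le _) le_rfl
    rw [lawChange, lintegral_pathLaw_step _ π (s + k) hF, if_neg (by omega)]
    refine (ih (measurable_step_mean post π (s + k) hF)).trans ?_
    have hFL : Measurable[history 𝔸 E (s + k + 1)] fun ω : RunPath 𝔸 E =>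
        F ω * ∏ i ∈ Finset.range (k + 1), ENNReal.ofReal (Real.exp (logLR
        (post (RunPath.A (s + i + 1) ω)) (pre (RunPath.A (s + i + 1) ω))
        (RunPath.X (s + i + 1) ω))) := hF.mul (hL (k + 1) _ (by omega))
    rw [lawNoChange, lintegral_pathLaw_step _ π (s + k) hFL]
    refine lintegral_mono fun ω => ?_
    simp only
    have hFu : ∀ a, Measurable fun p : E × unitInterval =>
        F (Function.update ω (s + k) (a, p.1, p.2)) := fun a => by
      refine hF'.comp (measurable_pi_lambda _ fun i => ?_)
      by_cases hi : i = s + k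
      · subst hi; simp only [Function.update_self]; fun_prop
      · simp only [Function.update_of_ne hi]; fun_prop
    -- The product of the earlier `k` factors does not see the newest record and passes through the
    -- inner integrals as the constant `c`.
    rw [mul_comm, ← lintegral_const_mul _ (measurable_of_countable _)]
    refine lintegral_mono fun a => ?_
    simp only [Finset.prod_range_succ, RunPath.A_update, RunPath.X_update]
    have hLu : ∀ y, (∏ i ∈ Finset.range k, ENNReal.ofReal (Real.exp (logLR
        (post (RunPath.A (s + i + 1) (Function.update ω (s + k) y)))
        (pre (RunPath.A (s + i + 1) (Function.update ω (s + k) y)))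
        (RunPath.X (s + i + 1) (Function.update ω (s + k) y))))) =
        ∏ i ∈ Finset.range k, ENNReal.ofReal (Real.exp (logLR
        (post (RunPath.A (s + i + 1) ω)) (pre (RunPath.A (s + i + 1) ω))
        (RunPath.X (s + i + 1) ω))) := fun y => (hL k _ le_rfl).update_of_le le_rfl ω y
    simp only [hLu]
    set c := ∏ i ∈ Finset.range k, ENNReal.ofReal (Real.exp (logLR
        (post (RunPath.A (s + i + 1) ω)) (pre (RunPath.A (s + i + 1) ω))
        (RunPath.X (s + i + 1) ω)))
    have hG : Measurable fun x => ∫⁻ u, F (Function.update ω (s + k) (a, x, u)) :=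
      (hFu a).lintegral_prod_right'
    have e1 : ∀ x, ∫⁻ u, F (Function.update ω (s + k) (a, x, u)) *
        (c * ENNReal.ofReal (Real.exp (logLR (post a) (pre a) x))) =
        c * ((∫⁻ u, F (Function.update ω (s + k) (a, x, u))) *
          ENNReal.ofReal (Real.exp (logLR (post a) (pre a) x))) := fun x => by
      rw [lintegral_mul_const _ (show Measurable fun u => F (Function.update ω (s + k) (a, x, u)) from
        (hFu a).comp measurable_prodMk_left)]
      ring
    simp only [e1]
    have hGm : Measurable fun x => (∫⁻ u, F (Function.update ω (s + k) (a, x, u))) *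
        ENNReal.ofReal (Real.exp (logLR (post a) (pre a) x)) := hG.mul (hm a)
    rw [lintegral_const_mul _ hGm]
    exact mul_le_mul_right (lintegral_le_lintegral_mul_exp_logLR (hac a) hG) c

/-! ### The universal lower bound -/

/-- The log-likelihood ratio of the action `a` minus its mean. -/
def centredLLR (pre post : 𝔸 → Density lam) (a : 𝔸) (x : E) : ℝ :=
  logLR (post a) (pre a) x - (actionInfo pre post a).toReal

lemma measurable_centredLLR (a : 𝔸) : Measurable (centredLLR pre post a) :=
  (measurable_logLR _ _).sub_const _

/-- Chebyshev conditionally on the past. Although actions are adaptive, each increment is centred at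
the divergence of the action actually taken, so the increments are conditionally centred under every
policy. All times involved are past the change because `ν ≤ s + 1`. -/
theorem lawChange_centred_sum_ge_le {V : ℝ≥0}
    (hV : ∀ a, ∫⁻ x, (logRatio (post a) (pre a) x).abs ^ 2 ∂(post a).toMeasure ≤ V)
    (π : Policy 𝔸 E) (ν s : ℕ) (hν : ν ≤ s + 1) {k : ℕ} (hk : 0 < k) {η : ℝ} (hη : 0 < η)
    {B : Set (RunPath 𝔸 E)} (hB : MeasurableSet[history 𝔸 E s] B) :
    lawChange pre post ν π (B ∩ {ω | η * k ≤ |∑ i ∈ Finset.range k,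
      centredLLR pre post (RunPath.A (s + i + 1) ω) (RunPath.X (s + i + 1) ω)|}) ≤
      ENNReal.ofReal (V / (η ^ 2 * k)) * lawChange pre post ν π B := by
  have hc := setLIntegral_sq_sum_le (fun n => if n < ν then pre else post) π s k hB
    (ξ := centredLLR pre post) measurable_centredLLR (V := V) fun i hi a z => by
      rw [if_neg (by omega)]
      exact lintegral_sq_add_centred_le ENNReal.coe_lt_top (hV a) z
  set S : RunPath 𝔸 E → ℝ := fun ω => ∑ i ∈ Finset.range k,
      centredLLR pre post (RunPath.A (s + i + 1) ω) (RunPath.X (s + i + 1) ω) with hS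
  have hSm : Measurable S := Finset.measurable_fun_sum _ fun i hi =>
    (measurable_comp_action_obs measurable_centredLLR (by omega) le_rfl).mono (history_le _) le_rfl
  have hD : MeasurableSet {ω | η * k ≤ |S ω|} := measurableSet_le measurable_const hSm.abs
  have hpos : (0 : ℝ) < η * k := by positivity
  have h1 : ENNReal.ofReal ((η * k) ^ 2) * lawChange pre post ν π (B ∩ {ω | η * k ≤ |S ω|}) ≤
      k * V * lawChange pre post ν π B := by
    refine le_trans ?_ hc
    rw [← setLIntegral_const]
    refine (setLIntegral_mono' ((history_le _ _ hB).inter hD) fun ω hω => ?_).trans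
      (lintegral_mono_set Set.inter_subset_left)
    refine ENNReal.ofReal_le_ofReal ?_
    rw [← sq_abs (S ω)]
    exact pow_le_pow_left₀ hpos.le hω.2 2
  have h2 : ENNReal.ofReal ((η * k) ^ 2) ≠ 0 :=
    (ENNReal.ofReal_pos.2 (by positivity)).ne'
  rw [← ENNReal.mul_le_mul_iff_right h2 ENNReal.ofReal_ne_top]
  refine h1.trans (le_of_eq ?_)
  rw [← mul_assoc, ← ENNReal.ofReal_mul (by positivity)]
  congr 1
  have : (η * k) ^ 2 * (V / (η ^ 2 * k)) = k * V := by field_simp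
  rw [this, ENNReal.ofReal_mul (by positivity)]
  simp

lemma measure_lt_time_eq_add {T : RunPath 𝔸 E → ℕ∞}
    (hT : ∀ n : ℕ, MeasurableSet[history 𝔸 E n] {ω | T ω = n}) (μ : Measure (RunPath 𝔸 E))
    (s m : ℕ) : μ {ω | (s : ℕ∞) < T ω} =
      μ ({ω | (s : ℕ∞) < T ω} \ {ω | ((s + m : ℕ) : ℕ∞) < T ω}) +
        μ {ω | ((s + m : ℕ) : ℕ∞) < T ω} := by
  have hsub : {ω | ((s + m : ℕ) : ℕ∞) < T ω} ⊆ {ω | (s : ℕ∞) < T ω} := fun ω hω =>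
    show (s : ℕ∞) < T ω from
    lt_of_le_of_lt (Nat.cast_le.2 (Nat.le_add_right s m)) hω
  have h := measure_inter_add_sdiff (μ := μ) {ω | (s : ℕ∞) < T ω} (measurableSet_lt_time' hT (s + m))
  rw [Set.inter_eq_self_of_subset_right hsub, add_comm] at h
  exact h.symm

/-- If the mean of `T` is at least `γ`, then for some time `s` an alarm within the next `m` steps
has conditional probability at most `2 m / γ`. -/
lemma exists_rare_alarm {T : RunPath 𝔸 E → ℕ∞}
    (hT : ∀ n : ℕ, MeasurableSet[history 𝔸 E n] {ω | T ω = n}) (μ : Measure (RunPath 𝔸 E))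
    [IsProbabilityMeasure μ] {γ : ℝ≥0∞} (hγ : γ ≠ 0) (hγ' : γ ≠ ∞)
    (h : γ ≤ ∫⁻ ω, (T ω : ℝ≥0∞) ∂μ) {m : ℕ} (hm : 1 ≤ m) :
    ∃ s : ℕ, μ {ω | (s : ℕ∞) < T ω} ≠ 0 ∧
      γ * μ ({ω | (s : ℕ∞) < T ω} \ {ω | ((s + m : ℕ) : ℕ∞) < T ω}) ≤
        2 * m * μ {ω | (s : ℕ∞) < T ω} := by
  by_contra! hcon
  have h1 : ∀ s : ℕ, 2 * m * μ {ω | (s : ℕ∞) < T ω} ≤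
      γ * μ ({ω | (s : ℕ∞) < T ω} \ {ω | ((s + m : ℕ) : ℕ∞) < T ω}) := fun s => by
    by_cases h0 : μ {ω | (s : ℕ∞) < T ω} = 0
    · simp [h0]
    · exact (hcon s h0).le
  -- Alarms in the disjoint blocks of length `m` have total probability at most one.
  have h2 : ∀ K : ℕ, ∑ k ∈ Finset.range K, μ ({ω | ((k * m : ℕ) : ℕ∞) < T ω} \
      {ω | ((k * m + m : ℕ) : ℕ∞) < T ω}) + μ {ω | ((K * m : ℕ) : ℕ∞) < T ω} ≤ 1 := by
    intro K
    induction K with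
    | zero => simpa using prob_le_one
    | succ K ih =>
      rw [Finset.sum_range_succ, add_assoc, add_mul, one_mul,
        ← measure_lt_time_eq_add hT μ (K * m) m]
      exact ih
  -- If every block had a larger alarm probability, summing over blocks and bounding the mean of `T`
  -- by `m` times the sum of its block tails would give twice the mean at most `γ`, against the
  -- hypothesis.
  have h3 : 2 * ∫⁻ ω, (T ω : ℝ≥0∞) ∂μ ≤ γ := by
    have := lintegral_time_sub_le hT μ 0 hm
    simp only [CharP.cast_eq_zero, tsub_zero, zero_add] at this
    refine (mul_le_mul_right this 2).trans ?_
    rw [← ENNReal.tsum_mul_left, ENNReal.tsum_eq_iSup_nat]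
    refine iSup_le fun K => ?_
    calc _ ≤ ∑ k ∈ Finset.range K, γ * μ ({ω | ((k * m : ℕ) : ℕ∞) < T ω} \
          {ω | ((k * m + m : ℕ) : ℕ∞) < T ω}) :=
          Finset.sum_le_sum fun k _ => by rw [← mul_assoc]; exact h1 (k * m)
      _ ≤ γ * 1 := by
          rw [← Finset.mul_sum]
          gcongr
          exact le_self_add.trans (h2 K)
      _ = γ := mul_one _
  have h4 : γ + γ ≤ γ + 0 := by
    rw [← two_mul, add_zero]
    exact (mul_le_mul_right h 2).trans h3
  exact hγ (nonpos_iff_eq_zero.1 ((ENNReal.add_le_add_iff_left hγ').1 h4))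

/-- Lai's change-of-measure argument at the time `s` supplied by `exists_rare_alarm`. The first
error term is the false-alarm probability inflated by the likelihood ratio, the second is the
Chebyshev bound for an untypically large ratio. -/
theorem le_lordenDelay_of_mem_procedureClass {V : ℝ≥0}
    (hV : ∀ a, ∫⁻ x, (logRatio (post a) (pre a) x).abs ^ 2 ∂(post a).toMeasure ≤ V)
    {I : ℝ} (hI : ∀ a, (actionInfo pre post a).toReal ≤ I) {γ : ℝ} (hγ : 0 < γ)
    {p : Policy 𝔸 E × (RunPath 𝔸 E → ℕ∞)} (hp : p ∈ procedureClass pre γ)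
    {m : ℕ} (hm : 1 ≤ m) {η : ℝ} (hη : 0 < η) :
    m * (1 - ENNReal.ofReal (Real.exp ((I + η) * m) * (2 * m / γ) + V / (η ^ 2 * m))) ≤
      lordenDelay pre post p := by
  obtain ⟨π, T⟩ := p
  obtain ⟨hT, hET⟩ := hp
  simp only at hT hET
  have hac : ∀ a, (post a).toMeasure ≪ (pre a).toMeasure := fun a =>
    ac_of_lintegral_logRatio_sq_lt_top ((hV a).trans_lt ENNReal.coe_lt_top)
  obtain ⟨s, hs0, hs⟩ := exists_rare_alarm hT (lawNoChange pre π)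
    (by simpa using hγ) ENNReal.ofReal_ne_top hET hm
  set B := {ω | (s : ℕ∞) < T ω} with hBdef
  set B' := {ω | ((s + m : ℕ) : ℕ∞) < T ω} with hB'def
  have hB : MeasurableSet[history 𝔸 E s] B := measurableSet_lt_time hT s
  have hB' : MeasurableSet[history 𝔸 E (s + m)] B' := measurableSet_lt_time hT (s + m)
  have hC : MeasurableSet[history 𝔸 E (s + m)] (B \ B') :=
    ((history 𝔸 E).mono (by omega) _ hB).diff hB'
  set P := lawChange pre post (s + 1) π with hP
  set Q := lawNoChange pre π with hQ
  have hPB : P B = Q B := lawChange_apply_eq π s hB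
  set S : RunPath 𝔸 E → ℝ := fun ω => ∑ i ∈ Finset.range m, logLR
        (post (RunPath.A (s + i + 1) ω)) (pre (RunPath.A (s + i + 1) ω))
        (RunPath.X (s + i + 1) ω) with hS
  have hSm : Measurable[history 𝔸 E (s + m)] S := Finset.measurable_fun_sum _ fun i hi =>
    measurable_comp_action_obs (φ := fun a x => logLR (post a) (pre a) x)
      (fun a => measurable_logLR _ _) (by omega) (by have := Finset.mem_range.1 hi; omega)
  -- The typical event, on which the density of the changed law with respect to the no-change law is
  -- at most `exp((I + η) m)`.
  set D := {ω | S ω ≤ (I + η) * m} with hD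
  have hDm : MeasurableSet[history 𝔸 E (s + m)] D :=
    hSm measurableSet_Iic
  have hCD := hC.inter hDm
  have b1 : P ((B \ B') ∩ D) ≤ ENNReal.ofReal (Real.exp ((I + η) * m)) * Q (B \ B') := by
    have := lintegral_lawChange_le hac π s m (F := ((B \ B') ∩ D).indicator fun _ => 1)
      ((@measurable_const _ _ _ (history 𝔸 E (s + m)) _).indicator hCD)
    rw [lintegral_indicator_const (history_le _ _ hCD), one_mul] at this
    refine this.trans ?_
    rw [← lintegral_indicator_const (history_le _ _ hC)]
    refine lintegral_mono fun ω => ?_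
    by_cases hω : ω ∈ (B \ B') ∩ D
    · rw [Set.indicator_of_mem hω, Set.indicator_of_mem hω.1, one_mul,
        ← ENNReal.ofReal_prod_of_nonneg fun i _ => (Real.exp_pos _).le, ← Real.exp_sum]
      exact ENNReal.ofReal_le_ofReal (Real.exp_le_exp.2 hω.2)
    · simp [Set.indicator_of_notMem hω]
  have b1' : P ((B \ B') ∩ D) ≤
      ENNReal.ofReal (Real.exp ((I + η) * m) * (2 * m / γ)) * P B := by
    have hγ0 : ENNReal.ofReal γ ≠ 0 := by simpa using hγ
    rw [← ENNReal.mul_le_mul_iff_right hγ0 ENNReal.ofReal_ne_top]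
    calc _ ≤ ENNReal.ofReal γ * (ENNReal.ofReal (Real.exp ((I + η) * m)) * Q (B \ B')) := by gcongr
      _ = ENNReal.ofReal (Real.exp ((I + η) * m)) * (ENNReal.ofReal γ * Q (B \ B')) := by ring
      _ ≤ ENNReal.ofReal (Real.exp ((I + η) * m)) * (2 * m * Q B) := by gcongr
      _ = ENNReal.ofReal (Real.exp ((I + η) * m) * (2 * m)) * P B := by
          rw [hPB, ENNReal.ofReal_mul (Real.exp_pos _).le, ENNReal.ofReal_mul (by norm_num)]
          simp [mul_assoc]
      _ = _ := by
          rw [← mul_assoc (ENNReal.ofReal γ), ← ENNReal.ofReal_mul hγ.le]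
          congr 2
          field_simp
  -- The means of the `m` increments add up to at most `m * I` for every choice of actions, so off
  -- `D` the centred sum exceeds `η * m`.
  have b2 : P ((B \ B') \ D) ≤ ENNReal.ofReal (V / (η ^ 2 * m)) * P B := by
    refine le_trans (measure_mono fun ω hω => ?_)
      (lawChange_centred_sum_ge_le hV π (s + 1) s le_rfl hm hη hB)
    refine ⟨hω.1.1, ?_⟩
    have h1 : (I + η) * m < S ω := not_le.1 hω.2
    have h2 : ∑ i ∈ Finset.range m, (actionInfo pre post (RunPath.A (s + i + 1) ω)).toReal ≤
        m * I := by
      refine (Finset.sum_le_sum fun i _ => hI (RunPath.A (s + i + 1) ω)).trans ?_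
      simp
    change η * m ≤ |_|
    refine le_trans ?_ (le_abs_self _)
    simp only [centredLLR, Finset.sum_sub_distrib]
    change (I + η) * m < ∑ i ∈ Finset.range m, _ at h1
    linarith
  have b3 : P (B \ B') ≤
      ENNReal.ofReal (Real.exp ((I + η) * m) * (2 * m / γ) + V / (η ^ 2 * m)) * P B := by
    rw [ENNReal.ofReal_add (by positivity) (by positivity), add_mul]
    rw [← measure_inter_add_sdiff (μ := P) (B \ B') (history_le _ _ hDm)]
    exact add_le_add b1' b2
  set δ := ENNReal.ofReal (Real.exp ((I + η) * m) * (2 * m / γ) + V / (η ^ 2 * m))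
  have b4 : (1 - δ) * P B ≤ P B' := by
    rw [ENNReal.sub_mul fun _ _ => measure_ne_top _ _, one_mul, tsub_le_iff_left]
    calc P B = P (B \ B') + P B' := measure_lt_time_eq_add hT P s m
      _ ≤ δ * P B + P B' := by gcongr
  -- On `B'` the delay exceeds `m`.
  have b5 : m * P B' ≤ lordenDelay pre post (π, T) * P B := by
    refine le_trans ?_ (setLIntegral_le_lordenDelay_mul (pre := pre) (post := post) (π, T) s hB)
    have hsub : B' ⊆ B := fun ω hω => show (s : ℕ∞) < T ω from
    lt_of_le_of_lt (Nat.cast_le.2 (Nat.le_add_right s m)) hω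
    rw [← setLIntegral_const]
    refine le_trans ?_ (lintegral_mono_set hsub)
    refine setLIntegral_mono' (history_le _ _ hB') fun ω hω => ?_
    refine ENNReal.le_sub_of_add_le_left (ENNReal.natCast_ne_top s) ?_
    have : ((s + m : ℕ) : ℕ∞) ≤ T ω := le_of_lt hω
    have := ENat.toENNReal_mono this
    simpa using this
  have hPB0 : P B ≠ 0 := by rw [hPB]; exact hs0
  rw [← ENNReal.mul_le_mul_iff_left hPB0 (measure_ne_top _ _), mul_assoc]
  exact (mul_le_mul_right b4 _).trans b5

end LordenDelay

end

noncomputable section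

/-! ### Counting exploration times -/

open Classical in
/-- The number of elements of `N` in `(a, b]`. -/
def exploreCount (N : Set ℕ) (a b : ℕ) : ℕ := ((Finset.Ioc a b).filter (· ∈ N)).card

lemma sum_indicator_eq_exploreCount (N : Set ℕ) (a b : ℕ) :
    ∑ i ∈ Finset.Icc (a + 1) b, N.indicator (fun _ => (1 : ℝ)) i = exploreCount N a b := by
  classical
  rw [exploreCount, ← Finset.sum_boole, Finset.Icc_add_one_left_eq_Ioc]
  refine Finset.sum_congr rfl fun i _ => ?_
  by_cases h : i ∈ N <;> simp [h]

lemma exploreCount_add (N : Set ℕ) {a b c : ℕ} (hab : a ≤ b) (hbc : b ≤ c) :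
    exploreCount N a c = exploreCount N a b + exploreCount N b c := by
  classical
  rw [exploreCount, exploreCount, exploreCount, ← Finset.card_union_of_disjoint,
    ← Finset.filter_union, Finset.Ioc_union_Ioc_eq_Ioc hab hbc]
  exact Finset.disjoint_filter_filter (Finset.Ioc_disjoint_Ioc_of_le le_rfl)

lemma exploreCount_le (N : Set ℕ) (a b : ℕ) : exploreCount N a b ≤ b - a := by
  classical
  exact (Finset.card_filter_le _ _).trans (by simp)

lemma exploreCount_mono {N M : Set ℕ} (h : N ⊆ M) (a b : ℕ) :
    exploreCount N a b ≤ exploreCount M a b := by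
  classical
  exact Finset.card_le_card (Finset.monotone_filter_right _ fun _ _ hi => h hi)

lemma exploreCount_of_subset {N : Set ℕ} {a b : ℕ} (h : ∀ i, a < i → i ≤ b → i ∈ N) :
    exploreCount N a b = b - a := by
  classical
  rw [exploreCount, Finset.filter_true_of_mem, Nat.card_Ioc]
  exact fun i hi => h i (Finset.mem_Ioc.1 hi).1 (Finset.mem_Ioc.1 hi).2

lemma exploreCount_succ_of_mem {N : Set ℕ} {a b : ℕ} (hab : a ≤ b) (h : b + 1 ∈ N) :
    exploreCount N a (b + 1) = exploreCount N a b + 1 := by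
  rw [exploreCount_add N hab b.le_succ, exploreCount_of_subset (a := b)]
  · simp
  · intro i h1 h2
    obtain rfl : i = b + 1 := by omega
    exact h

lemma exploreCount_succ_of_notMem {N : Set ℕ} {a b : ℕ} (hab : a ≤ b) (h : b + 1 ∉ N) :
    exploreCount N a (b + 1) = exploreCount N a b := by
  classical
  rw [exploreCount_add N hab b.le_succ]
  simp [exploreCount, h, Finset.filter_singleton]

section ExplorationSet

variable {q w : ℕ} {N : Set ℕ}

lemma IsExplorationSet.le_exploreCount (h : IsExplorationSet q w N) {m : ℕ} (hm : w ≤ m) :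
    q ≤ exploreCount N m (m + w) := by
  have := h.le_window m hm
  rw [sum_indicator_eq_exploreCount] at this
  exact_mod_cast this

lemma IsExplorationSet.exploreCount_prefix_le (h : IsExplorationSet q w N) (n : ℕ) :
    (exploreCount N w (w + n) : ℝ) ≤ n / w * q := by
  rcases n with _ | n
  · simp [exploreCount]
  · have := h.sampling_le (n + 1) (by omega)
    rwa [sum_indicator_eq_exploreCount] at this

lemma IsExplorationSet.mul_le_exploreCount (h : IsExplorationSet q w N) (k : ℕ) :
    k * q ≤ exploreCount N w (w + k * w) := by
  induction k with
  | zero => simp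
  | succ k ih =>
    rw [exploreCount_add N (b := w + k * w) (by omega) (by nlinarith)]
    have := h.le_exploreCount (m := w + k * w) (by omega)
    rw [show w + (k + 1) * w = w + k * w + w by ring]
    linarith

/-- Only prefixes have an upper bound by hypothesis. A general window is a difference of prefixes,
and the subtracted one is bounded below through its complete windows of length `w`; rounding to
complete windows costs the extra `q`. -/
lemma IsExplorationSet.exploreCount_le (h : IsExplorationSet q w N) {m : ℕ} (hm : w ≤ m) (n : ℕ) :
    (exploreCount N m (m + n) : ℝ) ≤ (n / w + 1) * q := by
  obtain ⟨j, rfl⟩ := Nat.exists_eq_add_of_le hm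
  have hw : (0 : ℝ) < w := by exact_mod_cast h.q_pos.trans h.q_lt
  have h1 := h.exploreCount_prefix_le (j + n)
  have h2 := h.mul_le_exploreCount (j / w)
  have h3 : exploreCount N w (w + j / w * w) ≤ exploreCount N w (w + j) := by
    rw [exploreCount_add N (b := w + j / w * w) (c := w + j) (by omega)
      (by have := Nat.div_mul_le_self j w; omega)]
    omega
  rw [← add_assoc, exploreCount_add N (b := w + j) (by omega) (by omega)] at h1
  have h4 : (j : ℝ) / w - 1 ≤ ((j / w : ℕ) : ℝ) := by
    have := Nat.lt_div_mul_add (a := j) (b := w) (by exact_mod_cast hw)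
    rw [sub_le_iff_le_add, div_le_iff₀ hw]
    have : (j : ℝ) < (j / w : ℕ) * w + w := by exact_mod_cast this
    linarith
  have h5 : (((j / w : ℕ) : ℝ)) * q ≤ exploreCount N w (w + j) := by exact_mod_cast h2.trans h3
  have h6 := mul_le_mul_of_nonneg_right h4 (Nat.cast_nonneg (α := ℝ) q)
  push_cast at h1
  rw [add_div, add_mul] at h1
  linarith

/-- Every window of `w` consecutive times contains at least `q` times at which the procedure
explores, and so at least `q - 1` apart from its first time. -/
lemma IsExplorationSet.le_exploreCount_window (h : IsExplorationSet q w N) (s : ℕ) :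
    q - 1 ≤ exploreCount ({m | m ≤ w} ∪ N) (s + 1) (s + w) := by
  have hw := h.q_pos.trans h.q_lt
  have h1 : q ≤ exploreCount ({m | m ≤ w} ∪ N) s (s + w) := by
    rcases le_total w s with hs | hs
    · exact (h.le_exploreCount hs).trans (exploreCount_mono Set.subset_union_right _ _)
    -- For `s ≤ w` the window loses at most `w - s` elements of `N` compared with the one starting
    -- at `w`, and gains the `w - s` times up to `w`, which are all exploratory.
    · have h2 := h.le_exploreCount le_rfl
      rw [exploreCount_add N (b := s + w) (by omega) (by omega)] at h2
      have h3 := _root_.exploreCount_le N (s + w) (w + w)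
      have h4 := exploreCount_mono (N := N) (M := {m | m ≤ w} ∪ N) Set.subset_union_right w (s + w)
      rw [exploreCount_add _ hs (by omega), exploreCount_of_subset (N := {m | m ≤ w} ∪ N)
        (a := s) (b := w) fun i _ hi => Or.inl hi]
      omega
  rw [exploreCount_add _ (b := s + 1) (by omega) (by omega)] at h1
  have := _root_.exploreCount_le ({m | m ≤ w} ∪ N) s (s + 1)
  omega

end ExplorationSet

section Estimation

variable {𝔸 E Θ : Type*} [Fintype 𝔸] [Nonempty 𝔸] [MeasurableSpace 𝔸]
  [MeasurableSingletonClass 𝔸] [Finite Θ] [MeasurableSpace E] {lam : Measure E}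
  {pre : 𝔸 → Density lam} {post : Θ → 𝔸 → Density lam} {q w : ℕ} {N : Set ℕ} {π : Policy 𝔸 E}
  {est : ℕ → RunPath 𝔸 E → Θ}

/-! ### Consistency of the windowed maximum likelihood estimator -/

lemma windowLogLik_eq_log_prod (post : Θ → 𝔸 → Density lam) (w s : ℕ) (ϑ : Θ)
    (ω : RunPath 𝔸 E) :
    windowLogLik post w (s + w + 1) ϑ ω = ENNReal.log ((∏ i ∈ Finset.range w,
      (post ϑ (RunPath.A (s + i + 1) ω)).toFun (RunPath.X (s + i + 1) ω) : ℝ≥0) : ℝ≥0∞) := by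
  have h1 : ∀ (J : Finset ℕ) (f : ℕ → ℝ≥0∞), ∑ i ∈ J, ENNReal.log (f i) =
      ENNReal.log (∏ i ∈ J, f i) := by
    intro J f
    induction J using Finset.cons_induction with
    | empty => simp
    | cons a J ha ih => rw [Finset.sum_cons, Finset.prod_cons, ENNReal.log_mul_add, ih]
  rw [windowLogLik, Finset.sum_Ico_eq_sum_range, h1, ENNReal.ofNNReal_finsetProd]
  have h2 : s + w + 1 - (s + w + 1 - w) = w := by omega
  have h3 : ∀ i, s + w + 1 - w + i = s + i + 1 := fun i => by omega
  rw [h2]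
  simp only [h3]

/-- If `θ'` is at least as likely as `θ`, the likelihood ratio is at least one, hence so is its
root. The root is used because its mean is the Bhattacharyya coefficient, whereas that of the ratio
itself may be one. -/
lemma one_le_prod_sqrtLR_of_windowLogLik_le {s : ℕ} {θ θ' : Θ} {ω : RunPath 𝔸 E}
    (h : windowLogLik post w (s + w + 1) θ ω ≤ windowLogLik post w (s + w + 1) θ' ω)
    (hpos : ∀ i < w, (post θ (RunPath.A (s + i + 1) ω)).toFun (RunPath.X (s + i + 1) ω) ≠ 0) :
    (1 : ℝ≥0∞) ≤ ∏ i ∈ Finset.range w, (sqrtLR (post θ (RunPath.A (s + i + 1) ω))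
      (post θ' (RunPath.A (s + i + 1) ω)) (RunPath.X (s + i + 1) ω) : ℝ≥0∞) := by
  rw [windowLogLik_eq_log_prod, windowLogLik_eq_log_prod, ENNReal.log_le_log_iff,
    ENNReal.coe_le_coe] at h
  have hsqrt : ∀ (J : Finset ℕ) (f : ℕ → ℝ≥0),
      ∏ i ∈ J, NNReal.sqrt (f i) = NNReal.sqrt (∏ i ∈ J, f i) := by
    intro J f
    induction J using Finset.cons_induction with
    | empty => simp
    | cons a J ha ih => rw [Finset.prod_cons, Finset.prod_cons, NNReal.sqrt_mul, ih]
  simp only [sqrtLR]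
  rw [← ENNReal.ofNNReal_finsetProd, hsqrt, ← ENNReal.coe_one, ENNReal.coe_le_coe,
    ← NNReal.sqrt_one, NNReal.sqrt_le_sqrt, Finset.prod_div_distrib, one_le_div₀]
  · exact h
  · exact Finset.prod_pos fun i hi => pos_iff_ne_zero.2 (hpos i (Finset.mem_range.1 hi))

lemma measurable_bhattacharyya_action (f h : 𝔸 → Density lam) {m n : ℕ} (h1 : 1 ≤ m)
    (hmn : m ≤ n) : Measurable[history 𝔸 E n] fun ω : RunPath 𝔸 E =>
      bhattacharyya (f (RunPath.A m ω)) (h (RunPath.A m ω)) :=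
  (measurable_of_countable fun a => bhattacharyya (f a) (h a)).comp
    (measurable_action_history h1 hmn)

lemma measurable_prod_sqrtLR (f h : 𝔸 → Density lam) (s k : ℕ) {n : ℕ} (hn : s + k ≤ n) :
    Measurable[history 𝔸 E n] fun ω : RunPath 𝔸 E => ∏ i ∈ Finset.range k,
      (sqrtLR (f (RunPath.A (s + i + 1) ω)) (h (RunPath.A (s + i + 1) ω))
        (RunPath.X (s + i + 1) ω) : ℝ≥0∞) :=
  Finset.measurable_fun_prod _ fun i hi => measurable_comp_action_obs
    (φ := fun a x => (sqrtLR (f a) (h a) x : ℝ≥0∞))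
    (fun a => (measurable_sqrtLR _ _).coe_nnreal_ennreal) (by omega)
    (by have := Finset.mem_range.1 hi; omega)

/-- The product of the root likelihood ratios over a window, weighted by the Bhattacharyya
coefficient of the next action, contracts at every exploration time. -/
lemma setLIntegral_prod_sqrtLR_le (hW : IsWindowedChernoff pre post q w N π est) {θ θ' : Θ}
    {ρ : ℝ≥0∞} (hρ : ∫⁻ a, bhattacharyya (post θ a) (post θ' a) ∂(uniformAction 𝔸) ≤ ρ)
    {ν s : ℕ} (hν : ν ≤ s + 1) {B : Set (RunPath 𝔸 E)} (hB : MeasurableSet[history 𝔸 E s] B)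
    (k : ℕ) :
    ∫⁻ ω in B, ∏ i ∈ Finset.range (k + 1), (sqrtLR (post θ (RunPath.A (s + i + 1) ω))
      (post θ' (RunPath.A (s + i + 1) ω)) (RunPath.X (s + i + 1) ω) : ℝ≥0∞)
        ∂(lawChange pre (post θ) ν π) ≤
    ρ ^ exploreCount ({m | m ≤ w} ∪ N) (s + 1) (s + k + 1) * lawChange pre (post θ) ν π B := by
  set P := lawChange pre (post θ) ν π with hP
  set R : 𝔸 → ℝ≥0∞ := fun a => bhattacharyya (post θ a) (post θ' a) with hR
  set r : 𝔸 → E → ℝ≥0∞ := fun a x => sqrtLR (post θ a) (post θ' a) x with hr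
  have hrm : ∀ a, Measurable (r a) := fun a => (measurable_sqrtLR _ _).coe_nnreal_ennreal
  set M : ℕ → RunPath 𝔸 E → ℝ≥0∞ := fun k ω => ∏ i ∈ Finset.range k,
    r (RunPath.A (s + i + 1) ω) (RunPath.X (s + i + 1) ω) with hM
  have hMm : ∀ k n, s + k ≤ n → Measurable[history 𝔸 E n] (M k) :=
    fun k n hn => measurable_prod_sqrtLR (post θ) (post θ') s k hn
  have hB0 := history_le _ _ hB
  have hind : ∀ (F : RunPath 𝔸 E → ℝ≥0∞) n, s ≤ n → Measurable[history 𝔸 E n] F →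
      Measurable[history 𝔸 E n] (B.indicator F) := fun F n hn hF =>
    hF.indicator ((history 𝔸 E).mono hn _ hB)
  have hBu : ∀ k ω y, Function.update ω (s + k) y ∈ B ↔ ω ∈ B := fun k ω y =>
    hB.mem_iff_of_agree fun i hi => Function.update_of_ne (by omega) _ _
  have hRm : ∀ m n, 1 ≤ m → m ≤ n → Measurable[history 𝔸 E n]
      fun ω : RunPath 𝔸 E => R (RunPath.A m ω) := fun m n =>
    measurable_bhattacharyya_action (post θ) (post θ')
  have hlaw : ∀ k, (if s + k + 1 < ν then pre else post θ) = post θ :=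
    fun k => if_neg (by omega)
  -- The weight by the coefficient of the next action records what the next observation will
  -- contribute, so that the average over an exploring action can be taken one step earlier.
  set G : ℕ → ℝ≥0∞ := fun k => ∫⁻ ω in B, M k ω * R (RunPath.A (s + k + 1) ω) ∂P with hG
  have stepA : ∀ k, ∫⁻ ω in B, M (k + 1) ω ∂P ≤ G k := by
    intro k
    simp only [hG]
    rw [← lintegral_indicator hB0, ← lintegral_indicator hB0]
    refine lintegral_pathLaw_le_of_step _ π (s + k) (hind _ _ (by omega) (hMm _ _ (by omega)))
      (hind _ _ (by omega) ((hMm k _ (by omega)).mul (hRm _ _ (by omega) le_rfl))) fun ω a => ?_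
    by_cases hω : ω ∈ B
    · have hMu := fun y => (hMm k _ le_rfl).update_of_le le_rfl ω y
      simp only [Set.indicator, hBu, hω, if_true, RunPath.A_update, hMu, lintegral_const,
        measure_univ, mul_one]
      simp only [hM, Finset.prod_range_succ, RunPath.A_update, RunPath.X_update]
      simp only [hM] at hMu
      simp only [hMu, lintegral_const, measure_univ, mul_one]
      rw [lintegral_const_mul _ (hrm a), hlaw]
      rfl
    · simp [Set.indicator, hBu, hω]
  -- The action at time `s + k + 2` is a function of the randomization drawn at `s + k + 1`, which
  -- is independent of the observation made then. Integrating it out yields the factor `ρ`.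
  have stepB : ∀ k, s + k + 2 ∈ ({m | m ≤ w} ∪ N : Set ℕ) → G (k + 1) ≤ ρ * G k := by
    intro k hk
    obtain ⟨φ, hφm, hφ, hact⟩ := hW.explore (s + k + 2) (by omega) hk
    have hRφ : Measurable fun u => R (φ u) := (measurable_of_countable R).comp hφm
    have hint : ∫⁻ u, R (φ u) ∂volume ≤ ρ := by
      rw [← lintegral_map (f := R) (measurable_of_countable R) hφm, hφ]
      exact hρ
    have e1 : G (k + 1) = ∫⁻ ω in B, M (k + 1) ω * R (φ (RunPath.U (s + k + 1) ω)) ∂P := by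
      refine lintegral_congr_ae (ae_restrict_of_ae ?_)
      filter_upwards [ae_action_eq (fun n => if n < ν then pre else post θ) π
        (n := s + k + 2) (by omega)] with ω hω
      rw [show s + (k + 1) + 1 = s + k + 2 by ring, hω, hact ω]
      rfl
    rw [e1]
    simp only [hG]
    have hGm : Measurable[history 𝔸 E (s + k + 1)]
        (B.indicator fun ω => M k ω * R (RunPath.A (s + k + 1) ω)) :=
      hind _ _ (by omega) ((hMm k _ (by omega)).mul (hRm _ _ (by omega) le_rfl))
    rw [← lintegral_indicator hB0, ← lintegral_indicator hB0,
      ← lintegral_const_mul _ (hGm.mono (history_le _) le_rfl)]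
    have hUm : Measurable[history 𝔸 E (s + k + 1)] fun ω : RunPath 𝔸 E =>
        R (φ (RunPath.U (s + k + 1) ω)) := hRφ.comp (measurable_rand_history (by omega) le_rfl)
    refine lintegral_pathLaw_le_of_step _ π (s + k)
      (hind _ _ (by omega) ((hMm (k + 1) _ (by omega)).mul hUm))
      (hGm.const_mul ρ)
      fun ω a => ?_
    by_cases hω : ω ∈ B
    · have hMu := fun y => (hMm k _ le_rfl).update_of_le le_rfl ω y
      simp only [Set.indicator, hBu, hω, if_true, RunPath.A_update, hMu, lintegral_const,
        measure_univ, mul_one]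
      simp only [hM, Finset.prod_range_succ, RunPath.A_update, RunPath.X_update, RunPath.U_update]
      simp only [hM] at hMu
      simp only [hMu]
      simp only [lintegral_const_mul _ hRφ]
      rw [lintegral_mul_const _ ((hrm a).const_mul _), lintegral_const_mul _ (hrm a), hlaw,
        mul_comm ρ]
      exact mul_le_mul_right hint _
    · simp [Set.indicator, hBu, hω]
  have hle : ∀ k, G k ≤ ∫⁻ ω in B, M k ω ∂P := fun k =>
    lintegral_mono fun ω => mul_le_of_le_one_right' (bhattacharyya_le_one _ _)
  -- The action at time `s + 1` may already be fixed by `F_s`, so it yields no contraction and the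
  -- count starts after `s + 1`. This is the source of the exponent `q - 1`.
  have stepC : ∀ k, G k ≤ ρ ^ exploreCount ({m | m ≤ w} ∪ N) (s + 1) (s + k + 1) * P B := by
    intro k
    induction k with
    | zero => exact (hle 0).trans (by simp [hM, exploreCount])
    | succ k ih =>
      by_cases hk : s + k + 1 + 1 ∈ ({m | m ≤ w} ∪ N : Set ℕ)
      · rw [show s + (k + 1) + 1 = s + k + 1 + 1 by ring,
          exploreCount_succ_of_mem (by omega) hk, pow_succ', mul_assoc]
        exact (stepB k hk).trans (mul_le_mul_right ih _)
      · rw [show s + (k + 1) + 1 = s + k + 1 + 1 by ring,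
          exploreCount_succ_of_notMem (by omega) hk]
        exact (hle (k + 1)).trans ((stepA k).trans ih)
  exact (stepA k).trans (stepC k)

/-- Given the past before the window, the estimator errs with a probability that is geometrically
small in the number of exploration times. -/
theorem lawChange_estimator_ne_le (hW : IsWindowedChernoff pre post q w N π est) {θ θ' : Θ}
    {ρ : ℝ≥0∞} (hρ1 : ρ ≤ 1)
    (hρ : ∫⁻ a, bhattacharyya (post θ a) (post θ' a) ∂(uniformAction 𝔸) ≤ ρ)
    {ν s n : ℕ} (hν : ν ≤ s + 1) (hn : s + w + 1 ≤ n)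
    {B : Set (RunPath 𝔸 E)} (hB : MeasurableSet[history 𝔸 E s] B) :
    lawChange pre (post θ) ν π (B ∩ {ω | est n ω = θ'}) ≤
      ρ ^ (q - 1) * lawChange pre (post θ) ν π B := by
  have hES := hW.exploration_set
  have hw := hES.q_pos.trans hES.q_lt
  -- The estimation window is {s' + 1, …, s' + w}. It lies after the conditioning time `s`, since `s
  -- ≤ s'`, and after the change.
  obtain ⟨s', rfl⟩ : ∃ s', n = s' + w + 1 := ⟨n - w - 1, by omega⟩
  have hB' : MeasurableSet[history 𝔸 E s'] B := (history 𝔸 E).mono (by omega) _ hB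
  have hB0 := history_le _ _ hB
  obtain ⟨w', rfl⟩ : ∃ w', w = w' + 1 := ⟨w - 1, by omega⟩
  have hpos : ∀ᵐ ω ∂(lawChange pre (post θ) ν π), ∀ i : ℕ,
      (post θ (RunPath.A (s' + i + 1) ω)).toFun (RunPath.X (s' + i + 1) ω) ≠ 0 := by
    rw [ae_all_iff]
    intro i
    refine ae_pathLaw_of_forall_ae (fun n => if n < ν then pre else post θ) π (s' + i)
      (P := fun a x => (post θ a).toFun x ≠ 0) fun a => ?_
    rw [if_neg (by omega)]
    exact (post θ a).ae_ne_zero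
  have hem : MeasurableSet {ω | est (s' + (w' + 1) + 1) ω = θ'} :=
    history_le _ _ (hW.measurable_est _ (by omega) θ')
  calc lawChange pre (post θ) ν π (B ∩ {ω | est (s' + (w' + 1) + 1) ω = θ'})
      = ∫⁻ ω in B, {ω | est (s' + (w' + 1) + 1) ω = θ'}.indicator (fun _ => 1) ω
          ∂(lawChange pre (post θ) ν π) := by
        rw [lintegral_indicator_const hem, one_mul, Measure.restrict_apply hem, Set.inter_comm]
    _ ≤ ∫⁻ ω in B, ∏ i ∈ Finset.range (w' + 1), (sqrtLR (post θ (RunPath.A (s' + i + 1) ω))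
          (post θ' (RunPath.A (s' + i + 1) ω)) (RunPath.X (s' + i + 1) ω) : ℝ≥0∞)
          ∂(lawChange pre (post θ) ν π) := by
        refine lintegral_mono_ae (ae_restrict_of_ae ?_)
        filter_upwards [hpos] with ω hω
        by_cases h : est (s' + (w' + 1) + 1) ω = θ'
        · have hmle := hW.mle (s' + (w' + 1) + 1) (by omega) ω θ
          rw [h] at hmle
          rw [Set.indicator_of_mem (show ω ∈ {ω | est (s' + (w' + 1) + 1) ω = θ'} from h)]
          exact one_le_prod_sqrtLR_of_windowLogLik_le hmle fun i _ => hω i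
        · rw [Set.indicator_of_notMem (show ω ∉ {ω | est (s' + (w' + 1) + 1) ω = θ'} from h)]
          exact zero_le
    _ ≤ _ := setLIntegral_prod_sqrtLR_le hW hρ (by omega) hB' w'
    _ ≤ _ := by
        gcongr ?_ * _
        exact pow_le_pow_right_of_le_one' hρ1 (hES.le_exploreCount_window s')

end Estimation

end

noncomputable section

section Delay

variable {𝔸 E Θ : Type*} [Fintype 𝔸] [Nonempty 𝔸] [MeasurableSpace 𝔸]
  [MeasurableSingletonClass 𝔸] [Finite Θ] [MeasurableSpace E] {lam : Measure E}
  {pre : 𝔸 → Density lam} {post : Θ → 𝔸 → Density lam} {q w : ℕ} {N : Set ℕ} {π : Policy 𝔸 E}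
  {est : ℕ → RunPath 𝔸 E → Θ}

/-! ### The detection delay of the Windowed Chernoff-CuSum procedure -/

lemma sum_range_indicator_eq_exploreCount (N : Set ℕ) (s k : ℕ) :
    ∑ i ∈ Finset.range k, N.indicator (fun _ => (1 : ℝ)) (s + i + 1) =
      exploreCount N s (s + k) := by
  induction k with
  | zero => simp [exploreCount]
  | succ k ih =>
    rw [Finset.sum_range_succ, ih, ← add_assoc]
    by_cases h : s + k + 1 ∈ N
    · rw [exploreCount_succ_of_mem (by omega) h, Set.indicator_of_mem h]
      push_cast; rfl
    · rw [exploreCount_succ_of_notMem (by omega) h, Set.indicator_of_notMem h, add_zero]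

/-- Discarding the maxima with `0` only lowers the statistic, so CuSum dominates the sum of
increments started at any time `s ≥ w`, whatever its value at `s`. -/
lemma sum_le_cusum {s : ℕ} (hs : w ≤ s) {ω : RunPath 𝔸 E} {z : ℕ → ℝ} {k : ℕ} (hk : 0 < k)
    (h : ∀ i < k, (z i : EReal) ≤ logRatio (post (est (s + i + 1) ω) (RunPath.A (s + i + 1) ω))
      (pre (RunPath.A (s + i + 1) ω)) (RunPath.X (s + i + 1) ω)) :
    ((∑ i ∈ Finset.range k, z i : ℝ) : EReal) ≤ cusum pre post w est ω (s + k) := by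
  have key : ∀ j, j < k → ((∑ i ∈ Finset.range (j + 1), z i : ℝ) : EReal) ≤
      cusum pre post w est ω (s + j + 1) := by
    intro j
    induction j with
    | zero =>
      intro hj
      simp only [cusum, if_neg (show ¬ s + 0 + 1 ≤ w by omega), Finset.sum_range_one, zero_add]
      calc ((z 0 : ℝ) : EReal) = 0 + z 0 := (zero_add _).symm
        _ ≤ _ := add_le_add (le_max_right _ _) (h 0 hj)
    | succ j ih =>
      intro hj
      rw [Finset.sum_range_succ, EReal.coe_add]
      have hw : ¬ s + (j + 1) + 1 ≤ w := by omega
      simp only [cusum, if_neg hw]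
      exact add_le_add ((ih (by omega)).trans (le_max_left _ _)) (h (j + 1) hj)
  obtain ⟨j, rfl⟩ : ∃ j, k = j + 1 := ⟨k - 1, by omega⟩
  exact key j (by omega)

open Classical in
/-- The loss in the drift caused by estimating `ϑ` when the true parameter is `θ`. -/
def penalty (post : Θ → 𝔸 → Density lam) (I : ℝ) (θ ϑ : Θ) (a : 𝔸) (x : E) : ℝ :=
  if ϑ = θ then 0 else max (logLR (post θ a) (post ϑ a) x) 0 + I

lemma measurable_penalty (I : ℝ) (θ ϑ : Θ) (a : 𝔸) :
    Measurable (penalty post I θ ϑ a) := by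
  unfold penalty
  split_ifs
  · exact measurable_const
  · exact ((measurable_logLR _ _).max measurable_const).add_const _

lemma penalty_nonneg {I : ℝ} (hI : 0 ≤ I) (θ ϑ : Θ) (a : 𝔸) (x : E) :
    0 ≤ penalty post I θ ϑ a x := by
  unfold penalty
  split_ifs
  · exact le_rfl
  · have := le_max_right (logLR (post θ a) (post ϑ a) x) 0
    linarith

lemma logLR_self (f : Density lam) (x : E) : logLR f f x = 0 := by
  unfold logLR
  rcases eq_or_ne (f.toFun x) 0 with h | h <;> simp [h]

open Classical in
lemma lintegral_penalty_le {C : ℝ≥0} {I : ℝ} {θ : Θ}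
    (hC : ∀ ϑ a, ∫⁻ x, ENNReal.ofReal (logLR (post θ a) (post ϑ a) x) ∂(post θ a).toMeasure ≤ C)
    (ϑ : Θ) (a : 𝔸) :
    ∫⁻ x, ENNReal.ofReal (penalty post I θ ϑ a x) ∂(post θ a).toMeasure ≤
      if ϑ = θ then 0 else C + ENNReal.ofReal I := by
  unfold penalty
  split_ifs with h
  · simp
  · calc _ ≤ ∫⁻ x, (ENNReal.ofReal (logLR (post θ a) (post ϑ a) x) + ENNReal.ofReal I)
          ∂(post θ a).toMeasure := by
          refine lintegral_mono fun x => ENNReal.ofReal_add_le.trans ?_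
          rw [ENNReal.ofReal_max]
          simp
      _ ≤ _ := by
          rw [lintegral_add_right _ measurable_const]
          simpa using hC ϑ a

/-- Markov's inequality. A penalty is nonzero only if the estimate is wrong, and then its
conditional mean is at most `C + I`. Starting at `s + w + 1` ensures that every estimation window
lies after `s`, where `lawChange_estimator_ne_le` applies uniformly in the past. -/
theorem lawChange_sum_penalty_ge_le (hW : IsWindowedChernoff pre post q w N π est) {θ : Θ}
    {C ρ : ℝ≥0} {I : ℝ} (hI : 0 ≤ I)
    (hC : ∀ ϑ a, ∫⁻ x, ENNReal.ofReal (logLR (post θ a) (post ϑ a) x) ∂(post θ a).toMeasure ≤ C)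
    (hρ1 : ρ ≤ 1) (hρ : ∀ ϑ, ϑ ≠ θ →
      ∫⁻ a, bhattacharyya (post θ a) (post ϑ a) ∂(uniformAction 𝔸) ≤ ρ)
    {ν s : ℕ} (hν : ν ≤ s + 1) {k : ℕ} (hk : 0 < k) {η : ℝ} (hη : 0 < η)
    {B : Set (RunPath 𝔸 E)} (hB : MeasurableSet[history 𝔸 E s] B) :
    lawChange pre (post θ) ν π (B ∩ {ω | η * k ≤ ∑ i ∈ Finset.range k,
      penalty post I θ (est (s + w + i + 1) ω) (RunPath.A (s + w + i + 1) ω)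
        (RunPath.X (s + w + i + 1) ω)}) ≤
      ENNReal.ofReal (Nat.card Θ * (C + I) * ρ ^ (q - 1) / η) * lawChange pre (post θ) ν π B := by
  classical
  set P := lawChange pre (post θ) ν π with hP
  have hB0 := history_le _ _ hB
  have hfin := Fintype.ofFinite Θ
  set d : ℕ → RunPath 𝔸 E → ℝ≥0∞ := fun i ω => ENNReal.ofReal (penalty post I θ
    (est (s + w + i + 1) ω) (RunPath.A (s + w + i + 1) ω) (RunPath.X (s + w + i + 1) ω)) with hd
  have hest : ∀ i ϑ, MeasurableSet[history 𝔸 E (s + w + i)] {ω | est (s + w + i + 1) ω = ϑ} :=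
    fun i ϑ => hW.measurable_est (s + w + i + 1) (by omega) ϑ
  have hpm : ∀ ϑ a, Measurable fun x => ENNReal.ofReal (penalty post I θ ϑ a x) := fun ϑ a =>
    (measurable_penalty I θ ϑ a).ennreal_ofReal
  have hdm : ∀ i, Measurable (d i) := fun i => (measurable_comp_estimator
    (fun ϑ => (history 𝔸 E).mono (Nat.le_succ _) _ (hest i ϑ))
    (F := fun ϑ ω => ENNReal.ofReal (penalty post I θ ϑ (RunPath.A (s + w + i + 1) ω)
      (RunPath.X (s + w + i + 1) ω)))
    fun ϑ => measurable_comp_action_obs (hpm ϑ) (by omega) le_rfl).mono (history_le _) le_rfl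
  have h1 : ∀ i, ∫⁻ ω in B, d i ω ∂P ≤
      Nat.card Θ * ((C + ENNReal.ofReal I) * (ρ ^ (q - 1) * P B)) := by
    intro i
    have hBi : MeasurableSet[history 𝔸 E (s + w + i)] B := (history 𝔸 E).mono (by omega) _ hB
    have hind : Measurable[history 𝔸 E (s + w + i)] (B.indicator fun _ => (1 : ℝ≥0∞)) :=
      (@measurable_const _ _ _ (history 𝔸 E (s + w + i)) _).indicator hBi
    have key := lintegral_mul_estimator_step_le (fun n => if n < ν then pre else post θ) π
      (s + w + i) hind (hest i) hpm (c := fun ϑ => if ϑ = θ then 0 else C + ENNReal.ofReal I)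
      fun ϑ a => by
        rw [if_neg (by omega)]
        exact lintegral_penalty_le hC ϑ a
    calc _ = _ := by
          rw [← lintegral_indicator hB0]
          refine lintegral_congr fun ω => ?_
          exact (by by_cases hω : ω ∈ B <;> simp [hω, hd] :
            B.indicator (d i) ω = B.indicator (fun _ => (1 : ℝ≥0∞)) ω * d i ω)
      _ ≤ _ := key
      -- Splitting according to the estimated value bounds each wrong value separately; this gives
      -- the factor `Nat.card Θ`.
      _ ≤ ∫⁻ ω, ∑ ϑ : Θ, (if ϑ = θ then 0 else C + ENNReal.ofReal I) *
            (B ∩ {ω | est (s + w + i + 1) ω = ϑ}).indicator (fun _ => 1) ω ∂P := by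
          refine lintegral_mono fun ω => ?_
          refine le_trans (le_of_eq ?_) (Finset.single_le_sum (f := fun ϑ : Θ =>
            (if ϑ = θ then 0 else C + ENNReal.ofReal I) *
            (B ∩ {ω | est (s + w + i + 1) ω = ϑ}).indicator (fun _ => (1 : ℝ≥0∞)) ω)
            (fun _ _ => zero_le) (Finset.mem_univ (est (s + w + i + 1) ω)))
          by_cases hω : ω ∈ B <;> simp [hω, Set.indicator]
      _ = ∑ ϑ : Θ, (if ϑ = θ then 0 else C + ENNReal.ofReal I) *
            P (B ∩ {ω | est (s + w + i + 1) ω = ϑ}) := by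
          have hm : ∀ ϑ, MeasurableSet (B ∩ {ω | est (s + w + i + 1) ω = ϑ}) := fun ϑ =>
            hB0.inter (history_le _ _ (hest i ϑ))
          rw [lintegral_finsetSum _ fun ϑ _ => (measurable_const.indicator (hm ϑ)).const_mul _]
          refine Finset.sum_congr rfl fun ϑ _ => ?_
          rw [lintegral_const_mul _ (measurable_const.indicator (hm ϑ)),
            lintegral_indicator_const (hm ϑ), one_mul]
      _ ≤ ∑ ϑ : Θ, (C + ENNReal.ofReal I) * (ρ ^ (q - 1) * P B) := by
          refine Finset.sum_le_sum fun ϑ _ => ?_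
          split_ifs with h
          · simp
          · exact mul_le_mul_right (lawChange_estimator_ne_le hW (by exact_mod_cast hρ1) (hρ ϑ h) hν
              (by omega) hB) _
      _ = _ := by simp
  have h2 : ENNReal.ofReal (η * k) * P (B ∩ {ω | η * k ≤ ∑ i ∈ Finset.range k,
      penalty post I θ (est (s + w + i + 1) ω) (RunPath.A (s + w + i + 1) ω)
        (RunPath.X (s + w + i + 1) ω)}) ≤
      k * (Nat.card Θ * ((C + ENNReal.ofReal I) * (ρ ^ (q - 1) * P B))) := by
    have hset : {ω | η * k ≤ ∑ i ∈ Finset.range k,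
        penalty post I θ (est (s + w + i + 1) ω) (RunPath.A (s + w + i + 1) ω)
        (RunPath.X (s + w + i + 1) ω)} ⊆
        {ω | ENNReal.ofReal (η * k) ≤ ∑ i ∈ Finset.range k, d i ω} := fun ω hω => by
      change ENNReal.ofReal (η * k) ≤ ∑ i ∈ Finset.range k, d i ω
      simp only [hd]
      rw [← ENNReal.ofReal_sum_of_nonneg fun i _ => penalty_nonneg hI _ _ _ _]
      exact ENNReal.ofReal_le_ofReal hω
    have hsm : Measurable fun ω => ∑ i ∈ Finset.range k, d i ω :=
      Finset.measurable_fun_sum _ fun i _ => hdm i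
    have hmk := mul_meas_ge_le_lintegral (μ := P.restrict B) hsm (ENNReal.ofReal (η * k))
    rw [Measure.restrict_apply (measurableSet_le measurable_const hsm), Set.inter_comm] at hmk
    refine (mul_le_mul_right (measure_mono (Set.inter_subset_inter_right B hset)) _).trans
      (hmk.trans ?_)
    rw [lintegral_finsetSum _ fun i _ => hdm i]
    refine (Finset.sum_le_sum fun i _ => h1 i).trans ?_
    simp
  have hpos : (0 : ℝ) < η * k := by positivity
  rw [← ENNReal.mul_le_mul_iff_right (ENNReal.ofReal_pos.2 hpos).ne' ENNReal.ofReal_ne_top]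
  refine h2.trans (le_of_eq ?_)
  rw [← mul_assoc (ENNReal.ofReal (η * k)), ← ENNReal.ofReal_mul hpos.le]
  have e1 : η * k * (Nat.card Θ * (C + I) * ρ ^ (q - 1) / η) =
      k * (Nat.card Θ * ((C + I) * ρ ^ (q - 1))) := by field_simp
  rw [e1, ENNReal.ofReal_mul (by positivity), ENNReal.ofReal_mul (by positivity),
    ENNReal.ofReal_mul (by positivity), ENNReal.ofReal_add (by positivity) hI,
    ENNReal.ofReal_pow (by positivity)]
  simp only [ENNReal.ofReal_natCast, ENNReal.ofReal_coe_nnreal]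
  ring

/-- From any past, an alarm is raised within `w + k` steps after the change with probability close
to one. -/
theorem lawChange_lt_cusumTime_le (hW : IsWindowedChernoff pre post q w N π est) {θ : Θ}
    {V C ρ : ℝ≥0}
    (hV : ∀ a, ∫⁻ x, (logRatio (post θ a) (pre a) x).abs ^ 2 ∂(post θ a).toMeasure ≤ V)
    (hac : ∀ ϑ a, (post θ a).toMeasure ≪ (post ϑ a).toMeasure)
    (hC : ∀ ϑ a, ∫⁻ x, ENNReal.ofReal (logLR (post θ a) (post ϑ a) x) ∂(post θ a).toMeasure ≤ C)
    (hρ1 : ρ ≤ 1) (hρ : ∀ ϑ, ϑ ≠ θ →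
      ∫⁻ a, bhattacharyya (post θ a) (post ϑ a) ∂(uniformAction 𝔸) ≤ ρ)
    {I : ℝ} (hI : (maxInfo pre (post θ)).toReal = I)
    {ν s : ℕ} (hν : ν ≤ s + 1) {k : ℕ} (hk : 0 < k) {η b : ℝ} (hη : 0 < η)
    (hb : b ≤ (I - 2 * η) * k - I * ((k / w + 1) * q))
    {B : Set (RunPath 𝔸 E)} (hB : MeasurableSet[history 𝔸 E s] B) :
    lawChange pre (post θ) ν π
      (B ∩ {ω | ((s + (w + k) : ℕ) : ℕ∞) < cusumTime pre post w est b ω}) ≤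
      ENNReal.ofReal (V / (η ^ 2 * k) + Nat.card Θ * (C + I) * ρ ^ (q - 1) / η) *
        lawChange pre (post θ) ν π B := by
  have hI0 : 0 ≤ I := hI ▸ ENNReal.toReal_nonneg
  have hES := hW.exploration_set
  have hqw := hES.q_lt
  have hq := hES.q_pos
  set P := lawChange pre (post θ) ν π with hP
  set g : ℕ → 𝔸 → Density lam := fun n => if n < ν then pre else post θ with hg
  have hIa : ∀ a, (actionInfo pre (post θ) a).toReal = I ↔
      ∀ a', actionInfo pre (post θ) a' ≤ actionInfo pre (post θ) a := by
    intro a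
    have hfin : ∀ a, actionInfo pre (post θ) a ≠ ∞ := fun a =>
      (klDiv_lt_top_of_sq ((hV a).trans_lt ENNReal.coe_lt_top)).ne
    constructor
    · intro h a'
      have hm : maxInfo pre (post θ) ≠ ∞ := by
        rw [maxInfo, ← lt_top_iff_ne_top, iSup_lt_iff]
        exact ⟨_, ENNReal.sum_lt_top.2 fun a _ => (hfin a).lt_top, fun a =>
          Finset.single_le_sum (fun _ _ => zero_le) (Finset.mem_univ a)⟩
      rw [← hI, ENNReal.toReal_eq_toReal_iff' (hfin a) hm] at h
      rw [h]
      exact le_iSup (actionInfo pre (post θ)) a'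
    · intro h
      rw [← hI, maxInfo]
      congr 1
      exact le_antisymm (le_iSup (actionInfo pre (post θ)) a) (iSup_le h)
  have hgood : ∀ᵐ ω ∂P, ∀ i : ℕ,
      (∀ ϑ, (post ϑ (RunPath.A (s + w + i + 1) ω)).toFun (RunPath.X (s + w + i + 1) ω) ≠ 0) ∧
      RunPath.A (s + w + i + 1) ω = π.action (s + w + i + 1) ω := by
    rw [ae_all_iff]
    intro i
    refine Filter.Eventually.and ?_ (ae_action_eq g π (by omega))
    rw [ae_all_iff]
    intro ϑ
    refine ae_pathLaw_of_forall_ae g π (s + w + i) (P := fun a x => (post ϑ a).toFun x ≠ 0)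
      fun a => ?_
    rw [hg]
    simp only [if_neg (show ¬ s + w + i + 1 < ν by omega)]
    exact Density.ae_ne_zero_of_ac (hac ϑ a)
  set S₁ := {ω : RunPath 𝔸 E | η * k ≤ |∑ i ∈ Finset.range k, centredLLR pre (post θ)
    (RunPath.A (s + w + i + 1) ω) (RunPath.X (s + w + i + 1) ω)|} with hS₁
  set S₂ := {ω : RunPath 𝔸 E | η * k ≤ ∑ i ∈ Finset.range k, penalty post I θ
    (est (s + w + i + 1) ω) (RunPath.A (s + w + i + 1) ω) (RunPath.X (s + w + i + 1) ω)} with hS₂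
  -- Without an untypical fluctuation (`S₁`) or too large a total penalty (`S₂`), the `k` increments
  -- after the burn-in of `w` steps already add up to `b`.
  have hsub : ∀ᵐ ω ∂P, ω ∈ B ∩ {ω | ((s + (w + k) : ℕ) : ℕ∞) < cusumTime pre post w est b ω} →
      ω ∈ (B ∩ S₁) ∪ (B ∩ S₂) := by
    filter_upwards [hgood] with ω hω hmem
    by_contra hcon
    rw [← Set.inter_union_distrib_left] at hcon
    have hcon' : ω ∉ S₁ ∪ S₂ := fun h => hcon ⟨hmem.1, h⟩
    have h1 : |∑ i ∈ Finset.range k, centredLLR pre (post θ)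
        (RunPath.A (s + w + i + 1) ω) (RunPath.X (s + w + i + 1) ω)| < η * k :=
      not_le.1 fun h => hcon' (Or.inl h)
    have h2 : ∑ i ∈ Finset.range k, penalty post I θ (est (s + w + i + 1) ω)
        (RunPath.A (s + w + i + 1) ω) (RunPath.X (s + w + i + 1) ω) < η * k :=
      not_le.1 fun h => hcon' (Or.inr h)
    have h3 : ((s + (w + k) : ℕ) : ℕ∞) < cusumTime pre post w est b ω := hmem.2
    refine absurd h3 (not_lt.2 (cusumTime_le_iff.2 ⟨_, le_rfl, by omega, ?_⟩))
    set z : ℕ → ℝ := fun i => logLR (post θ (RunPath.A (s + w + i + 1) ω))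
        (pre (RunPath.A (s + w + i + 1) ω)) (RunPath.X (s + w + i + 1) ω) -
      max (logLR (post θ (RunPath.A (s + w + i + 1) ω))
        (post (est (s + w + i + 1) ω) (RunPath.A (s + w + i + 1) ω))
        (RunPath.X (s + w + i + 1) ω)) 0 with hz
    have hcus := sum_le_cusum (pre := pre) (post := post) (est := est) (w := w) (s := s + w)
      (by omega) (ω := ω) (z := z) hk fun i hi =>
        logLR_sub_le_logRatio ((hω i).1 θ) ((hω i).1 _)
    rw [add_assoc] at hcus
    refine le_trans (EReal.coe_le_coe_iff.2 ?_) hcus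
    -- A drift of `I` is guaranteed when the estimate is right and the time is not exploratory. At
    -- exploration times at most `I` of drift is lost, the divergence being nonnegative; under a
    -- wrong estimate the penalty covers both the loss of `I` and the loss in likelihood.
    have hzi : ∀ i, centredLLR pre (post θ) (RunPath.A (s + w + i + 1) ω)
        (RunPath.X (s + w + i + 1) ω) + I - I * N.indicator (fun _ => (1 : ℝ)) (s + w + i + 1) -
        penalty post I θ (est (s + w + i + 1) ω) (RunPath.A (s + w + i + 1) ω)
          (RunPath.X (s + w + i + 1) ω) ≤ z i := by
      intro i
      have hA0 : 0 ≤ (actionInfo pre (post θ) (RunPath.A (s + w + i + 1) ω)).toReal :=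
        ENNReal.toReal_nonneg
      simp only [hz, centredLLR, penalty]
      by_cases he : est (s + w + i + 1) ω = θ
      · rw [if_pos he, he, logLR_self, max_self]
        by_cases hN : s + w + i + 1 ∈ N
        · rw [Set.indicator_of_mem hN]
          linarith
        · rw [Set.indicator_of_notMem hN]
          have := (hIa (RunPath.A (s + w + i + 1) ω)).2 fun a' => by
            have := hW.exploit (s + w + i + 1) (by omega) hN ω a'
            rwa [he, ← (hω i).2] at this
          linarith
      · rw [if_neg he]
        have : 0 ≤ I * N.indicator (fun _ => (1 : ℝ)) (s + w + i + 1) :=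
          mul_nonneg hI0 (Set.indicator_nonneg (fun _ _ => zero_le_one) _)
        linarith
    have hsum := Finset.sum_le_sum fun i (_ : i ∈ Finset.range k) => hzi i
    simp only [Finset.sum_sub_distrib, Finset.sum_add_distrib, ← Finset.mul_sum,
      sum_range_indicator_eq_exploreCount, Finset.sum_const, Finset.card_range, nsmul_eq_mul]
      at hsum
    have hcount := mul_le_mul_of_nonneg_left (hES.exploreCount_le (m := s + w) (by omega) k) hI0
    have := (abs_lt.1 h1).1
    linarith
  calc _ ≤ P ((B ∩ S₁) ∪ (B ∩ S₂)) := measure_mono_ae hsub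
    _ ≤ P (B ∩ S₁) + P (B ∩ S₂) := measure_union_le _ _
    _ ≤ ENNReal.ofReal (V / (η ^ 2 * k)) * P B +
        ENNReal.ofReal (Nat.card Θ * (C + I) * ρ ^ (q - 1) / η) * P B := by
        refine add_le_add ?_ (lawChange_sum_penalty_ge_le hW hI0 hC hρ1 hρ hν hk hη hB)
        exact lawChange_centred_sum_ge_le hV π ν (s + w) (by omega) hk hη
          ((history 𝔸 E).mono (by omega) _ hB)
    _ = _ := by rw [ENNReal.ofReal_add (by positivity) (by positivity), add_mul]

/-- The bound on missing an alarm in a block of length `w + k` holds from every past, so the tail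
over successive blocks is geometric and sums to the inverse factor. For `δ ≥ 1` the right side is
infinite. -/
theorem lordenDelay_cusumTime_le (hW : IsWindowedChernoff pre post q w N π est) {θ : Θ}
    {V C ρ : ℝ≥0}
    (hV : ∀ a, ∫⁻ x, (logRatio (post θ a) (pre a) x).abs ^ 2 ∂(post θ a).toMeasure ≤ V)
    (hac : ∀ ϑ a, (post θ a).toMeasure ≪ (post ϑ a).toMeasure)
    (hC : ∀ ϑ a, ∫⁻ x, ENNReal.ofReal (logLR (post θ a) (post ϑ a) x) ∂(post θ a).toMeasure ≤ C)
    (hρ1 : ρ ≤ 1) (hρ : ∀ ϑ, ϑ ≠ θ →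
      ∫⁻ a, bhattacharyya (post θ a) (post ϑ a) ∂(uniformAction 𝔸) ≤ ρ)
    {I : ℝ} (hI : (maxInfo pre (post θ)).toReal = I) {k : ℕ} (hk : 0 < k) {η b : ℝ} (hη : 0 < η)
    (hb : b ≤ (I - 2 * η) * k - I * ((k / w + 1) * q)) :
    lordenDelay pre (post θ) (π, cusumTime pre post w est b) ≤ ((w + k : ℕ) : ℝ≥0∞) *
      (1 - ENNReal.ofReal (V / (η ^ 2 * k) + Nat.card Θ * (C + I) * ρ ^ (q - 1) / η))⁻¹ := by
  set δ := ENNReal.ofReal (V / (η ^ 2 * k) + Nat.card Θ * (C + I) * ρ ^ (q - 1) / η) with hδ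
  set T := cusumTime pre post w est b
  have hT : ∀ n : ℕ, MeasurableSet[history 𝔸 E n] {ω | T ω = n} :=
    measurableSet_cusumTime_eq hW.measurable_est b
  refine lordenDelay_le_of_forall_setLIntegral _ _ fun s B hB => ?_
  simp only
  set P := lawChange pre (post θ) (s + 1) π
  have hgeo : ∀ j : ℕ, P (B ∩ {ω | ((s + j * (w + k) : ℕ) : ℕ∞) < T ω}) ≤ δ ^ j * P B := by
    intro j
    induction j with
    | zero => simpa using measure_mono Set.inter_subset_left
    | succ j ih =>
      have hBj : MeasurableSet[history 𝔸 E (s + j * (w + k))]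
          (B ∩ {ω | ((s + j * (w + k) : ℕ) : ℕ∞) < T ω}) :=
        ((history 𝔸 E).mono (by omega) _ hB).inter (measurableSet_lt_time hT _)
      have := lawChange_lt_cusumTime_le hW hV hac hC hρ1 hρ hI (ν := s + 1)
        (s := s + j * (w + k)) (by omega) hk hη hb hBj
      refine le_trans (measure_mono fun ω hω => ?_) (this.trans ?_)
      · have h1 : ((s + (j + 1) * (w + k) : ℕ) : ℕ∞) < T ω := hω.2
        rw [show s + (j + 1) * (w + k) = s + j * (w + k) + (w + k) by ring] at h1
        exact ⟨⟨hω.1, show ((s + j * (w + k) : ℕ) : ℕ∞) < T ω from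
          lt_of_le_of_lt (Nat.cast_le.2 (Nat.le_add_right _ _)) h1⟩, h1⟩
      · exact (mul_le_mul_right ih δ).trans (le_of_eq (by ring))
  refine (lintegral_time_sub_le hT (P.restrict B) s (t := w + k) (by omega)).trans ?_
  calc _ ≤ ∑' j : ℕ, ((w + k : ℕ) : ℝ≥0∞) * (δ ^ j * P B) := by
        refine ENNReal.tsum_le_tsum fun j => mul_le_mul_right ?_ _
        rw [Measure.restrict_apply (measurableSet_lt_time' hT _), Set.inter_comm]
        exact hgeo j
    _ = _ := by
        rw [ENNReal.tsum_mul_left, ENNReal.tsum_mul_right, ENNReal.tsum_geometric, mul_assoc]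

end Delay

end

noncomputable section

/-! ### Existence of Windowed Chernoff-CuSum procedures -/

/-- The exploration times are those at which the integer part of `(n - w) q / w` jumps. As `q < w`
the jumps have size at most one, so prefix counts equal these integer parts, and each stretch of
length `w` contains exactly `q` jumps. -/
lemma exists_isExplorationSet {q w : ℕ} (hq : 0 < q) (hqw : q < w) :
    ∃ N, IsExplorationSet q w N := by
  have hw : 0 < w := hq.trans hqw
  set N : Set ℕ := {n | w < n ∧ (n - 1 - w) * q / w < (n - w) * q / w}
  have hcount : ∀ n, exploreCount N w (w + n) = n * q / w := by
    intro n
    induction n with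
    | zero => simp [exploreCount]
    | succ n ih =>
      have hup : (n + 1) * q / w ≤ n * q / w + 1 := by
        rw [add_mul, one_mul, ← Nat.add_div_right _ hw]
        exact Nat.div_le_div_right (by omega)
      have hlo : n * q / w ≤ (n + 1) * q / w := Nat.div_le_div_right (by nlinarith)
      have hmem : w + n + 1 ∈ N ↔ n * q / w < (n + 1) * q / w := by
        change _ ∧ _ ↔ _
        rw [show w + n + 1 - 1 - w = n by omega, show w + n + 1 - w = n + 1 by omega]
        exact and_iff_right (by omega)
      rw [← add_assoc]
      by_cases h : w + n + 1 ∈ N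
      · rw [exploreCount_succ_of_mem (by omega) h, ih]
        have := hmem.1 h
        omega
      · rw [exploreCount_succ_of_notMem (by omega) h, ih]
        have := mt hmem.2 h
        omega
  refine ⟨N, hq, hqw, fun n hn => hn.1, fun n _ => ?_, fun m hm => ?_⟩
  · rw [sum_indicator_eq_exploreCount, hcount]
    refine Nat.cast_div_le.trans (le_of_eq ?_)
    push_cast
    ring
  · rw [sum_indicator_eq_exploreCount, Nat.cast_le]
    obtain ⟨j, rfl⟩ := Nat.exists_eq_add_of_le hm
    have h1 := exploreCount_add N (a := w) (b := w + j) (c := w + j + w) (by omega) (by omega)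
    rw [add_assoc, hcount, hcount, add_mul, Nat.add_mul_div_left _ _ hw] at h1
    rw [add_assoc]
    omega

section Existence

variable {𝔸 E Θ : Type*} [Fintype 𝔸] [Nonempty 𝔸] [MeasurableSpace 𝔸]
  [MeasurableSingletonClass 𝔸] [Finite Θ] [MeasurableSpace E] {lam : Measure E}

lemma measurable_windowLogLik (post : Θ → 𝔸 → Density lam) {w n : ℕ} (hn : w < n) (ϑ : Θ) :
    Measurable[history 𝔸 E (n - 1)] (windowLogLik post w n ϑ) := by
  obtain ⟨s, rfl⟩ : ∃ s, n = s + w + 1 := ⟨n - w - 1, by omega⟩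
  rw [funext (windowLogLik_eq_log_prod post w s ϑ)]
  refine ENNReal.measurable_log.comp (Measurable.coe_nnreal_ennreal ?_)
  exact Finset.measurable_fun_prod _ fun i hi => measurable_comp_action_obs
    (φ := fun a x => (post ϑ a).toFun x) (fun a => (post ϑ a).measurable') (by omega)
    (by have := Finset.mem_range.1 hi; omega)

/-- The selected maximizer depends on `ω` only through the set of maximizers, which takes finitely
many values and varies measurably. -/
lemma exists_measurable_argmax [Nonempty Θ] {Ω : Type*} [MeasurableSpace Ω] {F : Θ → Ω → EReal}
    (hF : ∀ ϑ, Measurable (F ϑ)) :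
    ∃ e : Ω → Θ, (∀ ϑ, MeasurableSet {ω | e ω = ϑ}) ∧ ∀ ω ϑ, F ϑ ω ≤ F (e ω) ω := by
  classical
  set S : Ω → Set Θ := fun ω => {ϑ | ∀ ϑ', F ϑ' ω ≤ F ϑ ω} with hS
  set c : Set Θ → Θ := fun s => if h : s.Nonempty then h.some else Classical.arbitrary Θ with hc
  have hne : ∀ ω, (S ω).Nonempty := fun ω => Finite.exists_max fun ϑ => F ϑ ω
  refine ⟨fun ω => c (S ω), fun ϑ => ?_, fun ω ϑ => ?_⟩
  · have hm : Measurable S := by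
      refine measurable_set_iff.2 fun ϑ => measurableSet_setOfPred.1 ?_
      rw [show {ω | ϑ ∈ S ω} = ⋂ ϑ', {ω | F ϑ' ω ≤ F ϑ ω} by ext ω; simp [hS]]
      exact MeasurableSet.iInter fun ϑ' => measurableSet_le (hF ϑ') (hF ϑ)
    exact hm (Set.to_countable {s | c s = ϑ}).measurableSet
  · have : c (S ω) ∈ S ω := by
      simp only [hc, dif_pos (hne ω)]
      exact (hne ω).some_mem
    exact this ϑ

lemma exists_windowMLE [Nonempty Θ] (post : Θ → 𝔸 → Density lam) (w : ℕ) :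
    ∃ est : ℕ → RunPath 𝔸 E → Θ,
      (∀ n, w < n → ∀ ϑ, MeasurableSet[history 𝔸 E (n - 1)] {ω | est n ω = ϑ}) ∧
      ∀ n, w < n → ∀ ω ϑ, windowLogLik post w n ϑ ω ≤ windowLogLik post w n (est n ω) ω := by
  have h : ∀ n, ∃ e : RunPath 𝔸 E → Θ, w < n →
      (∀ ϑ, MeasurableSet[history 𝔸 E (n - 1)] {ω | e ω = ϑ}) ∧
      ∀ ω ϑ, windowLogLik post w n ϑ ω ≤ windowLogLik post w n (e ω) ω := fun n => by
    by_cases hn : w < n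
    · obtain ⟨e, he⟩ := @exists_measurable_argmax Θ _ _ _ (history 𝔸 E (n - 1)) _
        (measurable_windowLogLik post hn)
      exact ⟨e, fun _ => he⟩
    · exact ⟨fun _ => Classical.arbitrary Θ, fun h => absurd h hn⟩
  choose est hest using h
  exact ⟨est, fun n hn => (hest n hn).1, fun n hn => (hest n hn).2⟩

/-- Needed for the upper bound on the optimal delay, whose statement mentions no particular
procedure. -/
theorem exists_isWindowedChernoff [Nonempty Θ] (pre : 𝔸 → Density lam)
    (post : Θ → 𝔸 → Density lam) {q w : ℕ} (hq : 0 < q) (hqw : q < w) :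
    ∃ N π est, IsWindowedChernoff (E := E) pre post q w N π est := by
  classical
  obtain ⟨N, hN⟩ := exists_isExplorationSet hq hqw
  obtain ⟨est, hest, hmle⟩ := exists_windowMLE post w
  obtain ⟨φ, hφm, hφ⟩ := Measure.exists_measurable_map_eq (uniformAction 𝔸)
  choose best hbest using fun ϑ => Finite.exists_max (actionInfo pre (post ϑ))
  -- A policy receives a finite record while estimators are functions of whole paths. The padding is
  -- irrelevant, because the estimator at time `n + 2` depends only on the first `n + 1` records.
  set ext : ∀ n : ℕ, (Finset.Iic n → Step 𝔸 E) → RunPath 𝔸 E := fun n x i =>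
    if h : i ∈ Finset.Iic n then x ⟨i, h⟩ else x ⟨n, Finset.mem_Iic.2 le_rfl⟩ with hext
  have hextm : ∀ n, Measurable[_, history 𝔸 E (n + 1)] (ext n) := fun n =>
    Measurable.mono (measurable_pi_lambda _ fun i => by
      by_cases h : i ∈ Finset.Iic n
      · simpa only [hext, dif_pos h] using measurable_pi_apply _
      · simpa only [hext, dif_neg h] using measurable_pi_apply _) le_rfl (history_le _)
  have hestm : ∀ n, w < n + 2 → Measurable fun x => best (est (n + 2) (ext n x)) := fun n hn => by
    refine measurable_to_countable' fun a => ?_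
    rw [show (fun x => best (est (n + 2) (ext n x))) ⁻¹' {a} =
      ⋃ ϑ ∈ {ϑ | best ϑ = a}, ext n ⁻¹' {ω | est (n + 2) ω = ϑ} by ext x; simp]
    exact MeasurableSet.biUnion (Set.to_countable _) fun ϑ _ => hextm n (hest (n + 2) hn ϑ)
  set act : ∀ n : ℕ, (Finset.Iic n → Step 𝔸 E) → 𝔸 := fun n x =>
    if n + 2 ≤ w ∨ n + 2 ∈ N then φ (x ⟨n, Finset.mem_Iic.2 le_rfl⟩).2.2
    else best (est (n + 2) (ext n x)) with hact
  have hactm : ∀ n, Measurable (act n) := fun n => by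
    by_cases h : n + 2 ≤ w ∨ n + 2 ∈ N
    · simp only [hact, if_pos h]
      exact hφm.comp (measurable_snd.comp (measurable_snd.comp (measurable_pi_apply _)))
    · simp only [hact, if_neg h]
      exact hestm n (by omega)
  refine ⟨N, ⟨act, hactm⟩, est, hN, hest, hmle, fun n hn h => ⟨φ, hφm, hφ, fun ω => ?_⟩,
    fun n hn h ω a => ?_⟩
  · obtain ⟨n, rfl⟩ := Nat.exists_eq_add_of_le' hn
    simp [Policy.action, hact, if_pos h, RunPath.U]
  · have hw := hN.q_pos.trans hN.q_lt
    obtain ⟨n, rfl⟩ : ∃ k, n = k + 2 := ⟨n - 2, by omega⟩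
    have h' : ¬(n + 2 ≤ w ∨ n + 2 ∈ N) := by simp [h, hn]
    have heq : est (n + 2) (ext n fun i => ω i) = est (n + 2) ω := by
      refine ((hest (n + 2) hn (est (n + 2) ω)).mem_iff_of_agree fun i hi => ?_).2 rfl
      simp only [hext]
      rw [dif_pos (Finset.mem_Iic.2 (by omega))]
    have hπ : Policy.action ⟨act, hactm⟩ (n + 2) ω = best (est (n + 2) ω) := by
      change act n (fun i => ω i) = _
      simp only [hact, if_neg h']
      exact congrArg best heq
    rw [hπ]
    exact hbest _ a

end Existence

end

noncomputable section

/-! ### First-order asymptotics -/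

lemma ENNReal.tendsto_div_ofReal_one {ι : Type*} {l : Filter ι} {u : ι → ℝ≥0∞} {y : ι → ℝ}
    (hy : ∀ᶠ i in l, 0 < y i)
    (hlo : ∀ ε : ℝ, 0 < ε → ε < 1 → ∀ᶠ i in l, ENNReal.ofReal ((1 - ε) * y i) ≤ u i)
    (hup : ∀ ε : ℝ, 0 < ε → ε < 1 → ∀ᶠ i in l, u i ≤ ENNReal.ofReal ((1 + ε) * y i)) :
    Tendsto (fun i => u i / ENNReal.ofReal (y i)) l (𝓝 1) := by
  refine (ENNReal.tendsto_nhds ENNReal.one_ne_top).2 fun ε hε => ?_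
  obtain ⟨δ, hδ0, hδ1, hδ⟩ : ∃ δ : ℝ, 0 < δ ∧ δ < 1 ∧ ENNReal.ofReal δ ≤ ε := by
    obtain ⟨r, hr0, hr⟩ := ENNReal.lt_iff_exists_nnreal_btwn.1 (lt_min hε one_pos)
    refine ⟨r, by exact_mod_cast hr0, by exact_mod_cast hr.trans_le (min_le_right _ _), ?_⟩
    rw [ENNReal.ofReal_coe_nnreal]
    exact hr.le.trans (min_le_left _ _)
  filter_upwards [hy, hlo δ hδ0 hδ1, hup δ hδ0 hδ1] with i hi h1 h2
  have hi0 : ENNReal.ofReal (y i) ≠ 0 := by simpa using hi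
  constructor
  · refine (tsub_le_tsub_left hδ 1).trans ?_
    rw [ENNReal.le_div_iff_mul_le (Or.inl hi0) (Or.inl ENNReal.ofReal_ne_top),
      ← ENNReal.ofReal_one, ← ENNReal.ofReal_sub _ hδ0.le, ← ENNReal.ofReal_mul (by linarith)]
    exact h1
  · refine le_trans ?_ (add_le_add_right hδ 1)
    rw [ENNReal.div_le_iff hi0 ENNReal.ofReal_ne_top, ← ENNReal.ofReal_one,
      ← ENNReal.ofReal_add zero_le_one hδ0.le, ← ENNReal.ofReal_mul (by linarith)]
    exact h2

section Asymptotics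

variable {𝔸 E Θ : Type*} [Fintype 𝔸] [Nonempty 𝔸] [MeasurableSpace 𝔸]
  [MeasurableSingletonClass 𝔸] [MeasurableSpace E] {lam : Measure E}

theorem eventually_le_optimalDelay {pre post : 𝔸 → Density lam} {V : ℝ≥0}
    (hV : ∀ a, ∫⁻ x, (logRatio (post a) (pre a) x).abs ^ 2 ∂(post a).toMeasure ≤ V) {I : ℝ}
    (hI0 : 0 < I) (hI : ∀ a, (actionInfo pre post a).toReal ≤ I) {ε : ℝ} (hε0 : 0 < ε)
    (hε1 : ε < 1) :
    ∀ᶠ γ : ℝ in atTop, ENNReal.ofReal ((1 - ε) * (Real.log γ / I)) ≤ optimalDelay pre post γ := by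
  -- Rounding and the slack in the drift cost a factor `1 - 3κ`, the error probability a factor `1 -
  -- κ`; the product is at least `1 - 4κ = 1 - ε`.
  set κ := ε / 4 with hκ
  set η := κ * I with hη
  have hκ0 : 0 < κ := by positivity
  have hη0 : 0 < η := by positivity
  -- With `η = κ I`, this makes `(I + η) m` at most `(1 - κ) log γ`, so the exponential stays below
  -- `γ` by a power that absorbs the factor `2 m`.
  set m : ℝ → ℕ := fun b => ⌊(1 - κ) * b / ((1 + κ) * I)⌋₊ with hm
  have hc : 0 < (1 - κ) / ((1 + κ) * I) := div_pos (by linarith) (by positivity)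
  have hmtop : Tendsto m atTop atTop := by
    refine tendsto_nat_floor_atTop.comp ?_
    refine (tendsto_id.const_mul_atTop hc).congr fun b => ?_
    simp only [id]
    ring
  have h1 : ∀ᶠ b : ℝ in atTop, V / (η ^ 2 * m b) ≤ κ / 2 := by
    have : Tendsto (fun b => V / η ^ 2 / (m b : ℝ)) atTop (𝓝 0) :=
      (tendsto_natCast_atTop_atTop.comp hmtop).const_div_atTop _
    filter_upwards [this.eventually_le_const (u := κ / 2) (by positivity)] with b hb
    rwa [← div_div]
  have h2 : ∀ᶠ b : ℝ in atTop, 2 / I * (b * Real.exp (-κ * b)) ≤ κ / 2 := by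
    have : Tendsto (fun b : ℝ => 2 / I * (b ^ (1 : ℝ) * Real.exp (-κ * b))) atTop
        (𝓝 (2 / I * 0)) := (tendsto_rpow_mul_exp_neg_mul_atTop_nhds_zero 1 κ hκ0).const_mul _
    rw [mul_zero] at this
    simpa using this.eventually_le_const (u := κ / 2) (by positivity)
  have hev := ((h1.and h2).and ((hmtop.eventually_ge_atTop 1).and
    (eventually_ge_atTop (max 1 (I / κ))))).filter_mono
    (Real.tendsto_log_atTop : Tendsto Real.log atTop atTop)
  filter_upwards [hev, eventually_gt_atTop 0] with γ hγ hγ0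
  obtain ⟨⟨h1, h2⟩, hm1, hb⟩ := hγ
  set b := Real.log γ with hbdef
  have hb1 : 1 ≤ b := (le_max_left _ _).trans hb
  have hbκ : 1 ≤ κ * (b / I) := by
    have := (div_le_iff₀ hκ0).1 ((le_max_right _ _).trans hb)
    rw [mul_div_assoc', le_div_iff₀ hI0]
    linarith
  have hγb : γ = Real.exp b := (Real.exp_log hγ0).symm
  have hy0 : 0 < b / I := by positivity
  have hmle : (m b : ℝ) ≤ (1 - κ) * b / ((1 + κ) * I) :=
    Nat.floor_le (div_nonneg (mul_nonneg (by linarith) (by linarith)) (by positivity))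
  have hmI : (I + η) * m b ≤ (1 - κ) * b := by
    have := (le_div_iff₀ (by positivity)).1 hmle
    rw [hη]
    linarith
  have hmb : (m b : ℝ) ≤ b / I := by
    rw [le_div_iff₀ hI0]
    have : (0 : ℝ) ≤ η * m b := by positivity
    nlinarith
  have hmge : (1 - 3 * κ) * (b / I) ≤ m b := by
    have h3 : (1 - κ) * b / ((1 + κ) * I) < m b + 1 := Nat.lt_floor_add_one _
    have h4 : (1 - 2 * κ) * (b / I) ≤ (1 - κ) * b / ((1 + κ) * I) := by
      rw [le_div_iff₀ (by positivity)]
      have : (1 - 2 * κ) * (b / I) * ((1 + κ) * I) = (1 - 2 * κ) * (1 + κ) * b := by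
        field_simp
      rw [this]
      exact mul_le_mul_of_nonneg_right (by nlinarith) (by linarith)
    linarith
  have hδ : Real.exp ((I + η) * m b) * (2 * m b / γ) + V / (η ^ 2 * m b) ≤ κ := by
    have h3 : Real.exp ((I + η) * m b) * (2 * m b / γ) ≤ 2 / I * (b * Real.exp (-κ * b)) := by
      calc _ ≤ Real.exp ((1 - κ) * b) * (2 * (b / I) / γ) := by gcongr
        _ = 2 / I * (b * (Real.exp ((1 - κ) * b) / Real.exp b)) := by rw [← hγb]; ring
        _ = _ := by rw [← Real.exp_sub]; ring_nf
    linarith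
  refine le_iInf₂ fun p hp => le_trans ?_ (le_lordenDelay_of_mem_procedureClass hV hI hγ0 hp hm1 hη0)
  refine le_trans ?_ (mul_le_mul_right (tsub_le_tsub_left (ENNReal.ofReal_le_ofReal hδ) 1) _)
  rw [← ENNReal.ofReal_one, ← ENNReal.ofReal_sub _ hκ0.le, ← ENNReal.ofReal_natCast,
    ← ENNReal.ofReal_mul (Nat.cast_nonneg _)]
  refine ENNReal.ofReal_le_ofReal ?_
  calc (1 - ε) * (b / I) ≤ (1 - 3 * κ) * (1 - κ) * (b / I) :=
        mul_le_mul_of_nonneg_right (by nlinarith) hy0.le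
    _ = (1 - 3 * κ) * (b / I) * (1 - κ) := by ring
    _ ≤ m b * (1 - κ) := mul_le_mul_of_nonneg_right hmge (by linarith)

theorem eventually_lordenDelay_cusumTime_le [Finite Θ] {pre : 𝔸 → Density lam}
    {post : Θ → 𝔸 → Density lam} {θ : Θ} {V C ρ : ℝ≥0}
    (hV : ∀ a, ∫⁻ x, (logRatio (post θ a) (pre a) x).abs ^ 2 ∂(post θ a).toMeasure ≤ V)
    (hac : ∀ ϑ a, (post θ a).toMeasure ≪ (post ϑ a).toMeasure)
    (hC : ∀ ϑ a, ∫⁻ x, ENNReal.ofReal (logLR (post θ a) (post ϑ a) x) ∂(post θ a).toMeasure ≤ C)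
    (hρ1 : ρ < 1) (hρ : ∀ ϑ, ϑ ≠ θ →
      ∫⁻ a, bhattacharyya (post θ a) (post ϑ a) ∂(uniformAction 𝔸) ≤ ρ)
    {I : ℝ} (hI0 : 0 < I) (hI : (maxInfo pre (post θ)).toReal = I)
    {ι : Type*} {l : Filter ι} {b : ι → ℝ} {q w : ι → ℕ} {N : ι → Set ℕ}
    {π : ι → Policy 𝔸 E} {est : ι → ℕ → RunPath 𝔸 E → Θ} (hb : Tendsto b l atTop)
    (hq : Tendsto q l atTop) (hqw : (fun i => (q i : ℝ)) =o[l] (fun i => (w i : ℝ)))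
    (hwb : (fun i => (w i : ℝ)) =o[l] b)
    (hW : ∀ i, IsWindowedChernoff pre post (q i) (w i) (N i) (π i) (est i)) {ε : ℝ} (hε0 : 0 < ε) :
    ∀ᶠ i in l, lordenDelay pre (post θ) (π i, cusumTime pre post (w i) (est i) (b i)) ≤
      ENNReal.ofReal ((1 + ε) * (b i / I)) := by
  -- The condition `κ (4 + ε) ≤ ε` makes `(1 + 11κ/4) / (1 - κ)` at most `1 + ε`. In units of `b /
  -- I`, the numerator bounds `w + k`: `κ/4` from the window, `2κ` from the margin in `k`, `κ/2`
  -- from rounding up.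
  set κ := min (1 / 2) (ε / (4 + ε)) with hκ
  have hκ0 : 0 < κ := by positivity
  have hκ1 : κ ≤ 1 / 2 := min_le_left _ _
  have hκε : κ * (4 + ε) ≤ ε := (le_div_iff₀ (by positivity)).1 (min_le_right _ _)
  set η := κ * I / 4 with hη
  have hη0 : 0 < η := by positivity
  -- The margin `2κ` compensates the drift lost to `η`, to the exploration fraction `q / w` and to
  -- the additive term `I q`.
  set k : ι → ℕ := fun i => ⌈b i * (1 + 2 * κ) / I⌉₊ with hk
  have hktop : Tendsto k l atTop := by
    refine tendsto_nat_ceil_atTop.comp ?_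
    exact (hb.atTop_mul_const (by positivity)).atTop_div_const hI0
  have h1 : ∀ᶠ i in l, V / (η ^ 2 * k i) ≤ κ / 2 := by
    have : Tendsto (fun i => V / η ^ 2 / (k i : ℝ)) l (𝓝 0) :=
      (tendsto_natCast_atTop_atTop.comp hktop).const_div_atTop _
    filter_upwards [this.eventually_le_const (u := κ / 2) (by positivity)] with i hi
    rwa [← div_div]
  have h2 : ∀ᶠ i in l, Nat.card Θ * (C + I) * (ρ : ℝ) ^ (q i - 1) / η ≤ κ / 2 := by
    have : Tendsto (fun i => Nat.card Θ * (C + I) * (ρ : ℝ) ^ (q i - 1) / η) l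
        (𝓝 (Nat.card Θ * (C + I) * 0 / η)) :=
      ((((tendsto_pow_atTop_nhds_zero_of_lt_one ρ.2 (by exact_mod_cast hρ1)).comp
        (tendsto_sub_atTop_nat 1)).comp hq).const_mul _).div_const _
    rw [mul_zero, zero_div] at this
    exact this.eventually_le_const (by positivity)
  filter_upwards [h1, h2, hktop.eventually_ge_atTop 1, hb.eventually_ge_atTop (2 * I / κ),
    hb.eventually_gt_atTop 0, hqw.bound (show 0 < κ / 4 by positivity),
    hwb.bound (show 0 < κ / (4 * I) by positivity)] with i h1 h2 hk1 hbi hb0 hqi hwi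
  have hES := (hW i).exploration_set
  have hw0 : (0 : ℝ) < w i := by exact_mod_cast hES.q_pos.trans hES.q_lt
  have hy0 : 0 < b i / I := by positivity
  simp only [Real.norm_eq_abs, Nat.abs_cast, abs_of_pos hb0] at hqi hwi
  have hbκ : 2 ≤ κ * (b i / I) := by
    have := (div_le_iff₀ hκ0).1 hbi
    rw [mul_div_assoc', le_div_iff₀ hI0]
    linarith
  have hwi' : w i ≤ κ / 4 * (b i / I) := hwi.trans (le_of_eq (by field_simp))
  have hkge : b i / I * (1 + 2 * κ) ≤ k i := by
    refine le_trans (le_of_eq ?_) (Nat.le_ceil _)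
    ring
  have hkle : (k i : ℝ) ≤ b i / I * (1 + 2 * κ) + 1 := by
    refine (Nat.ceil_lt_add_one (by positivity)).le.trans (le_of_eq ?_)
    ring
  have hbk : b i ≤ (I - 2 * η) * k i - I * ((k i / w i + 1) * q i) := by
    have h3 : (k i : ℝ) / w i * q i ≤ k i * (κ / 4) := by
      rw [div_mul_eq_mul_div, div_le_iff₀ hw0]
      have := mul_le_mul_of_nonneg_left hqi (Nat.cast_nonneg (α := ℝ) (k i))
      linarith
    have h4 : (q i : ℝ) ≤ κ / 4 * (b i / I) :=
      (Nat.cast_le.2 hES.q_lt.le).trans hwi'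
    have h5 : b i / I ≤ (1 - 3 * κ / 4) * k i - κ / 4 * (b i / I) := by
      have h6 := mul_le_mul_of_nonneg_left hkge (show 0 ≤ 1 - 3 * κ / 4 by linarith)
      have h7 : 0 ≤ b i / I * (κ * (1 - 3 * κ / 2)) :=
        mul_nonneg hy0.le (mul_nonneg hκ0.le (by linarith))
      linarith
    have h8 : b i / I ≤ (1 - κ / 2) * k i - (k i / w i + 1) * q i := by linarith
    have h9 := mul_le_mul_of_nonneg_left h8 hI0.le
    rw [mul_div_cancel₀ _ hI0.ne'] at h9
    rw [hη]
    linarith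
  have hδ : V / (η ^ 2 * k i) + Nat.card Θ * (C + I) * (ρ : ℝ) ^ (q i - 1) / η ≤ κ := by
    linarith
  refine (lordenDelay_cusumTime_le (hW i) hV hac hC hρ1.le hρ hI hk1 hη0 hbk).trans ?_
  refine (mul_le_mul_right (ENNReal.inv_le_inv.2
    (tsub_le_tsub_left (ENNReal.ofReal_le_ofReal hδ) 1)) _).trans ?_
  rw [← ENNReal.ofReal_one, ← ENNReal.ofReal_sub _ hκ0.le, ← ENNReal.ofReal_natCast,
    ← ENNReal.ofReal_inv_of_pos (by linarith), ← ENNReal.ofReal_mul (Nat.cast_nonneg _)]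
  refine ENNReal.ofReal_le_ofReal ?_
  rw [← div_eq_mul_inv, div_le_iff₀ (by linarith)]
  push_cast
  have h3 : 0 ≤ (b i / I) * (ε - κ * (4 + ε)) := mul_nonneg hy0.le (by linarith)
  linarith

end Asymptotics

end

noncomputable section

lemma ENNReal.exists_nnreal_bound_of_forall_lt {α : Type*} [Finite α] {f : α → ℝ≥0∞} {c : ℝ≥0∞}
    (hc : 0 < c) (h : ∀ a, f a < c) : ∃ C : ℝ≥0, (C : ℝ≥0∞) < c ∧ ∀ a, f a ≤ C := by
  rcases isEmpty_or_nonempty α with hα | hα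
  · exact ⟨0, by simpa using hc, fun a => hα.elim a⟩
  · obtain ⟨a, ha⟩ := Finite.exists_max f
    refine ⟨(f a).toNNReal, ?_, fun a' => ?_⟩ <;>
      rw [ENNReal.coe_toNNReal (h a).ne_top]
    exacts [h a, ha a']

/-! ### Uniform constants, attainment of the bound, and the main theorem. -/

section Optimality

variable {𝔸 E Θ : Type*} [Fintype 𝔸] [Nonempty 𝔸] [MeasurableSpace 𝔸]
  [MeasurableSingletonClass 𝔸] [Finite Θ] [MeasurableSpace E] {lam : Measure E}
  {pre : 𝔸 → Density lam} {post : Θ → 𝔸 → Density lam} {V : ℝ≥0}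

lemma maxInfo_lt_top {post : 𝔸 → Density lam} (h : ∀ a, actionInfo pre post a < ∞) :
    maxInfo pre post < ∞ := by
  obtain ⟨C, hC, hle⟩ := ENNReal.exists_nnreal_bound_of_forall_lt ENNReal.zero_lt_top h
  exact (iSup_le hle).trans_lt hC

lemma actionInfo_lt_top {post : 𝔸 → Density lam}
    (hV : ∀ a, ∫⁻ x, (logRatio (post a) (pre a) x).abs ^ 2 ∂(post a).toMeasure < V) (a : 𝔸) :
    actionInfo pre post a < ∞ :=
  klDiv_lt_top_of_sq ((hV a).trans ENNReal.coe_lt_top)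

lemma toReal_maxInfo_pos {post : 𝔸 → Density lam} (hfin : maxInfo pre post < ∞)
    (h : ∃ a, 0 < actionInfo pre post a) : 0 < (maxInfo pre post).toReal := by
  obtain ⟨a, ha⟩ := h
  exact ENNReal.toReal_pos (ha.trans_le (le_iSup _ a)).ne' hfin.ne

/-- The uniform law charges every action, so one discriminating action makes the average strict. -/
lemma lintegral_bhattacharyya_lt_one {f h : 𝔸 → Density lam}
    (hne : ∃ a, 0 < InformationTheory.klDiv (f a).toMeasure (h a).toMeasure) :
    ∫⁻ a, bhattacharyya (f a) (h a) ∂(uniformAction 𝔸) < 1 := by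
  obtain ⟨a, ha⟩ := hne
  have h0 : uniformAction 𝔸 {a} ≠ 0 := by
    rw [uniformAction, PMF.toMeasure_apply_singleton _ _ (measurableSet_singleton a)]
    simp
  have h1 : ∫⁻ a, bhattacharyya (f a) (h a) ∂(uniformAction 𝔸) ≤ 1 :=
    (lintegral_mono fun a => bhattacharyya_le_one _ _).trans (by simp)
  refine (lintegral_strict_mono_of_ae_le_of_ae_lt_on (μ := uniformAction 𝔸)
    (f := fun a => bhattacharyya (f a) (h a)) (g := fun _ => 1) aemeasurable_const
    (ne_top_of_le_ne_top ENNReal.one_ne_top h1)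
    (ae_of_all _ fun a => bhattacharyya_le_one _ _) h0 (ae_of_all _ fun a' ha' => ?_)).trans_le
    (by simp)
  rw [Set.mem_singleton_iff.1 ha']
  exact bhattacharyya_lt_one ha

/-- Finiteness of `Θ` and `𝔸` turns the pointwise assumptions into one bound `C` on losses and one
contraction factor `ρ < 1`. -/
theorem exists_eventually_delay_le
    (hdetect : ∀ θ, ∃ a, 0 < actionInfo pre (post θ) a)
    (hmoment : ∀ θ a, ∫⁻ x, (logRatio (post θ a) (pre a) x).abs ^ 2 ∂(post θ a).toMeasure < V)
    (hdist : ∀ θ θ' : Θ, θ ≠ θ' →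
      ∃ a, 0 < InformationTheory.klDiv (post θ a).toMeasure (post θ' a).toMeasure)
    (hfinite : ∀ (θ θ' : Θ) (a : 𝔸),
      InformationTheory.klDiv (post θ a).toMeasure (post θ' a).toMeasure < ∞) (θ : Θ)
    {ι : Type*} {l : Filter ι} {b : ι → ℝ} {q w : ι → ℕ} {N : ι → Set ℕ}
    {π : ι → Policy 𝔸 E} {est : ι → ℕ → RunPath 𝔸 E → Θ} (hb : Tendsto b l atTop)
    (hq : Tendsto q l atTop) (hqw : (fun i => (q i : ℝ)) =o[l] (fun i => (w i : ℝ)))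
    (hwb : (fun i => (w i : ℝ)) =o[l] b)
    (hW : ∀ i, IsWindowedChernoff pre post (q i) (w i) (N i) (π i) (est i)) {ε : ℝ} (hε0 : 0 < ε) :
    ∀ᶠ i in l, lordenDelay pre (post θ) (π i, cusumTime pre post (w i) (est i) (b i)) ≤
      ENNReal.ofReal ((1 + ε) * (b i / (maxInfo pre (post θ)).toReal)) := by
  have hfin := maxInfo_lt_top (actionInfo_lt_top (hmoment θ))
  obtain ⟨C, -, hC⟩ := ENNReal.exists_nnreal_bound_of_forall_lt (α := Θ × 𝔸)
    ENNReal.zero_lt_top fun p => lintegral_logLR_lt_top (hfinite θ p.1 p.2).ne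
  obtain ⟨ρ, hρ1, hρ⟩ := ENNReal.exists_nnreal_bound_of_forall_lt (α := {ϑ // ϑ ≠ θ}) one_pos
    fun ϑ => lintegral_bhattacharyya_lt_one (hdist θ ϑ ϑ.2.symm)
  exact eventually_lordenDelay_cusumTime_le (fun a => (hmoment θ a).le)
    (fun ϑ a => (InformationTheory.klDiv_ne_top_iff.1 (hfinite θ ϑ a).ne).1)
    (fun ϑ a => hC (ϑ, a)) (by exact_mod_cast hρ1) (fun ϑ h => hρ ⟨ϑ, h⟩)
    (toReal_maxInfo_pos hfin (hdetect θ)) rfl hb hq hqw hwb hW hε0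

theorem cusumTime_mem_procedureClass {q w : ℕ} {N : Set ℕ} {π : Policy 𝔸 E}
    {est : ℕ → RunPath 𝔸 E → Θ} (hW : IsWindowedChernoff pre post q w N π est) {γ : ℝ}
    (hγ : 0 < γ) : (π, cusumTime pre post w est (Real.log γ)) ∈ procedureClass pre γ := by
  refine ⟨measurableSet_cusumTime_eq hW.measurable_est _, ?_⟩
  have := le_lintegral_cusumTime hW.measurable_est (pre := pre) (post := post) π (Real.log γ)
  rwa [Real.exp_log hγ] at this

/-- Window lengths and numbers of exploration times satisfying the growth conditions. -/
lemma exists_window_growth {b : ℝ → ℝ} (hb : Tendsto b atTop atTop) :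
    ∃ q w : ℝ → ℕ, (∀ γ, 0 < q γ ∧ q γ < w γ) ∧ Tendsto q atTop atTop ∧
      (fun γ => (q γ : ℝ)) =o[atTop] (fun γ => (w γ : ℝ)) ∧
      (fun γ => (w γ : ℝ)) =o[atTop] b := by
  -- The window grows like the root of `b` and `q` is the integer root of `w`; adding `4` gives `0 <
  -- q < w` for every `γ`.
  set w : ℝ → ℕ := fun γ => ⌊√(b γ)⌋₊ + 4 with hw
  have hsq : Tendsto (fun γ => √(b γ)) atTop atTop := Real.tendsto_sqrt_atTop.comp hb
  have hwtop : Tendsto w atTop atTop :=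
    tendsto_atTop_mono (fun _ => Nat.le_add_right _ _) (tendsto_nat_floor_atTop.comp hsq)
  have hw4 : ∀ γ, 4 ≤ w γ := fun γ => Nat.le_add_left _ _
  have hqtop : Tendsto (fun γ => Nat.sqrt (w γ)) atTop atTop := by
    refine Tendsto.comp (g := Nat.sqrt) (tendsto_atTop.2 fun n => ?_) hwtop
    filter_upwards [eventually_ge_atTop (n * n)] with m hm
    exact Nat.le_sqrt.2 hm
  refine ⟨fun γ => Nat.sqrt (w γ), w, fun γ => ⟨Nat.sqrt_pos.2 (by linarith [hw4 γ]),
    Nat.sqrt_lt_self (by linarith [hw4 γ])⟩, hqtop, isLittleO_iff.2 fun c hc => ?_,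
    isLittleO_iff.2 fun c hc => ?_⟩
  · filter_upwards [(tendsto_natCast_atTop_atTop.comp hqtop).eventually_ge_atTop (1 / c)] with γ hγ
    have h1 : (Nat.sqrt (w γ) : ℝ) * Nat.sqrt (w γ) ≤ w γ := by exact_mod_cast Nat.sqrt_le (w γ)
    have h2 := (div_le_iff₀' hc).1 hγ
    simp only [Real.norm_eq_abs, Nat.abs_cast, Function.comp_apply] at h2 ⊢
    nlinarith [Nat.cast_nonneg (α := ℝ) (Nat.sqrt (w γ))]
  · filter_upwards [hsq.eventually_ge_atTop (max 4 (2 / c)), hb.eventually_ge_atTop 0]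
      with γ hγ hb0
    have h1 : (w γ : ℝ) ≤ √(b γ) + 4 := by
      have := Nat.floor_le (Real.sqrt_nonneg (b γ))
      simp only [hw]
      push_cast
      linarith
    have h2 := (div_le_iff₀' hc).1 ((le_max_right _ _).trans hγ)
    have h3 := (le_max_left _ _).trans hγ
    have h4 := Real.mul_self_sqrt hb0
    rw [Real.norm_eq_abs, Nat.abs_cast, Real.norm_eq_abs, abs_of_nonneg hb0]
    nlinarith

theorem tendsto_optimalDelay_div
    (hdetect : ∀ θ, ∃ a, 0 < actionInfo pre (post θ) a)
    (hmoment : ∀ θ a, ∫⁻ x, (logRatio (post θ a) (pre a) x).abs ^ 2 ∂(post θ a).toMeasure < V)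
    (hdist : ∀ θ θ' : Θ, θ ≠ θ' →
      ∃ a, 0 < InformationTheory.klDiv (post θ a).toMeasure (post θ' a).toMeasure)
    (hfinite : ∀ (θ θ' : Θ) (a : 𝔸),
      InformationTheory.klDiv (post θ a).toMeasure (post θ' a).toMeasure < ∞) (θ : Θ) :
    Tendsto (fun γ : ℝ => optimalDelay pre (post θ) γ /
      ENNReal.ofReal (Real.log γ / (maxInfo pre (post θ)).toReal)) atTop (𝓝 1) := by
  have hfin := maxInfo_lt_top (actionInfo_lt_top (hmoment θ))
  have hI0 := toReal_maxInfo_pos hfin (hdetect θ)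
  have : Nonempty Θ := ⟨θ⟩
  obtain ⟨q, w, hlt, hq, hqw, hwb⟩ := exists_window_growth Real.tendsto_log_atTop
  choose N π est hW using fun γ : ℝ =>
    exists_isWindowedChernoff (E := E) pre post (hlt γ).1 (hlt γ).2
  refine ENNReal.tendsto_div_ofReal_one ?_ (fun ε hε0 hε1 => ?_) fun ε hε0 _ => ?_
  · filter_upwards [Real.tendsto_log_atTop.eventually_gt_atTop 0] with γ hγ
    positivity
  · exact eventually_le_optimalDelay (fun a => (hmoment θ a).le) hI0
      (fun a => ENNReal.toReal_mono hfin.ne (le_iSup _ a)) hε0 hε1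
  · filter_upwards [exists_eventually_delay_le hdetect hmoment hdist hfinite θ
      Real.tendsto_log_atTop hq hqw hwb hW hε0, eventually_gt_atTop 0] with γ hγ hγ0
    exact (iInf₂_le _ (cusumTime_mem_procedureClass (hW γ) hγ0)).trans hγ

end Optimality

theorem mainTheorem1 {𝔸 Θ E : Type*} [Fintype 𝔸] [Nontrivial 𝔸] [MeasurableSpace 𝔸]
    [MeasurableSingletonClass 𝔸] [Finite Θ] [MeasurableSpace E] (lam : Measure E)
    (pre : 𝔸 → Density lam) (post : Θ → 𝔸 → Density lam)
    (hdetect : ∀ θ, ∃ a, 0 < actionInfo pre (post θ) a)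
    (V : ℝ≥0)
    (hmoment : ∀ θ a, ∫⁻ x, (logRatio (post θ a) (pre a) x).abs ^ 2 ∂(post θ a).toMeasure < V)
    (hdist : ∀ θ θ' : Θ, θ ≠ θ' →
      ∃ a, 0 < InformationTheory.klDiv (post θ a).toMeasure (post θ' a).toMeasure)
    (hfinite : ∀ (θ θ' : Θ) (a : 𝔸),
      InformationTheory.klDiv (post θ a).toMeasure (post θ' a).toMeasure < ∞) :
    (∀ θ, Tendsto (fun γ : ℝ =>
        optimalDelay pre (post θ) γ / (ENNReal.ofReal (Real.log γ) / maxInfo pre (post θ)))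
      atTop (𝓝 1)) ∧
    ∀ (ι : Type*) (l : Filter ι) (γ : ι → ℝ) (q w : ι → ℕ) (N : ι → Set ℕ)
      (π : ι → Policy 𝔸 E) (est : ι → ℕ → RunPath 𝔸 E → Θ),
      Tendsto γ l atTop → Tendsto q l atTop → Tendsto w l atTop →
      (fun i => (q i : ℝ)) =o[l] (fun i => (w i : ℝ)) →
      (fun i => (w i : ℝ)) =o[l] (fun i => Real.log (γ i)) →
      (∀ i, IsWindowedChernoff pre post (q i) (w i) (N i) (π i) (est i)) →
      (∀ i, 1 < γ i →
        (π i, cusumTime pre post (w i) (est i) (Real.log (γ i))) ∈ procedureClass pre (γ i)) ∧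
      ∀ θ,
        Tendsto (fun i =>
          lordenDelay pre (post θ) (π i, cusumTime pre post (w i) (est i) (Real.log (γ i))) /
            optimalDelay pre (post θ) (γ i)) l (𝓝 1) ∧
        Tendsto (fun i =>
          lordenDelay pre (post θ) (π i, cusumTime pre post (w i) (est i) (Real.log (γ i))) /
            (ENNReal.ofReal (Real.log (γ i)) / maxInfo pre (post θ))) l (𝓝 1) ∧
        Tendsto (fun i =>
          optimalDelay pre (post θ) (γ i) /
            (ENNReal.ofReal (Real.log (γ i)) / maxInfo pre (post θ))) l (𝓝 1) := by
  have hfin : ∀ θ, maxInfo pre (post θ) < ∞ := fun θ =>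
    maxInfo_lt_top (actionInfo_lt_top (hmoment θ))
  have hI0 : ∀ θ, 0 < (maxInfo pre (post θ)).toReal := fun θ =>
    toReal_maxInfo_pos (hfin θ) (hdetect θ)
  have hrate : ∀ θ (γ : ℝ), ENNReal.ofReal (Real.log γ) / maxInfo pre (post θ) =
      ENNReal.ofReal (Real.log γ / (maxInfo pre (post θ)).toReal) := fun θ γ => by
    rw [ENNReal.ofReal_div_of_pos (hI0 θ), ENNReal.ofReal_toReal (hfin θ).ne]
  simp only [hrate]
  have hopt := tendsto_optimalDelay_div hdetect hmoment hdist hfinite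
  refine ⟨hopt, fun ι l γ q w N π est hγ hq _ hqw hwb hW =>
    ⟨fun i hi => cusumTime_mem_procedureClass (hW i) (one_pos.trans hi), fun θ => ?_⟩⟩
  have hlog := Real.tendsto_log_atTop.comp hγ
  have hoptγ := (hopt θ).comp hγ
  have hpos : ∀ᶠ i in l, 0 < Real.log (γ i) / (maxInfo pre (post θ)).toReal := by
    filter_upwards [hlog.eventually_gt_atTop 0] with i hi
    exact div_pos hi (hI0 θ)
  have hdelay : Tendsto (fun i =>
      lordenDelay pre (post θ) (π i, cusumTime pre post (w i) (est i) (Real.log (γ i))) /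
        ENNReal.ofReal (Real.log (γ i) / (maxInfo pre (post θ)).toReal)) l (𝓝 1) := by
    refine ENNReal.tendsto_div_ofReal_one hpos (fun ε hε0 hε1 => ?_) fun ε hε0 _ =>
      exists_eventually_delay_le hdetect hmoment hdist hfinite θ hlog hq hqw hwb hW hε0
    filter_upwards [hγ.eventually (eventually_le_optimalDelay (fun a => (hmoment θ a).le) (hI0 θ)
      (fun a => ENNReal.toReal_mono (hfin θ).ne (le_iSup _ a)) hε0 hε1),
      hγ.eventually_gt_atTop 0] with i hi hi0
    exact hi.trans (iInf₂_le _ (cusumTime_mem_procedureClass (hW i) hi0))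
  refine ⟨?_, hdelay, hoptγ⟩
  -- Both delays are equivalent to the same rate, which is eventually positive and finite and
  -- cancels in the quotient.
  have hdiv := ENNReal.Tendsto.div hdelay (Or.inl one_ne_zero) hoptγ (Or.inl ENNReal.one_ne_top)
  rw [div_one] at hdiv
  refine hdiv.congr' ?_
  filter_upwards [hpos] with i hi
  have h0 : ENNReal.ofReal (Real.log (γ i) / (maxInfo pre (post θ)).toReal) ≠ 0 := by simpa using hi
  simp only [Function.comp_apply, div_eq_mul_inv _ (ENNReal.ofReal _)]
  exact ENNReal.mul_div_mul_right _ _ (ENNReal.inv_ne_zero.2 ENNReal.ofReal_ne_top)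
    (ENNReal.inv_ne_top.2 h0)

end
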